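/- Let $G=(V,E)$ be a finite simple connected graph. A set $M\subseteq V$ is a \emph{robust MIS} (RMIS) of a connected graph if it is a maximal independent set (MIS) of every connected spanning subgraph of it, including the graph itself. A graph is \emph{biconnected} if it has at least three vertices, is connected, and stays connected after removal of any single vertex; a \emph{biconnected component} of $G$ is a maximal biconnected subgraph. If $G$ has no biconnected component, then $G$ is a tree, all its MISs are robust, and it has one. Suppose from now on that $G$ has a biconnected component. \textbf{Decomposition.} The $\mathcal{ABC}$-tree $T$ of $G$ has as nodes the articulation points ($\mathcal A$), the bridges ($\mathcal B$), the biconnected components ($\mathcal C$) and the pendant (degree-one) vertices ($\mathcal P$) of $G$; a node of $\mathcal A$ is adjacent to the biconnected components that contain it, and a node of $\mathcal A\cup\mathcal P$ is adjacent to the bridges of which it is an end. Root $T$ in an arbitrary $R\in\mathcal C$. The attachment vertex $v(x)$ of a node $x\neq R$ is the vertex underlying $x$ if $x\in\mathcal A\cup\mathcal P$, and the vertex underlying the parent of $x$ if $x\in\mathcal B\cup\mathcal C$. Let $G[T_x]$ be the union of the subgraphs of $G$ induced by $x$ and its descendants (a component inducing itself), and let $G_a[T_x]$ be $G[T_x]$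 with one additional vertex $a$ adjacent to $v(x)$ only. A set $L(x)\subseteq\{PI,PO,PE\}$ is a \emph{correct labeling} of $x$ if: $PI\in L(x)$ iff $G[T_x]$ has an RMIS containing $v(x)$; $PO\in L(x)$ iff $G[T_x]$ has an RMIS not containing $v(x)$; $PE\in L(x)$ iff $PO\notin L(x)$ and $G_a[T_x]$ has an RMIS not containing $v(x)$. \textbf{Procedure isSatisfiable}$(x,flag)$, for $x\in\mathcal C$ with label sets $L(w)$ on its vertices ($L(w)=\emptyset$ for vertices without constraint) and $flag\in\{in,out,none\}$. Delete from $x$ all edges both of whose ends have label $PO$; call the result $X$. If $X$ is not bipartite, return false. Otherwise take one Boolean variable per connected component of $X$ and give the vertices on its two sides opposite literals $\ell(\cdot)$. Let $F$ consist of the clauses $\ell(w)$ whenever $L(w)=\{PI\}$, $\neg\ell(w)$ whenever $L(w)=\{PO\}$ or $L(w)=\{PE\}$, $\neg\ell(u)\vee\neg\ell(w)$ for every deleted edge $\{u,w\}$, and, for a distinguished vertex $v$ (the attachment vertex $v(x)$ in the algorithm), $\ell(v)$ if $flag=in$, $\neg\ell(v)$ if $flag=out$. Return whether the 2-SAT formula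 $F$ is satisfiable. \textbf{Algorithm.} Label the nodes $x\ne R$ bottom-up, starting from $L(x)=\emptyset$: if $x\in\mathcal P$, $L(x)=\{PI,PE\}$. If $x\in\mathcal A$: add $PI$ if all children have $PI$; if every child has $PO$ or $PE$, add $PO$ if some child has $PO$, and $PE$ otherwise. If $x\in\mathcal B$ with child $y$: add $PO$ if $PI\in L(y)$; add $PI$ if $PE\in L(y)$; add $PI$ and $PE$ if $PO\in L(y)$; finally remove $PE$ if both $PO$ and $PE$ are present. If $x\in\mathcal C$: use on the vertices of $x$ the labels of the children of $x$, and no label on $v(x)$; add $PI$ if isSatisfiable$(x,in)$; add $PO$ if isSatisfiable$(x,out)$; otherwise add $PE$ if isSatisfiable$(x,out)$ holds after $v(x)$ is given the artificial label set $\{PO\}$. If some $L(x)$ is empty, reject. When all nodes $x\neq R$ are labelled, accept if isSatisfiable$(R,none)$ is true and reject otherwise. \textbf{Constructive version.} After acceptance, redescend the labelled tree from $R$, realizing one label at each node $x\neq R$. At a component $x$ solve the corresponding formula again ($flag=none$ at $R$; otherwise the formula that produced the realized label of $x$), select the vertices whose literal is true, and realize $PI$ at the children whose vertex is selected and the label $PO$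 or $PE$ they have at the others. At $x\in\mathcal A$, realize $PI$ at all children if $x$ realizes $PI$, and otherwise at every child the label $PO$ or $PE$ it has. At a bridge that realizes $PO$, $PI$, $PE$, realize at its child $PI$, its label among $PO,PE$, and $PO$ respectively. Also select $v(x)$ at each $x\in\mathcal A\cup\mathcal B\cup\mathcal P$ that realizes $PI$. Output the set of all selected vertices; after rejection there is no output. \textbf{Theorem.} For every choice of $R$, every correct 2-SAT solver (returning a satisfying assignment if there is one) and every bipartiteness test (returning a proper 2-colouring if there is one): (1) $T$ is a tree. (2) Let $x\in\mathcal C$ and let $L$ be any assignment of label sets to the vertices of $x$, none containing both $PO$ and $PE$. Let $G_x^+$ be $x$ with a path $w,v'(w),v''(w)$ through two new vertices attached at every vertex $w$ with $L(w)\neq\emptyset$. Call an RMIS $M$ of $G_x^+$ \emph{suitable} if for each such $w$: $w\in M$ only if $PI\in L(w)$; $w\notin M$ only if $PO\in L(w)$ or $PE\in L(w)$; and $w\notin M$, $v'(w)\in M$, $v''(w)\notin M$ only if $PO\in L(w)$. Then isSatisfiable$(x,flag)$ with distinguished vertex $v$ of $x$ returns true if and only if $G_x^+$ has a suitable RMIS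 which contains $v$ (if $flag=in$), does not contain $v$ (if $flag=out$), or is arbitrary (if $flag=none$). (3) For each node $x\neq R$: if all children of $x$ are correctly labelled (and, if $x\in\mathcal C$, their label sets are non-empty), then the labeling rule for $x$ produces a correct labeling of $x$. Hence whenever the algorithm labels the subtree of $x$ without rejecting, $L(x)$ is correct, and if it rejects there, $G$ has no RMIS. (4) The algorithm accepts if and only if $G$ has a robust MIS. (5) If the constructive version outputs a set, it is a robust MIS of $G$; if it has no output, $G$ has no robust MIS. -/

import Mathlib

noncomputable section

open scoped Classical

namespace RobustMIS

universe u

/-! ### Robust maximal independent sets -/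

/-- A maximal independent set: an independent set to which no further vertex can be added. -/
def IsMIS {V : Type u} (G : SimpleGraph V) (S : Set V) : Prop :=
  Maximal G.IsIndepSet S

/-- A robust MIS of `G`: an MIS of `G` which is an MIS of every connected spanning subgraph. -/
def IsRMIS {V : Type u} (G : SimpleGraph V) (S : Set V) : Prop :=
  IsMIS G S ∧ ∀ H : SimpleGraph V, H ≤ G → H.Connected → IsMIS H S

/-! ### The `ABC`-tree -/

/-- A pendant vertex: a vertex of degree one. -/
def IsPendant {V : Type u} (G : SimpleGraph V) (v : V) : Prop :=
  ∃! w, G.Adj v w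

/-- An articulation point of a connected graph: its removal disconnects the graph. -/
def IsArticulation {V : Type u} (G : SimpleGraph V) (v : V) : Prop :=
  ¬ (G.induce {v}ᶜ).Preconnected

/-- A bridge of a connected graph: an edge whose removal disconnects the graph. -/
def IsBridgeEdge {V : Type u} (G : SimpleGraph V) (e : Sym2 V) : Prop :=
  e ∈ G.edgeSet ∧ G.IsBridge e

/-- A biconnected graph: at least three vertices, and it remains connected after the removal of
any single vertex. -/
def IsBiconnected {W : Type u} (H : SimpleGraph W) : Prop :=
  3 ≤ Nat.card W ∧ H.Connected ∧ ∀ v, (H.induce {v}ᶜ).Connected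

/-- A biconnected component: a maximal biconnected subgraph. -/
def IsBiconnComp {V : Type u} (G : SimpleGraph V) (C : G.Subgraph) : Prop :=
  Maximal (fun H : G.Subgraph => IsBiconnected H.coe) C

/-- The nodes of the `ABC`-tree: articulation points, bridges, biconnected components and
pendant vertices of `G`. -/
inductive Node {V : Type u} (G : SimpleGraph V) : Type u
  | art (a : V) (ha : IsArticulation G a)
  | bridge (e : Sym2 V) (he : IsBridgeEdge G e)
  | comp (C : G.Subgraph) (hC : IsBiconnComp G C)
  | pend (p : V) (hp : IsPendant G p)

namespace Node

variable {V : Type u} {G : SimpleGraph V}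

/-- The underlying vertex of an articulation or pendant node. -/
def vertex? : Node G → Option V
  | art a _ => some a
  | pend p _ => some p
  | bridge _ _ => none
  | comp _ _ => none

/-- Incidence of vertex nodes with bridge nodes and component nodes. -/
def Incident : Node G → Node G → Prop
  | art a _, comp C _ => a ∈ C.verts
  | art a _, bridge e _ => a ∈ e
  | pend p _, bridge e _ => p ∈ e
  | _, _ => False

/-- The subgraph `G_x` of `G` induced by a node `x`. -/
def subgraph : Node G → G.Subgraph
  | art a _ => (⊤ : G.Subgraph).induce {a}
  | pend p _ => (⊤ : G.Subgraph).induce {p}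
  | bridge e _ => (⊤ : G.Subgraph).induce {v | v ∈ e}
  | comp C _ => C

end Node

instance Node.instFinite {V : Type u} [Finite V] (G : SimpleGraph V) : Finite (Node G) := by
  refine Finite.of_injective (β := V ⊕ Sym2 V ⊕ G.Subgraph ⊕ V)
    (fun x => match x with
      | .art a _ => Sum.inl a
      | .bridge e _ => Sum.inr (Sum.inl e)
      | .comp C _ => Sum.inr (Sum.inr (Sum.inl C))
      | .pend p _ => Sum.inr (Sum.inr (Sum.inr p))) ?_
  intro x y h
  cases x <;> cases y <;> simp_all

/-- The `ABC`-tree of `G`. -/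
def abcTree {V : Type u} (G : SimpleGraph V) : SimpleGraph (Node G) where
  Adj x y := x.Incident y ∨ y.Incident x
  symm := ⟨fun _ _ h => h.symm⟩
  loopless := ⟨fun x h => by cases x <;> simp [Node.Incident] at h⟩

section Rooted

variable {V : Type u} {G : SimpleGraph V}

/-- The children of the node `x` when the `ABC`-tree is rooted in `R`: the neighbours of `x` that
are one hop farther from `R`. -/
def children (R x : Node G) : Set (Node G) :=
  {y | (abcTree G).Adj x y ∧ (abcTree G).dist R y = (abcTree G).dist R x + 1}

/-- The parent of a node, if any. -/
def parent? (R x : Node G) : Option (Node G) :=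
  if h : ∃ z, x ∈ children R z then some h.choose else none

/-- The attachment vertex `v(x)`: the vertex underlying `x` if `x` is an articulation point or a
pendant vertex, and otherwise the vertex underlying the parent of `x`. -/
def attach? (R x : Node G) : Option V :=
  match x with
  | .art a _ => some a
  | .pend p _ => some p
  | .bridge _ _ => (parent? R x).bind Node.vertex?
  | .comp _ _ => (parent? R x).bind Node.vertex?

/-- `x` together with its descendants. -/
def subtree (R x : Node G) : Set (Node G) :=
  {y | Relation.ReflTransGen (fun a b => b ∈ children R a) x y}

/-- The subgraph `G[T_x]` of `G` corresponding to the subtree of `x`. -/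
def subtreeGraph (R x : Node G) : G.Subgraph :=
  ⨆ y ∈ subtree R x, y.subgraph

theorem children_measure [Finite V] {R x y : Node G} (h : y ∈ children R x) :
    Nat.card (Node G) - (abcTree G).dist R y < Nat.card (Node G) - (abcTree G).dist R x := by
  obtain ⟨_, hd⟩ := h
  have hr : (abcTree G).Reachable R y := by
    by_contra hn
    rw [SimpleGraph.dist_eq_zero_of_not_reachable hn] at hd
    omega
  obtain ⟨p, hp, hl⟩ := hr.exists_path_of_dist
  have := Fintype.ofFinite (Node G)
  have := hp.length_lt
  rw [Nat.card_eq_fintype_card]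
  omega

end Rooted

/-! ### Labels -/

/-- Possibly in, possibly out, possibly external. -/
inductive Label : Type
  | PI
  | PO
  | PE
  deriving DecidableEq

/-- The graph `H` with an artificial additional vertex `none` attached to `v`. -/
def aerial {W : Type u} (H : SimpleGraph W) (v : W) : SimpleGraph (Option W) :=
  H.map Function.Embedding.some ⊔ SimpleGraph.edge (some v) none

/-- `L` is the correct label set of a graph `H` (standing for `G[T_x]`) with attachment vertex
`v`. -/
def IsCorrectFor {W : Type u} (H : SimpleGraph W) (v : W) (L : Finset Label) : Prop :=
  (Label.PI ∈ L ↔ ∃ S, IsRMIS H S ∧ v ∈ S) ∧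
  (Label.PO ∈ L ↔ ∃ S, IsRMIS H S ∧ v ∉ S) ∧
  (Label.PE ∈ L ↔ Label.PO ∉ L ∧ ∃ S, IsRMIS (aerial H v) S ∧ some v ∉ S)

/-- `L` is a correct labeling of the node `x` of the `ABC`-tree rooted in `R`. -/
def IsCorrect {V : Type u} {G : SimpleGraph V} (R x : Node G) (L : Finset Label) : Prop :=
  ∃ v : V, attach? R x = some v ∧ ∃ hv : v ∈ (subtreeGraph R x).verts,
    IsCorrectFor (subtreeGraph R x).coe ⟨v, hv⟩ L

/-! ### 2-SAT and bipartition -/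

/-- A literal: a variable (`sign = true`) or the negation of a variable (`sign = false`). -/
structure Literal (ι : Type u) : Type u where
  var : ι
  sign : Bool

/-- The negation of a literal. -/
def Literal.neg {ι : Type u} (l : Literal ι) : Literal ι := ⟨l.var, !l.sign⟩

/-- Truth of a literal under an assignment. -/
def Literal.Holds {ι : Type u} (s : ι → Bool) (l : Literal ι) : Prop := s l.var = l.sign

/-- A clause of a 2-SAT formula. -/
inductive Clause (ι : Type u) : Type u
  | unit (l : Literal ι)
  | or (l m : Literal ι)

/-- Truth of a clause under an assignment. -/
def Clause.Holds {ι : Type u} (s : ι → Bool) : Clause ι → Prop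
  | .unit l => l.Holds s
  | .or l m => l.Holds s ∨ m.Holds s

/-- An external 2-SAT solver. Formulas are sets of clauses, read as conjunctions. -/
structure TwoSatSolver : Type (u + 1) where
  solve : ∀ {ι : Type u} [Finite ι], Set (Clause ι) → Option (ι → Bool)
  sound : ∀ {ι : Type u} [Finite ι] (F : Set (Clause ι)) (s : ι → Bool),
    solve F = some s → ∀ c ∈ F, c.Holds s
  complete : ∀ {ι : Type u} [Finite ι] (F : Set (Clause ι)),
    solve F = none → ¬ ∃ s : ι → Bool, ∀ c ∈ F, c.Holds s

/-- A bipartiteness test that returns a proper 2-colouring of every bipartite graph. -/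
structure BipartiteTest : Type (u + 1) where
  run : ∀ {W : Type u} [Finite W] (X : SimpleGraph W), Option (X.Coloring Bool)
  complete : ∀ {W : Type u} [Finite W] (X : SimpleGraph W), run X = none → ¬ X.IsBipartite

theorem nonempty_twoSatSolver : Nonempty TwoSatSolver.{u} :=
  ⟨{ solve := fun {ι} _ F =>
        if h : ∃ s : ι → Bool, ∀ c ∈ F, c.Holds s then some h.choose else none
     sound := by
        intro ι _ F s h
        split_ifs at h with hs
        rw [← Option.some.inj h]
        exact hs.choose_spec
     complete := by
        intro ι _ F h
        split_ifs at h with hs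
        exact hs }⟩

theorem nonempty_bipartiteTest : Nonempty BipartiteTest.{u} :=
  ⟨{ run := fun {W} _ X => if h : Nonempty (X.Coloring Bool) then some h.some else none
     complete := by
        intro W _ X h
        split_ifs at h with hs
        rintro ⟨c⟩
        exact hs ⟨X.recolorOfEquiv finTwoEquiv c⟩ }⟩

/-! ### Solving a biconnected component -/

/-- Forced status of a vertex of the component. -/
inductive Flag (W : Type u) : Type u
  | isIn (v : W)
  | isOut (v : W)
  | free

section Component

variable {W : Type u}

/-- The edges of `H` both of whose ends contain the label `PO` are deleted. -/
def cutPO (H : SimpleGraph W) (L : W → Finset Label) : SimpleGraph W where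
  Adj u w := H.Adj u w ∧ ¬ (Label.PO ∈ L u ∧ Label.PO ∈ L w)
  symm := ⟨fun _ _ h => ⟨h.1.symm, fun h' => h.2 h'.symm⟩⟩
  loopless := ⟨fun _ h => h.1.ne rfl⟩

/-- The literal of a vertex: there is one variable for each connected component of the bipartite
graph `X`, and the two sides of a component carry opposite literals. -/
def lit {X : SimpleGraph W} (c : X.Coloring Bool) (w : W) : Literal X.ConnectedComponent :=
  ⟨X.connectedComponentMk w, c w⟩

/-- The clauses forcing the status prescribed by a flag. -/
def flagClauses {X : SimpleGraph W} (c : X.Coloring Bool) :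
    Flag W → Set (Clause X.ConnectedComponent)
  | .isIn v => {.unit (lit c v)}
  | .isOut v => {.unit (lit c v).neg}
  | .free => ∅

/-- The 2-SAT formula of a component; unlabelled vertices have `L w = ∅`. -/
def formula (H : SimpleGraph W) (L : W → Finset Label) (c : (cutPO H L).Coloring Bool)
    (flag : Flag W) : Set (Clause (cutPO H L).ConnectedComponent) :=
  {k | ∃ w, L w = {Label.PI} ∧ k = .unit (lit c w)} ∪
  {k | ∃ w, (L w = {Label.PO} ∨ L w = {Label.PE}) ∧ k = .unit (lit c w).neg} ∪
  {k | ∃ u w, H.Adj u w ∧ Label.PO ∈ L u ∧ Label.PO ∈ L w ∧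
    k = .or (lit c u).neg (lit c w).neg} ∪
  flagClauses c flag

variable [Finite W]

/-- The 2-SAT reduction: `none` if the bipartiteness test or the solver fails, and otherwise the
set of vertices whose literal is true under the assignment found. -/
def solveComponent (B : BipartiteTest.{u}) (S : TwoSatSolver.{u}) (H : SimpleGraph W)
    (L : W → Finset Label) (flag : Flag W) : Option (Set W) :=
  (B.run (cutPO H L)).bind fun c =>
    (S.solve (formula H L c flag)).map fun s => {w | (lit c w).Holds s}

/-- The procedure `isSatisfiable`. -/
def IsSatisfiable (B : BipartiteTest.{u}) (S : TwoSatSolver.{u}) (H : SimpleGraph W)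
    (L : W → Finset Label) (flag : Flag W) : Prop :=
  (solveComponent B S H L flag).isSome = true

end Component
/-- The augmented component: a path `w, v'(w), v''(w)` is attached to every constrained vertex `w`,
with `v'(w) = inr (w, false)` and `v''(w) = inr (w, true)`. -/
def augmented {W : Type u} (H : SimpleGraph W) (L : W → Finset Label) :
    SimpleGraph (W ⊕ ({w : W // L w ≠ ∅} × Bool)) :=
  SimpleGraph.fromRel fun x y => match x, y with
    | .inl u, .inl w => H.Adj u w
    | .inl u, .inr (k, false) => u = k
    | .inr (k, false), .inr (k', true) => k = k'
    | _, _ => False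

/-- A suitable RMIS of the augmented component. -/
def IsSuitable {W : Type u} (H : SimpleGraph W) (L : W → Finset Label)
    (M : Set (W ⊕ ({w : W // L w ≠ ∅} × Bool))) : Prop :=
  IsRMIS (augmented H L) M ∧ ∀ k : {w : W // L w ≠ ∅},
    (Sum.inl k.1 ∈ M → Label.PI ∈ L k) ∧
    (Sum.inl k.1 ∉ M → Label.PO ∈ L k ∨ Label.PE ∈ L k) ∧
    (Sum.inl k.1 ∉ M → Sum.inr (k, false) ∈ M → Sum.inr (k, true) ∉ M → Label.PO ∈ L k)

/-- The requirement of a flag on a set of vertices of the augmented component. -/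
def Flag.Agrees {W K : Type u} (M : Set (W ⊕ K)) : Flag W → Prop
  | .isIn v => Sum.inl v ∈ M
  | .isOut v => Sum.inl v ∉ M
  | .free => True

/-! ### The main algorithm -/

section Algorithm

variable {V : Type u} [Finite V] {G : SimpleGraph V}
  (B : BipartiteTest.{u}) (S : TwoSatSolver.{u})

/-- The labels seen by a component `x` with vertex set `C.verts`: those of the children of `x`.
The parent of `x` is not yet labelled. -/
def vertexLabels (R x : Node G) (f : Node G → Finset Label) (C : G.Subgraph) (w : C.verts) :
    Finset Label :=
  if ha : IsArticulation G w.1 then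
    if Node.art w.1 ha ∈ children R x then f (.art w.1 ha) else ∅
  else ∅

/-- The procedure `LabelNode`: the labels of `x` computed from the labels `f` of its children. -/
def labelNode (R x : Node G) (f : Node G → Finset Label) : Finset Label :=
  match x with
  | .pend _ _ => {Label.PI, Label.PE}
  | .art _ _ =>
    (if ∀ c ∈ children R x, Label.PI ∈ f c then {Label.PI} else ∅) ∪
    (if ∀ c ∈ children R x, Label.PO ∈ f c ∨ Label.PE ∈ f c then
      if ∃ c ∈ children R x, Label.PO ∈ f c then {Label.PO} else {Label.PE}
     else ∅)
  | .bridge _ _ =>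
    let L : Finset Label :=
      (if ∃ c ∈ children R x, Label.PI ∈ f c then {Label.PO} else ∅) ∪
      (if ∃ c ∈ children R x, Label.PE ∈ f c then {Label.PI} else ∅) ∪
      (if ∃ c ∈ children R x, Label.PO ∈ f c then {Label.PI, Label.PE} else ∅)
    if Label.PO ∈ L ∧ Label.PE ∈ L then L.erase Label.PE else L
  | .comp C _ =>
    match attach? R x with
    | none => ∅
    | some v =>
      if hv : v ∈ C.verts then
        let L := vertexLabels R x f C
        let v' : C.verts := ⟨v, hv⟩
        (if IsSatisfiable B S C.coe L (.isIn v') then {Label.PI} else ∅) ∪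
        (if IsSatisfiable B S C.coe L (.isOut v') then {Label.PO}
         else if IsSatisfiable B S C.coe (Function.update L v' {Label.PO}) (.isOut v') then
          {Label.PE}
         else ∅)
      else ∅

/-- The procedure `LabelSubTree`: the children are labelled first, then `x`; the value `none`
means that the algorithm rejects. -/
def labelSubTree (R x : Node G) : Option (Finset Label) :=
  let sub : children R x → Option (Finset Label) := fun c => labelSubTree R c.1
  if ∀ c, sub c ≠ none then
    let L := labelNode B S R x fun y => if hy : y ∈ children R x then (sub ⟨y, hy⟩).getD ∅ else ∅
    if L = ∅ then none else some L
  else none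
termination_by Nat.card (Node G) - (abcTree G).dist R x
decreasing_by exact children_measure c.2

/-- The label of a node after the execution of the algorithm. -/
def finalLabel (R x : Node G) : Finset Label :=
  (labelSubTree B S R x).getD ∅

/-- The main algorithm, run on the `ABC`-tree rooted in the component `C`, accepts. -/
def Accepts (C : G.Subgraph) (hC : IsBiconnComp G C) : Prop :=
  (∀ x ∈ children (.comp C hC) (.comp C hC), labelSubTree B S (.comp C hC) x ≠ none) ∧
  IsSatisfiable B S C.coe
    (vertexLabels (.comp C hC) (.comp C hC) (finalLabel B S (.comp C hC)) C) .free

/-! ### The constructive version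

After the decision algorithm has accepted, the labelled tree is redescended from the root. A node
`x` is visited with a label `some l` of `x` to be realized (`none` at the root). -/

/-- The set of vertices selected in the component `C = x` when the label `l` is realized. -/
def componentSet (R x : Node G) (C : G.Subgraph) (l : Option Label) : Set V :=
  let L := vertexLabels R x (finalLabel B S R) C
  let sol : Option (Set C.verts) :=
    match l, attach? R x with
    | none, _ => solveComponent B S C.coe L .free
    | some _, none => none
    | some l, some v =>
      if hv : v ∈ C.verts then
        match l with
        | .PI => solveComponent B S C.coe L (.isIn ⟨v, hv⟩)
        | .PO => solveComponent B S C.coe L (.isOut ⟨v, hv⟩)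
        | .PE => solveComponent B S C.coe (Function.update L ⟨v, hv⟩ {Label.PO}) (.isOut ⟨v, hv⟩)
      else none
  Subtype.val '' (sol.getD ∅)

/-- The vertices selected at the node `x` itself. -/
def selected (R x : Node G) (l : Option Label) : Set V :=
  match x with
  | .comp C _ => componentSet B S R x C l
  | _ => {v | l = some Label.PI ∧ attach? R x = some v}

/-- The label of a node by which its attachment vertex is excluded. -/
def outLabel (R x : Node G) : Label :=
  if Label.PO ∈ finalLabel B S R x then Label.PO else Label.PE

/-- The label realized at the child `c` of `x` when `x` realizes `l`. -/
def childLabel (R x : Node G) (l : Option Label) (c : Node G) : Label :=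
  match x with
  | .comp C _ =>
    if ∃ w ∈ componentSet B S R x C l, c.vertex? = some w then Label.PI else outLabel B S R c
  | .bridge _ _ =>
    if l = some Label.PO then Label.PI
    else if l = some Label.PI then outLabel B S R c
    else Label.PO
  | _ => if l = some Label.PI then Label.PI else outLabel B S R c

/-- The set of vertices selected in the whole subtree of `x`. -/
def redescend (R x : Node G) (l : Option Label) : Set V :=
  selected B S R x l ∪
    ⋃ c : children R x, redescend R c.1 (some (childLabel B S R x l c.1))
termination_by Nat.card (Node G) - (abcTree G).dist R x
decreasing_by exact children_measure c.2

/-- The constructive algorithm: run the decision algorithm and, if it accepts, redescend the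
labelled tree from the root; otherwise there is no output. -/
def construct (C : G.Subgraph) (hC : IsBiconnComp G C) : Option (Set V) :=
  if Accepts B S C hC then some (redescend B S (.comp C hC) (.comp C hC) none) else none

end Algorithm

end RobustMIS

end

namespace RobustMIS

universe u

/-! ### Reachability avoiding a vertex -/

section Avoid

variable {W : Type u}

/-! Robustness is a local property. If `v ∉ S` and every component of `H - v` adjacent to `v`
contains a neighbour of `v` outside `S`, all edges between `v` and `S` can be dropped without
disconnecting `H`, and `v` becomes undominated. If instead all neighbours of `v` in one such
component lie in `S`, every connected spanning subgraph must join this component to `v` by an edge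
from `S`. So robust means independent with every outside vertex `Secure` (`isRMIS_iff`). The
neighbours of `v` in one component of `G - v` are its neighbours in one block, that is, in one
bridge or biconnected component (`exists_block_of_reachAvoid`, `block_unique`). Robustness thereby
becomes a condition on single blocks (`secure_iff_secureIn`).

Blocks are arranged along the ABC-tree, which has no cycle because different blocks at an
articulation point lead into different components of the graph without that point. The graph
`G[T_c]` of a child meets its parent node and the graphs of its siblings in `v(c)` at most. Hence
the condition on `T_x` splits into conditions on `x` and on the child subtrees (`good_iff`), and
sets that agree at the attachment vertices can be glued (`glue_mem_iff`). All that the outside sees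
of `T_x` is whether `v(x)` is selected and, if not, whether it is already secured inside: the labels
PI, PO and PE.

Inside a component, an unselected vertex is secured from below (PO) or has all its neighbours in the
component selected. So an edge has exactly one selected end unless both ends carry PO. This leaves
one free bit per connected component of the remaining graph, and all other constraints are clauses
with at most two literals (`fits_iff`, `isSatisfiable_iff`).

Each labeling rule is complete by restricting a set to the children and sound by gluing sets
realized at the children; `labelSubTree_correct` and `redescend_realizes` are the corresponding
inductions over the tree. At the root no vertex is exempt, so the glued set is robust
(`isRMIS_iff_good`). -/

theorem reflTransGen_map {W' : Type*} {r : W → W → Prop} {r' : W' → W' → Prop} (φ : W → W')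
    (hφ : ∀ x y, r x y → r' (φ x) (φ y)) {a b : W} (h : Relation.ReflTransGen r a b) :
    Relation.ReflTransGen r' (φ a) (φ b) := by
  induction h with
  | refl => exact .refl
  | tail _ h ih => exact ih.tail (hφ _ _ h)

theorem reflTransGen_mono {r r' : W → W → Prop} (h : ∀ x y, r x y → r' x y) {a b : W}
    (hab : Relation.ReflTransGen r a b) : Relation.ReflTransGen r' a b :=
  reflTransGen_map id h hab

/-- `b` can be reached from `a` along `r` without visiting `v`. -/
def ReachAvoid (r : W → W → Prop) (v : W) : W → W → Prop :=
  Relation.ReflTransGen fun a b => r a b ∧ a ≠ v ∧ b ≠ v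

variable {r : W → W → Prop} {v : W}

theorem ReachAvoid.refl (a : W) : ReachAvoid r v a a := Relation.ReflTransGen.refl

theorem ReachAvoid.trans {a b c : W} (h : ReachAvoid r v a b) (h' : ReachAvoid r v b c) :
    ReachAvoid r v a c := Relation.ReflTransGen.trans h h'

theorem ReachAvoid.single {a b : W} (h : r a b) (ha : a ≠ v) (hb : b ≠ v) :
    ReachAvoid r v a b := Relation.ReflTransGen.single ⟨h, ha, hb⟩

theorem ReachAvoid.symm (hr : ∀ a b, r a b → r b a) {a b : W} (h : ReachAvoid r v a b) :
    ReachAvoid r v b a := by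
  induction h with
  | refl => exact .refl _
  | tail _ h ih => exact (ReachAvoid.single (hr _ _ h.1) h.2.2 h.2.1).trans ih

theorem ReachAvoid.map {W' : Type*} {r' : W' → W' → Prop} {v' : W'} {a b : W} (φ : W → W')
    (hφ : ∀ x y, r x y → x ≠ v → y ≠ v → r' (φ x) (φ y) ∧ φ x ≠ v' ∧ φ y ≠ v')
    (h : ReachAvoid r v a b) : ReachAvoid r' v' (φ a) (φ b) :=
  reflTransGen_map φ (fun x y hxy => hφ x y hxy.1 hxy.2.1 hxy.2.2) h

theorem ReachAvoid.mono {r' : W → W → Prop} {a b : W} (hr : ∀ x y, r x y → r' x y)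
    (h : ReachAvoid r v a b) : ReachAvoid r' v a b :=
  h.map id fun x y hxy hx hy => ⟨hr x y hxy, hx, hy⟩

theorem ReachAvoid.ne {a b : W} (h : ReachAvoid r v a b) (ha : a ≠ v) : b ≠ v := by
  induction h with
  | refl => exact ha
  | tail _ h _ => exact h.2.2

theorem ReachAvoid.reflTransGen {a b : W} (h : ReachAvoid r v a b) :
    Relation.ReflTransGen r a b :=
  reflTransGen_mono (fun _ _ h => h.1) h

end Avoid

/-! ### A local criterion for robust maximal independent sets -/

section Criterion

variable {W : Type u} {H : SimpleGraph W} {S : Set W}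

theorem isIndepSet_iff_forall : H.IsIndepSet S ↔ ∀ a b, H.Adj a b → a ∈ S → b ∉ S :=
  ⟨fun h _ _ hab ha hb => h ha hb hab.ne hab, fun h _ ha _ hb _ hab => h _ _ hab ha hb⟩

theorem isMIS_iff : IsMIS H S ↔ H.IsIndepSet S ∧ ∀ v ∉ S, ∃ s ∈ S, H.Adj v s := by
  constructor
  · intro h
    refine ⟨h.1, fun v hv => ?_⟩
    by_contra! hn
    refine hv (h.2 (y := insert v S) ?_ (Set.subset_insert _ _) (Set.mem_insert _ _))
    refine isIndepSet_iff_forall.2 fun a b hab ha hb => ?_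
    rcases ha with rfl | ha
    · rcases hb with rfl | hb
      · exact hab.ne rfl
      · exact hn b hb hab
    · rcases hb with rfl | hb
      · exact hn a ha hab.symm
      · exact isIndepSet_iff_forall.1 h.1 a b hab ha hb
  · rintro ⟨h, hd⟩
    refine ⟨h, fun S' hS' hSS' v hv => ?_⟩
    by_contra hvS
    obtain ⟨s, hs, hvs⟩ := hd v hvS
    exact isIndepSet_iff_forall.1 hS' v s hvs hv (hSS' hs)

/-- All neighbours of `v` in some connected component of `H - v` that is adjacent to `v` belong
to `S`. -/
def Secure (H : SimpleGraph W) (S : Set W) (v : W) : Prop :=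
  ∃ u, H.Adj v u ∧ ∀ w, H.Adj v w → ReachAvoid H.Adj v u w → w ∈ S

theorem connected_iff_reflTransGen :
    H.Connected ↔ Nonempty W ∧ ∀ a b, Relation.ReflTransGen H.Adj a b := by
  rw [SimpleGraph.connected_iff, and_comm]
  simp only [SimpleGraph.Preconnected, SimpleGraph.reachable_iff_reflTransGen]

/-- If `v` is not secure, each component of `H - v` adjacent to `v` has a neighbour of `v` outside
`S`. Deleting all edges from `v` to `S` then keeps the graph connected and leaves `v` undominated.
-/
theorem IsRMIS.secure (hH : H.Connected) (h : IsRMIS H S) {v : W} (hv : v ∉ S) :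
    Secure H S v := by
  by_contra hn
  simp only [Secure, not_exists, not_and, not_forall] at hn
  let K : SimpleGraph W :=
    { Adj := fun a b => H.Adj a b ∧ ¬ (a = v ∧ b ∈ S) ∧ ¬ (b = v ∧ a ∈ S)
      symm := ⟨fun a b h => ⟨h.1.symm, h.2.2, h.2.1⟩⟩
      loopless := ⟨fun a h => h.1.ne rfl⟩ }
  have key : ∀ a, K.Reachable v a := by
    intro a
    have ha := (connected_iff_reflTransGen.1 hH).2 v a
    induction ha with
    | refl => exact .refl _
    | @tail a b _ hab ih =>
      by_cases hb : b = v
      · rw [hb]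
      by_cases hK : K.Adj a b
      · exact ih.trans hK.reachable
      have hav : a = v ∧ b ∈ S := by
        by_contra hav
        exact hK ⟨hab, hav, fun hh => hb hh.1⟩
      obtain ⟨rfl, -⟩ := hav
      -- The deleted edge from `v` to `b` is bypassed: enter the component of `b` at a neighbour `w
      -- ∉ S` of `v` and walk to `b` off `v`, where no edge was deleted.
      obtain ⟨w, hw, hbw, hwS⟩ := hn b hab
      have h1 : K.Adj a w := ⟨hw, fun hh => hwS hh.2, fun hh => hv hh.2⟩
      have h2 : K.Reachable b w := by
        rw [SimpleGraph.reachable_iff_reflTransGen]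
        refine reflTransGen_mono (fun x y hxy => ?_) hbw
        exact ⟨hxy.1, fun hh => hxy.2.1 hh.1, fun hh => hxy.2.2 hh.1⟩
      exact h1.reachable.trans h2.symm
  have hK : K.Connected :=
    { preconnected := fun a b => (key a).symm.trans (key b)
      nonempty := ⟨v⟩ }
  obtain ⟨s, hs, hvs⟩ := (isMIS_iff.1 (h.2 K (fun _ _ h => h.1) hK)).2 v hv
  exact hvs.2.1 ⟨rfl, hs⟩

/-- For the converse, follow a walk of the spanning subgraph from the witness `u` to `v`. Until it
first meets `v` it stays in the component of `u`, so the vertex from which it enters `v` belongs to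
`S`. -/
theorem isRMIS_iff (hH : H.Connected) :
    IsRMIS H S ↔ H.IsIndepSet S ∧ ∀ v ∉ S, Secure H S v := by
  refine ⟨fun h => ⟨h.1.1, fun v hv => h.secure hH hv⟩, fun ⟨hi, hs⟩ => ?_⟩
  have key : ∀ K : SimpleGraph W, K ≤ H → K.Connected → IsMIS K S := by
    intro K hKH hK
    refine isMIS_iff.2 ⟨fun a ha b hb hab hadj => hi ha hb hab (hKH hadj), fun v hv => ?_⟩
    obtain ⟨u, huv, hu⟩ := hs v hv
    have hP : ∀ y, Relation.ReflTransGen K.Adj u y →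
        (y ≠ v ∧ ReachAvoid H.Adj v u y) ∨ ∃ s ∈ S, K.Adj v s := by
      intro y hy
      induction hy with
      | refl => exact .inl ⟨huv.ne', .refl _⟩
      | @tail y z _ hyz ih =>
        rcases ih with ⟨hyv, hy⟩ | ih
        · by_cases hzv : z = v
          · subst hzv
            exact .inr ⟨y, hu y (hKH hyz).symm hy, hyz.symm⟩
          · exact .inl ⟨hzv, hy.trans (.single (hKH hyz) hyv hzv)⟩
        · exact .inr ih
    rcases hP v ((connected_iff_reflTransGen.1 hK).2 u v) with h | h
    · exact absurd rfl h.1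
    · exact h
  exact ⟨key H le_rfl hH, key⟩

end Criterion

/-! ### The graph with an additional vertex -/

section Aerial

variable {W : Type u} {H : SimpleGraph W} {v : W}

theorem aerial_some_some {a b : W} : (aerial H v).Adj (some a) (some b) ↔ H.Adj a b := by
  simp only [aerial, SimpleGraph.sup_adj, SimpleGraph.edge_adj, SimpleGraph.map_adj]
  simp

theorem aerial_some_none {a : W} : (aerial H v).Adj (some a) none ↔ a = v := by
  simp only [aerial, SimpleGraph.sup_adj, SimpleGraph.edge_adj, SimpleGraph.map_adj]
  simp

theorem aerial_none_some {a : W} : (aerial H v).Adj none (some a) ↔ a = v := by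
  rw [SimpleGraph.adj_comm, aerial_some_none]

theorem aerial_connected (hH : H.Connected) : (aerial H v).Connected := by
  have key : ∀ x, (aerial H v).Reachable (some v) x := by
    rintro (_ | a)
    · exact (aerial_some_none.2 rfl).reachable
    · rw [SimpleGraph.reachable_iff_reflTransGen]
      exact reflTransGen_map some (fun x y h => aerial_some_some.2 h)
        ((connected_iff_reflTransGen.1 hH).2 v a)
  exact { preconnected := fun a b => (key a).symm.trans (key b), nonempty := ⟨none⟩ }

/-- The additional vertex is a leaf, so a walk visiting it can be contracted. -/
theorem reachAvoid_aerial {y a b : W} :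
    ReachAvoid (aerial H v).Adj (some y) (some a) (some b) ↔ ReachAvoid H.Adj y a b := by
  constructor
  · intro h
    -- The default value `v` retracts the leaf onto its only neighbour.
    have key : ∀ z, ReachAvoid (aerial H v).Adj (some y) (some a) z →
        ReachAvoid H.Adj y a (z.getD v) := by
      intro z hz
      induction hz with
      | refl => exact .refl _
      | @tail z z' _ h ih =>
        refine ih.trans ?_
        rcases z with _ | z <;> rcases z' with _ | z'
        · exact .refl _
        · rw [aerial_none_some.1 h.1]; exact .refl _
        · rw [aerial_some_none.1 h.1]; exact .refl _
        · exact .single (aerial_some_some.1 h.1) (fun e => h.2.1 (e ▸ rfl))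
            (fun e => h.2.2 (e ▸ rfl))
    exact key _ h
  · refine fun h => h.map some fun x z hxz hx hz => ⟨aerial_some_some.2 hxz, ?_, ?_⟩
    · simpa using hx
    · simpa using hz

/-- The leaf dominates nothing but `v`. Selecting it secures `v` and does not affect the security of
any other vertex, so its effect is to exempt `v`. -/
theorem exists_isRMIS_aerial (hH : H.Connected) :
    (∃ S, IsRMIS (aerial H v) S ∧ some v ∉ S) ↔
      ∃ S, H.IsIndepSet S ∧ v ∉ S ∧ ∀ y ∉ S, y ≠ v → Secure H S y := by
  simp only [isRMIS_iff (aerial_connected hH)]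
  constructor
  · rintro ⟨S, ⟨hi, hs⟩, hv⟩
    refine ⟨some ⁻¹' S, isIndepSet_iff_forall.2 fun a b hab ha hb =>
      isIndepSet_iff_forall.1 hi _ _ (aerial_some_some.2 hab) ha hb, hv, fun y hy hyv => ?_⟩
    obtain ⟨u, hu, h⟩ := hs (some y) hy
    rcases u with _ | u
    · exact absurd (aerial_some_none.1 hu) hyv
    · exact ⟨u, aerial_some_some.1 hu, fun w hw huw =>
        h (some w) (aerial_some_some.2 hw) (reachAvoid_aerial.2 huw)⟩
  · rintro ⟨S, hi, hv, hs⟩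
    refine ⟨insert none (some '' S), ⟨isIndepSet_iff_forall.2 ?_, ?_⟩, by simpa using hv⟩
    · rintro (_ | a) (_ | b) hab ha hb
      · exact hab.ne rfl
      · rw [aerial_none_some] at hab
        subst hab
        simp at hb
        exact hv hb
      · rw [aerial_some_none] at hab
        subst hab
        simp at ha
        exact hv ha
      · simp at ha hb
        exact isIndepSet_iff_forall.1 hi a b (aerial_some_some.1 hab) ha hb
    · rintro (_ | y) hy
      · simp at hy
      by_cases hyv : y = v
      · subst hyv
        refine ⟨none, aerial_some_none.2 rfl, fun w _ hw => ?_⟩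
        rcases Relation.ReflTransGen.cases_head hw with h | ⟨z, hz, -⟩
        · rw [← h]; exact Set.mem_insert _ _
        · rcases z with _ | z
          · exact absurd rfl hz.1.ne
          · exact absurd (congrArg some (aerial_none_some.1 hz.1)) hz.2.2
      · obtain ⟨u, hu, h⟩ := hs y (by simpa using hy) hyv
        refine ⟨some u, aerial_some_some.2 hu, fun w hw huw => ?_⟩
        rcases w with _ | w
        · exact Set.mem_insert _ _
        · exact Set.mem_insert_of_mem _
            ⟨w, h w (aerial_some_some.1 hw) (reachAvoid_aerial.1 huw), rfl⟩

end Aerial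

/-! ### Biconnected subgraphs -/

section Subtype

variable {W : Type u} {r : W → W → Prop} {s : Set W}

theorem reflTransGen_subtype (hr : ∀ x y, r x y → y ∈ s) {a b : s} :
    Relation.ReflTransGen (fun x y : s => r x y) a b ↔ Relation.ReflTransGen r (a : W) b := by
  refine ⟨fun h => reflTransGen_map Subtype.val (fun _ _ h => h) h, fun h => ?_⟩
  have key : ∀ c, Relation.ReflTransGen r (a : W) c → ∀ hc : c ∈ s,
      Relation.ReflTransGen (fun x y : s => r x y) a ⟨c, hc⟩ := by
    intro c h
    induction h with
    | refl => exact fun _ => .refl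
    | @tail x y hx hxy ih =>
      intro hy
      rcases Relation.ReflTransGen.cases_tail hx with h | ⟨z, -, hzx⟩
      · subst h
        exact .single hxy
      · exact (ih (hr _ _ hzx)).tail hxy
  exact key b h b.2

theorem reachAvoid_subtype (hr : ∀ x y, r x y → y ∈ s) {v a b : s} :
    ReachAvoid (fun x y : s => r x y) v a b ↔ ReachAvoid r v (a : W) b := by
  have := reflTransGen_subtype (r := fun x y => r x y ∧ x ≠ v ∧ y ≠ v) (s := s)
    (fun x y h => hr x y h.1) (a := a) (b := b)
  simpa only [ReachAvoid, ne_eq, Subtype.ext_iff] using this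

theorem induce_compl_preconnected_iff {K : SimpleGraph W} {v : W} :
    (K.induce {v}ᶜ).Preconnected ↔ ∀ a b, a ≠ v → b ≠ v → ReachAvoid K.Adj v a b := by
  constructor
  · intro h a b ha hb
    have := (SimpleGraph.reachable_iff_reflTransGen _ _).1 (h ⟨a, ha⟩ ⟨b, hb⟩)
    exact reflTransGen_map Subtype.val (fun x y hxy => ⟨hxy, x.2, y.2⟩) this
  · rintro h ⟨a, ha⟩ ⟨b, hb⟩
    have key : ∀ c, ReachAvoid K.Adj v a c → ∀ hc : c ∈ ({v}ᶜ : Set W),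
        (K.induce {v}ᶜ).Reachable ⟨a, ha⟩ ⟨c, hc⟩ := by
      intro c h
      induction h with
      | refl => exact fun _ => .refl _
      | tail _ h ih =>
        exact fun hc => (ih h.2.1).trans
          (SimpleGraph.Adj.reachable (G := K.induce {v}ᶜ) (u := ⟨_, h.2.1⟩) (v := ⟨_, hc⟩) h.1)
    exact key b (h a b ha hb) hb

end Subtype

/-! ### Biconnected subgraphs, cycles and bridges -/

section Bicon

variable {V : Type u} {G : SimpleGraph V}

/-- Biconnectedness of a subgraph in terms of walks in the ambient vertex type. -/
def Bicon (H : G.Subgraph) : Prop :=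
  3 ≤ H.verts.ncard ∧
    ∀ v, ∀ a ∈ H.verts, ∀ b ∈ H.verts, a ≠ v → b ≠ v → ReachAvoid H.Adj v a b

theorem exists_third {s : Set V} (hs : 3 ≤ s.ncard) (a b : V) : ∃ c ∈ s, c ≠ a ∧ c ≠ b := by
  by_contra! h
  have : s ⊆ {a, b} := fun c hc => by
    by_cases hca : c = a
    · exact .inl hca
    · exact .inr (h c hc hca)
  have := (Set.ncard_le_ncard this).trans (Set.ncard_insert_le _ _)
  simp at this
  omega

/-- Connectedness need not be demanded separately in `Bicon`: two vertices are joined by a walk that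
avoids some third one. -/
theorem isBiconnected_coe_iff {H : G.Subgraph} : IsBiconnected H.coe ↔ Bicon H := by
  have hadj : ∀ x y, H.Adj x y → y ∈ H.verts := fun x y h => h.snd_mem
  have hcoe : H.coe.Adj = fun x y : H.verts => H.Adj x y := rfl
  have hcard : Nat.card H.verts = H.verts.ncard := rfl
  simp only [IsBiconnected, Bicon, hcard]
  constructor
  · rintro ⟨h3, hc, hv⟩
    refine ⟨h3, fun v a ha b hb hav hbv => ?_⟩
    by_cases hvH : v ∈ H.verts
    · have := induce_compl_preconnected_iff.1 (hv ⟨v, hvH⟩).preconnected ⟨a, ha⟩ ⟨b, hb⟩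
        (by simpa using hav) (by simpa using hbv)
      rw [hcoe, reachAvoid_subtype hadj] at this
      exact this
    · have := (connected_iff_reflTransGen.1 hc).2 ⟨a, ha⟩ ⟨b, hb⟩
      rw [hcoe, reflTransGen_subtype hadj] at this
      exact reflTransGen_mono (fun x y hxy => ⟨hxy, fun e => hvH (e ▸ hxy.fst_mem),
        fun e => hvH (e ▸ hxy.snd_mem)⟩) this
  · rintro ⟨h3, h⟩
    have hne : ∀ a : H.verts, (({a}ᶜ : Set H.verts)).Nonempty := fun a => by
      obtain ⟨c, hc, hca, -⟩ := exists_third h3 a.1 a.1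
      exact ⟨⟨c, hc⟩, fun e => hca (congrArg Subtype.val e)⟩
    refine ⟨h3, connected_iff_reflTransGen.2 ⟨?_, fun a b => ?_⟩, fun v => ?_⟩
    · obtain ⟨c, hc⟩ := Set.nonempty_of_ncard_ne_zero (s := H.verts) (by omega)
      exact ⟨⟨c, hc⟩⟩
    · obtain ⟨c, hc, hca, hcb⟩ := exists_third h3 a.1 b.1
      rw [hcoe, reflTransGen_subtype hadj]
      exact (h c a a.2 b b.2 hca.symm hcb.symm).reflTransGen
    · refine { preconnected := induce_compl_preconnected_iff.2 fun a b ha hb => ?_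
               nonempty := (hne v).to_subtype }
      rw [hcoe, reachAvoid_subtype hadj]
      exact h v a a.2 b b.2 (fun e => ha (Subtype.ext e)) (fun e => hb (Subtype.ext e))

theorem isBiconnComp_iff {C : G.Subgraph} : IsBiconnComp G C ↔ Maximal Bicon C := by
  unfold IsBiconnComp
  have : (fun H : G.Subgraph => IsBiconnected H.coe) = Bicon :=
    funext fun H => propext isBiconnected_coe_iff
  rw [this]

/-- Of two common vertices one survives the removal of `v`, and in either subgraph everything else
still reaches it. -/
theorem Bicon.sup [Finite V] {H K : G.Subgraph} (hH : Bicon H) (hK : Bicon K) {p q : V}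
    (hpq : p ≠ q) (hpH : p ∈ H.verts) (hqH : q ∈ H.verts) (hpK : p ∈ K.verts)
    (hqK : q ∈ K.verts) : Bicon (H ⊔ K) := by
  refine ⟨hH.1.trans (Set.ncard_le_ncard (fun x hx => Or.inl hx) (Set.toFinite _)), fun v => ?_⟩
  obtain ⟨t, htv, htH, htK⟩ : ∃ t, t ≠ v ∧ t ∈ H.verts ∧ t ∈ K.verts := by
    by_cases hpv : p = v
    · exact ⟨q, fun e => hpq (hpv.trans e.symm), hqH, hqK⟩
    · exact ⟨p, hpv, hpH, hpK⟩
  have key : ∀ a ∈ (H ⊔ K).verts, a ≠ v → ReachAvoid (H ⊔ K).Adj v a t := by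
    rintro a (ha | ha) hav
    · exact (hH.2 v a ha t htH hav htv).mono fun x y h => Or.inl h
    · exact (hK.2 v a ha t htK hav htv).mono fun x y h => Or.inr h
  exact fun a ha b hb hav hbv => (key a ha hav).trans ((key b hb hbv).symm fun _ _ h => h.symm)

theorem IsBiconnComp.eq_of_mem [Finite V] {C D : G.Subgraph} (hC : IsBiconnComp G C)
    (hD : IsBiconnComp G D) {p q : V} (hpq : p ≠ q) (hpC : p ∈ C.verts) (hqC : q ∈ C.verts)
    (hpD : p ∈ D.verts) (hqD : q ∈ D.verts) : C = D := by
  rw [isBiconnComp_iff] at hC hD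
  have h := hC.1.sup hD.1 hpq hpC hqC hpD hqD
  exact le_antisymm (le_sup_left.trans (hD.2 h le_sup_right))
    (le_sup_right.trans (hC.2 h le_sup_left))

theorem Bicon.exists_isBiconnComp [Finite V] {H : G.Subgraph} (hH : Bicon H) :
    ∃ C, IsBiconnComp G C ∧ H ≤ C := by
  obtain ⟨C, hHC, hC⟩ := Finite.exists_le_maximal (p := Bicon) hH
  exact ⟨C, isBiconnComp_iff.2 hC, hHC⟩

theorem Bicon.exists_adj {H : G.Subgraph} (hH : Bicon H) {a : V} (ha : a ∈ H.verts) (z : V)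
    (hza : z ≠ a) : ∃ b, H.Adj a b ∧ b ≠ z := by
  obtain ⟨c, hc, hca, hcz⟩ := exists_third hH.1 a z
  rcases Relation.ReflTransGen.cases_head (hH.2 z a ha c hc hza.symm hcz) with h | ⟨b, h, -⟩
  · exact absurd h.symm hca
  · exact ⟨b, h.1, h.2.2⟩

/-- Deleting a vertex from a path leaves each other vertex connected to one of the ends. -/
theorem reachAvoid_of_mem_support {K : SimpleGraph V} {z a : V} : ∀ {u w : V} (p : K.Walk u w),
    p.IsPath → a ∈ p.support → a ≠ z →
      (ReachAvoid p.toSubgraph.Adj z a u ∨ ReachAvoid p.toSubgraph.Adj z a w) ∧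
      (z ∉ p.support → ReachAvoid p.toSubgraph.Adj z a u ∧ ReachAvoid p.toSubgraph.Adj z a w) := by
  intro u w p
  induction p with
  | nil =>
    intro _ ha _
    rw [SimpleGraph.Walk.support_nil, List.mem_singleton] at ha
    subst ha
    exact ⟨.inl (.refl _), fun _ => ⟨.refl _, .refl _⟩⟩
  | @cons u u' w h p ih =>
    intro hp ha haz
    rw [SimpleGraph.Walk.cons_isPath_iff] at hp
    have hle : ∀ x y, p.toSubgraph.Adj x y → (SimpleGraph.Walk.cons h p).toSubgraph.Adj x y :=
      fun x y hxy => Or.inr hxy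
    have hu : (SimpleGraph.Walk.cons h p).toSubgraph.Adj u u' := by
      left; simp
    rw [SimpleGraph.Walk.support_cons, List.mem_cons] at ha
    by_cases hap : a ∈ p.support
    · obtain ⟨h1, h2⟩ := ih hp.1 hap haz
      refine ⟨?_, fun hz => ?_⟩
      · by_cases hzu : z = u
        · exact .inr ((h2 (hzu ▸ hp.2)).2.mono hle)
        · rcases h1 with h1 | h1
          · exact .inl ((h1.mono hle).trans (.single hu.symm (h1.ne haz) (Ne.symm hzu)))
          · exact .inr (h1.mono hle)
      · rw [SimpleGraph.Walk.support_cons, List.mem_cons, not_or] at hz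
        obtain ⟨h3, h4⟩ := h2 hz.2
        exact ⟨(h3.mono hle).trans (.single hu.symm (h3.ne haz) (Ne.symm hz.1)), h4.mono hle⟩
    · obtain rfl : a = u := by tauto
      refine ⟨.inl (.refl _), fun hz => ⟨.refl _, ?_⟩⟩
      rw [SimpleGraph.Walk.support_cons, List.mem_cons, not_or] at hz
      have hu' : u' ≠ z := fun e => hz.2 (e ▸ p.start_mem_support)
      have h3 : ReachAvoid p.toSubgraph.Adj z u' w := by
        have hpc := (SimpleGraph.Walk.toSubgraph_connected p)
        have := (connected_iff_reflTransGen.1 hpc.coe).2 ⟨u', by simp⟩ ⟨w, by simp⟩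
        refine reflTransGen_map Subtype.val (fun x y hxy => ⟨hxy, ?_, ?_⟩) this
        · exact fun e => hz.2 (e ▸ p.mem_verts_toSubgraph.1 x.2)
        · exact fun e => hz.2 (e ▸ p.mem_verts_toSubgraph.1 y.2)
      exact (ReachAvoid.single hu haz hu').trans (h3.mono hle)

/-- Two edges at `v` whose other ends are connected in `G - v` lie on a cycle. -/
theorem exists_bicon_of_reachAvoid [Finite V] {v u w : V} (hu : G.Adj v u) (hw : G.Adj v w)
    (huw : u ≠ w) (h : ReachAvoid G.Adj v u w) :
    ∃ H : G.Subgraph, Bicon H ∧ H.Adj v u ∧ H.Adj v w := by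
  classical
  let K : SimpleGraph V :=
    { Adj := fun a b => G.Adj a b ∧ a ≠ v ∧ b ≠ v
      symm := ⟨fun a b h => ⟨h.1.symm, h.2.2, h.2.1⟩⟩
      loopless := ⟨fun a h => h.1.ne rfl⟩ }
  have hK : K.Reachable u w := (SimpleGraph.reachable_iff_reflTransGen _ _).2 h
  obtain ⟨p, hp⟩ := hK.exists_isPath
  have hpv : ∀ x ∈ p.support, x ≠ v := by
    intro x hx
    have : K.Reachable u x := ⟨p.takeUntil x hx⟩
    exact ReachAvoid.ne ((SimpleGraph.reachable_iff_reflTransGen _ _).1 this) hu.ne'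
  -- The cycle formed by `v` and the path `p`, which avoids `v` because its edges do.
  let H : G.Subgraph :=
    { verts := insert v {x | x ∈ p.support}
      Adj := fun x y => p.toSubgraph.Adj x y ∨ (x = v ∧ (y = u ∨ y = w)) ∨
        (y = v ∧ (x = u ∨ x = w))
      adj_sub := by
        rintro x y (h | ⟨rfl, rfl | rfl⟩ | ⟨rfl, rfl | rfl⟩)
        · exact h.adj_sub.1
        · exact hu
        · exact hw
        · exact hu.symm
        · exact hw.symm
      edge_vert := by
        rintro x y (h | ⟨rfl, -⟩ | ⟨rfl, rfl | rfl⟩)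
        · exact .inr (p.mem_verts_toSubgraph.1 h.fst_mem)
        · exact .inl rfl
        · exact .inr p.start_mem_support
        · exact .inr p.end_mem_support
      symm := ⟨by
        rintro x y (h | h | h)
        · exact .inl h.symm
        · exact .inr (.inr h)
        · exact .inr (.inl h)⟩ }
  have hHu : H.Adj v u := .inr (.inl ⟨rfl, .inl rfl⟩)
  have hHw : H.Adj v w := .inr (.inl ⟨rfl, .inr rfl⟩)
  have hle : ∀ x y, p.toSubgraph.Adj x y → H.Adj x y := fun _ _ h => .inl h
  refine ⟨H, ⟨?_, fun z => ?_⟩, hHu, hHw⟩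
  · have : ({v, u, w} : Set V).ncard = 3 := Set.ncard_eq_three.2 ⟨v, u, w, hu.ne, hw.ne, huw, rfl⟩
    rw [← this]
    refine Set.ncard_le_ncard ?_ (Set.toFinite _)
    rintro x (rfl | rfl | rfl)
    exacts [hHu.fst_mem, hHu.snd_mem, hHw.snd_mem]
  · by_cases hzv : z = v
    · subst hzv
      have key : ∀ a ∈ H.verts, a ≠ z → ReachAvoid H.Adj z a u := by
        rintro a (ha | ha) haz
        · exact absurd ha haz
        · exact ((reachAvoid_of_mem_support p hp ha haz).2 fun h => hpv z h rfl).1.mono hle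
      exact fun a ha b hb haz hbz =>
        (key a ha haz).trans ((key b hb hbz).symm fun _ _ h => h.symm)
    -- When a path vertex `z` is removed, every other path vertex still reaches an end of `p`, and
    -- both ends are adjacent to `v`.
    · have key : ∀ a ∈ H.verts, a ≠ z → ReachAvoid H.Adj z a v := by
        rintro a (ha | ha) haz
        · rw [ha]; exact .refl _
        · rcases (reachAvoid_of_mem_support p hp ha haz).1 with h | h
          · exact (h.mono hle).trans (.single hHu.symm (h.ne haz) (Ne.symm hzv))
          · exact (h.mono hle).trans (.single hHw.symm (h.ne haz) (Ne.symm hzv))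
      exact fun a ha b hb haz hbz =>
        (key a ha haz).trans ((key b hb hbz).symm fun _ _ h => h.symm)

theorem isBridge_iff_reflTransGen {a b : V} : G.IsBridge s(a, b) ↔
    ¬ Relation.ReflTransGen (fun x y => G.Adj x y ∧ s(x, y) ≠ s(a, b)) a b := by
  rw [SimpleGraph.isBridge_iff, SimpleGraph.reachable_iff_reflTransGen]
  have : (G.deleteEdges {s(a, b)}).Adj = fun x y => G.Adj x y ∧ s(x, y) ≠ s(a, b) := by
    ext x y
    simp [SimpleGraph.deleteEdges_adj]
  rw [this]

/-- Go from `a` to a third vertex `c` avoiding `b`, then from `c` to `b` avoiding `a`; neither part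
can use the edge `ab`. -/
theorem Bicon.not_isBridge {H : G.Subgraph} (hH : Bicon H) {a b : V} (hab : H.Adj a b) :
    ¬ G.IsBridge s(a, b) := by
  rw [isBridge_iff_reflTransGen, not_not]
  obtain ⟨c, hc, hca, hcb⟩ := exists_third hH.1 a b
  have h1 := hH.2 b a hab.fst_mem c hc hab.ne hcb
  have h2 := hH.2 a c hc b hab.snd_mem hca hab.adj_sub.ne'
  refine Relation.ReflTransGen.trans (reflTransGen_mono (fun x y h => ⟨h.1.adj_sub, ?_⟩) h1)
    (reflTransGen_mono (fun x y h => ⟨h.1.adj_sub, ?_⟩) h2)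
  · intro e
    rcases Sym2.eq_iff.1 e with ⟨-, e⟩ | ⟨e, -⟩
    exacts [h.2.2 e, h.2.1 e]
  · intro e
    rcases Sym2.eq_iff.1 e with ⟨e, -⟩ | ⟨-, e⟩
    exacts [h.2.1 e, h.2.2 e]

theorem exists_isBiconnComp_of_not_isBridge [Finite V] {a b : V} (hab : G.Adj a b)
    (h : ¬ G.IsBridge s(a, b)) : ∃ C, IsBiconnComp G C ∧ C.Adj a b := by
  rw [isBridge_iff_reflTransGen, not_not] at h
  -- The walk around `ab` is read backwards from `b`. Its last departure from `a` goes to some `c ≠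
  -- b` that reaches `b` off `a`, so `ab` and `ac` lie on a cycle.
  have key : ∀ y, Relation.ReflTransGen (fun x y => G.Adj x y ∧ s(x, y) ≠ s(a, b)) y b →
      (y ≠ a ∧ ReachAvoid G.Adj a y b) ∨ ∃ c, c ≠ b ∧ G.Adj a c ∧ ReachAvoid G.Adj a c b := by
    intro y hy
    induction hy using Relation.ReflTransGen.head_induction_on with
    | refl => exact .inl ⟨hab.ne', .refl _⟩
    | @head y y' hyy' _ ih =>
      rcases ih with ⟨hne, hr⟩ | ih
      · by_cases hya : y = a
        · subst hya
          exact .inr ⟨y', fun e => hyy'.2 (e ▸ rfl), hyy'.1, hr⟩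
        · exact .inl ⟨hya, (ReachAvoid.single hyy'.1 hya hne).trans hr⟩
      · exact .inr ih
  rcases key a h with ⟨h, -⟩ | ⟨c, hcb, hac, hr⟩
  · exact absurd rfl h
  · obtain ⟨H, hH, -, hHb⟩ := exists_bicon_of_reachAvoid hac hab hcb hr
    obtain ⟨C, hC, hle⟩ := hH.exists_isBiconnComp
    exact ⟨C, hC, hle.2 hHb⟩

end Bicon

/-! ### Blocks -/

section Block

variable {V : Type u} {G : SimpleGraph V}

/-- The bridges and the biconnected components are the blocks of `G`. -/
def Node.IsBlock : Node G → Prop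
  | .bridge _ _ => True
  | .comp _ _ => True
  | _ => False

theorem Node.subgraph_bridge_adj {e : Sym2 V} {he : IsBridgeEdge G e} {x y : V} :
    (Node.bridge e he).subgraph.Adj x y ↔ e = s(x, y) := by
  simp only [Node.subgraph, SimpleGraph.Subgraph.induce_adj, Set.mem_ofPred_eq,
    SimpleGraph.Subgraph.top_adj]
  constructor
  · rintro ⟨hx, hy, h⟩
    exact (Sym2.mem_and_mem_iff h.ne).1 ⟨hx, hy⟩
  · rintro rfl
    exact ⟨by simp, by simp, he.1⟩

theorem exists_block [Finite V] {a b : V} (h : G.Adj a b) :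
    ∃ B : Node G, B.IsBlock ∧ B.subgraph.Adj a b := by
  by_cases hb : G.IsBridge s(a, b)
  · exact ⟨.bridge s(a, b) ⟨h, hb⟩, trivial, Node.subgraph_bridge_adj.2 rfl⟩
  · obtain ⟨C, hC, hab⟩ := exists_isBiconnComp_of_not_isBridge h hb
    exact ⟨.comp C hC, trivial, hab⟩

/-- This identifies the components of `G - v` next to `v` with the blocks at `v`: distinct
neighbours joined off `v` close a cycle through `v`. -/
theorem exists_block_of_reachAvoid [Finite V] {v u w : V} (hu : G.Adj v u) (hw : G.Adj v w)
    (h : ReachAvoid G.Adj v u w) :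
    ∃ B : Node G, B.IsBlock ∧ B.subgraph.Adj v u ∧ B.subgraph.Adj v w := by
  by_cases huw : u = w
  · subst huw
    obtain ⟨B, hB, hBu⟩ := exists_block hu
    exact ⟨B, hB, hBu, hBu⟩
  · obtain ⟨H, hH, h1, h2⟩ := exists_bicon_of_reachAvoid hu hw huw h
    obtain ⟨C, hC, hle⟩ := hH.exists_isBiconnComp
    exact ⟨.comp C hC, trivial, hle.2 h1, hle.2 h2⟩

theorem Node.IsBlock.of_adj {B : Node G} {a b : V} (h : B.subgraph.Adj a b) : B.IsBlock := by
  cases B with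
  | art x _ =>
    obtain ⟨h1, h2, h3⟩ := h
    exact absurd (h1.trans h2.symm) (SimpleGraph.Adj.ne h3)
  | pend x _ =>
    obtain ⟨h1, h2, h3⟩ := h
    exact absurd (h1.trans h2.symm) (SimpleGraph.Adj.ne h3)
  | _ => trivial

/-- A biconnected component contains no bridge, and two components sharing both ends of an edge
coincide by maximality. -/
theorem block_unique [Finite V] {B B' : Node G} {a b : V} (h : B.subgraph.Adj a b)
    (h' : B'.subgraph.Adj a b) : B = B' := by
  have hB := Node.IsBlock.of_adj h
  have hB' := Node.IsBlock.of_adj h'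
  cases B with
  | art => exact hB.elim
  | pend => exact hB.elim
  | bridge e he =>
    cases B' with
    | art => exact hB'.elim
    | pend => exact hB'.elim
    | bridge e' he' =>
      obtain rfl := Node.subgraph_bridge_adj.1 h
      obtain rfl := Node.subgraph_bridge_adj.1 h'
      rfl
    | comp C hC =>
      obtain rfl := Node.subgraph_bridge_adj.1 h
      exact absurd he.2 ((isBiconnComp_iff.1 hC).1.not_isBridge h')
  | comp C hC =>
    cases B' with
    | art => exact hB'.elim
    | pend => exact hB'.elim
    | bridge e' he' =>
      obtain rfl := Node.subgraph_bridge_adj.1 h'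
      exact absurd he'.2 ((isBiconnComp_iff.1 hC).1.not_isBridge h)
    | comp C' hC' =>
      obtain rfl : C = C' :=
        hC.eq_of_mem hC' (SimpleGraph.Subgraph.Adj.ne h) (SimpleGraph.Subgraph.Adj.fst_mem h)
          (SimpleGraph.Subgraph.Adj.snd_mem h)
          (SimpleGraph.Subgraph.Adj.fst_mem h') (SimpleGraph.Subgraph.Adj.snd_mem h')
      rfl

theorem Node.IsBlock.exists_adj {B : Node G} (hB : B.IsBlock) {a : V}
    (ha : a ∈ B.subgraph.verts) : ∃ b, B.subgraph.Adj a b := by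
  cases B with
  | art => exact hB.elim
  | pend => exact hB.elim
  | bridge e he =>
    obtain ⟨b, rfl⟩ : ∃ b, e = s(a, b) := ha
    exact ⟨b, Node.subgraph_bridge_adj.2 rfl⟩
  | comp C hC =>
    have hC := (isBiconnComp_iff.1 hC).1
    obtain ⟨c, hc, hca, -⟩ := exists_third hC.1 a a
    obtain ⟨b, hb, -⟩ := hC.exists_adj ha c hca
    exact ⟨b, hb⟩

theorem Node.IsBlock.reachAvoid {B : Node G} (hB : B.IsBlock) {v a b : V}
    (ha : a ∈ B.subgraph.verts) (hb : b ∈ B.subgraph.verts) (hav : a ≠ v) (hbv : b ≠ v) :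
    ReachAvoid B.subgraph.Adj v a b := by
  cases B with
  | art => exact hB.elim
  | pend => exact hB.elim
  | bridge e he =>
    by_cases hab : a = b
    · rw [hab]; exact .refl _
    · exact .single (Node.subgraph_bridge_adj.2 ((Sym2.mem_and_mem_iff hab).1 ⟨ha, hb⟩)) hav hbv
  | comp C hC => exact (isBiconnComp_iff.1 hC).1.2 v a ha b hb hav hbv

theorem isArticulation_iff {v : V} :
    IsArticulation G v ↔ ¬ ∀ a b, a ≠ v → b ≠ v → ReachAvoid G.Adj v a b := by
  rw [IsArticulation, induce_compl_preconnected_iff]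

/-- A vertex shared by two blocks is an articulation point. -/
theorem isArticulation_of_mem_blocks [Finite V] {B B' : Node G} (hB : B.IsBlock)
    (hB' : B'.IsBlock) (hne : B ≠ B') {w : V} (hw : w ∈ B.subgraph.verts)
    (hw' : w ∈ B'.subgraph.verts) : IsArticulation G w := by
  rw [isArticulation_iff]
  intro h
  obtain ⟨b, hb⟩ := hB.exists_adj hw
  obtain ⟨b', hb'⟩ := hB'.exists_adj hw'
  obtain ⟨D, -, h1, h2⟩ := exists_block_of_reachAvoid hb.adj_sub hb'.adj_sub
    (h b b' hb.adj_sub.ne' hb'.adj_sub.ne')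
  exact hne ((block_unique hb h1).trans (block_unique h2 hb'))

/-- A walk through `p` enters and leaves by its only neighbour, so the detour can be cut out. -/
theorem IsPendant.not_isArticulation (hG : G.Connected) {p : V} (hp : IsPendant G p) :
    ¬ IsArticulation G p := by
  rw [isArticulation_iff, not_not]
  obtain ⟨u, hu, huniq⟩ := hp
  have key : ∀ y, Relation.ReflTransGen G.Adj u y → y ≠ p → ReachAvoid G.Adj p u y := by
    intro y hy
    have : y = p ∨ ReachAvoid G.Adj p u y := by
      induction hy with
      | refl => exact .inr (.refl _)
      | @tail y z _ hyz ih =>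
        by_cases hz : z = p
        · exact .inl hz
        · rcases ih with rfl | ih
          · rw [huniq z hyz]; exact .inr (.refl _)
          · exact .inr (ih.trans (.single hyz (ih.ne hu.ne') hz))
    tauto
  have hc := (connected_iff_reflTransGen.1 hG).2
  exact fun a b ha hb => ((key a (hc u a) ha).symm fun _ _ h => h.symm).trans (key b (hc u b) hb)

/-- The block of the edge at a pendant vertex is a bridge. -/
theorem IsPendant.exists_bridge [Finite V] {p : V} (hp : IsPendant G p) {B : Node G}
    (hB : B.IsBlock) (hpB : p ∈ B.subgraph.verts) : ∃ e he, B = .bridge e he := by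
  obtain ⟨u, hu, huniq⟩ := hp
  cases B with
  | art => exact hB.elim
  | pend => exact hB.elim
  | bridge e he => exact ⟨e, he, rfl⟩
  | comp C hC =>
    obtain ⟨b, hb, hbu⟩ := (isBiconnComp_iff.1 hC).1.exists_adj hpB u hu.ne'
    exact absurd (huniq b hb.adj_sub) hbu

end Block

/-! ### The `ABC`-tree is a tree -/

section Tree

variable {V : Type u} {G : SimpleGraph V}

theorem Node.exists_vertex_of_not_isBlock {x : Node G} (hx : ¬ x.IsBlock) :
    ∃ v, x.vertex? = some v := by
  cases x with
  | art a _ => exact ⟨a, rfl⟩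
  | pend p _ => exact ⟨p, rfl⟩
  | _ => exact absurd trivial hx

theorem Node.mem_verts_iff_of_vertex {x : Node G} {v w : V} (h : x.vertex? = some v) :
    w ∈ x.subgraph.verts ↔ w = v := by
  cases x <;> simp [Node.vertex?, Node.subgraph] at h ⊢ <;> rw [h]

theorem Node.Incident.isBlock {x y : Node G} (h : x.Incident y) : y.IsBlock := by
  cases x <;> cases y <;> simp [Node.Incident, Node.IsBlock] at h ⊢

theorem Node.Incident.not_isBlock {x y : Node G} (h : x.Incident y) : ¬ x.IsBlock := by
  cases x <;> cases y <;> simp [Node.Incident, Node.IsBlock] at h ⊢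

theorem Node.Incident.exists_vertex {x y : Node G} (h : x.Incident y) :
    ∃ v, x.vertex? = some v ∧ v ∈ y.subgraph.verts := by
  cases x <;> cases y <;> first | exact h.elim | exact ⟨_, rfl, h⟩

theorem Node.Incident.mem_verts {x y : Node G} (h : x.Incident y) {v : V}
    (hv : x.vertex? = some v) : v ∈ y.subgraph.verts := by
  obtain ⟨w, hw, hwy⟩ := h.exists_vertex
  rw [hv] at hw
  exact Option.some.inj hw ▸ hwy

theorem Node.incident_art {a : V} (ha : IsArticulation G a) {B : Node G} (hB : B.IsBlock)
    (haB : a ∈ B.subgraph.verts) : (Node.art a ha).Incident B := by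
  cases B with
  | art => exact hB.elim
  | pend => exact hB.elim
  | bridge => exact haB
  | comp => exact haB

theorem abcTree_adj_iff_of_isBlock {x y : Node G} (hx : x.IsBlock) :
    (abcTree G).Adj x y ↔ y.Incident x :=
  ⟨fun h => h.resolve_left fun h' => h'.not_isBlock hx, .inr⟩

theorem abcTree_adj_iff_of_not_isBlock {x y : Node G} (hx : ¬ x.IsBlock) :
    (abcTree G).Adj x y ↔ x.Incident y :=
  ⟨fun h => h.resolve_right fun h' => hx h'.isBlock, .inl⟩

/-- The set `s` is one side of a cut whose only edge is `xy`. -/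
theorem isBridge_of_closed {W : Type*} {K : SimpleGraph W} {x y : W} (s : Set W) (hx : x ∈ s)
    (hy : y ∉ s) (h : ∀ a ∈ s, ∀ b, K.Adj a b → s(a, b) ≠ s(x, y) → b ∈ s) :
    K.IsBridge s(x, y) := by
  rw [isBridge_iff_reflTransGen]
  intro hr
  have key : ∀ z, Relation.ReflTransGen (fun a b => K.Adj a b ∧ s(a, b) ≠ s(x, y)) x z →
      z ∈ s := by
    intro z hz
    induction hz with
    | refl => exact hx
    | tail _ hab ih => exact h _ ih _ hab.1 hab.2
  exact hy (key y hr)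

/-- A block containing the articulation point `a` and meeting the branch of the block `B` at `a`
is `B` itself. -/
theorem block_eq_of_mem_branch [Finite V] {B B' : Node G} (hB' : B'.IsBlock) {a b k : V}
    (hab : B.subgraph.Adj a b) (ha : a ∈ B'.subgraph.verts) (hk : k ∈ B'.subgraph.verts)
    (hka : k ≠ a) (hbk : ReachAvoid G.Adj a b k) : B' = B := by
  obtain ⟨b', hb'⟩ := hB'.exists_adj ha
  have h1 : ReachAvoid G.Adj a k b' :=
    (hB'.reachAvoid hk hb'.snd_mem hka hb'.adj_sub.ne').mono fun _ _ h => h.adj_sub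
  -- Through `k`, the neighbours `b` and `b'` of `a` lie in one component of `G - a`, so one block
  -- contains both edges `ab` and `ab'`.
  obtain ⟨D, -, h2, h3⟩ := exists_block_of_reachAvoid hab.adj_sub hb'.adj_sub (hbk.trans h1)
  exact (block_unique hb' h3).trans (block_unique h2 hab)

/-- At an articulation point `a`, the cut consists of the nodes that have a vertex other than `a` in
the component of `G - a` reached through the block `y`. A tree edge leaving this set must lead to
the node `a`, and it starts at `y` by `block_eq_of_mem_branch`. A pendant vertex is a leaf of the
tree, since its single edge lies in a single block. -/
theorem isBridge_of_incident [Finite V] (hG : G.Connected) {x y : Node G} (h : x.Incident y) :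
    (abcTree G).IsBridge s(y, x) := by
  have hy := h.isBlock
  cases x with
  | bridge => exact absurd trivial h.not_isBlock
  | comp => exact absurd trivial h.not_isBlock
  | pend p hp =>
    rw [Sym2.eq_swap]
    refine isBridge_of_closed {Node.pend p hp} rfl (fun e => ?_) ?_
    · rw [Set.mem_singleton_iff] at e
      subst e
      exact hy
    · rintro _ rfl z hz hne
      rw [abcTree_adj_iff_of_not_isBlock id] at hz
      obtain ⟨b, hb⟩ := hy.exists_adj (h.mem_verts rfl)
      obtain ⟨c, hc⟩ := hz.isBlock.exists_adj (hz.mem_verts rfl)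
      have hbc : b = c := hp.unique hb.adj_sub hc.adj_sub
      subst hbc
      exact absurd (by rw [block_unique hc hb]) hne
  | art a ha =>
    have hay : a ∈ y.subgraph.verts := h.mem_verts rfl
    obtain ⟨b, hb⟩ := hy.exists_adj hay
    refine isBridge_of_closed
      {z | ∃ k ∈ z.subgraph.verts, k ≠ a ∧ ReachAvoid G.Adj a b k}
      ⟨b, hb.snd_mem, hb.adj_sub.ne', .refl _⟩ ?_ ?_
    · rintro ⟨k, hk, hka, -⟩
      exact hka hk
    · rintro z ⟨k, hk, hka, hr⟩ z' hzz' hne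
      by_cases hz : z.IsBlock
      · rw [abcTree_adj_iff_of_isBlock hz] at hzz'
        obtain ⟨w, hw, hwz⟩ := hzz'.exists_vertex
        by_cases hwa : w = a
        · subst hwa
          obtain rfl := block_eq_of_mem_branch hz hb hwz hk hka hr
          cases z' with
          | art w' _ =>
            obtain rfl := Option.some.inj hw
            exact absurd rfl hne
          | pend w' hp =>
            obtain rfl := Option.some.inj hw
            exact absurd ha (hp.not_isArticulation hG)
          | bridge => exact absurd trivial hzz'.not_isBlock
          | comp => exact absurd trivial hzz'.not_isBlock
        · exact ⟨w, (Node.mem_verts_iff_of_vertex hw).2 rfl, hwa,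
            hr.trans ((hz.reachAvoid hk hwz hka hwa).mono fun _ _ h => h.adj_sub)⟩
      · rw [abcTree_adj_iff_of_not_isBlock hz] at hzz'
        obtain ⟨w, hw, hwz⟩ := hzz'.exists_vertex
        rw [Node.mem_verts_iff_of_vertex hw] at hk
        subst hk
        exact ⟨k, hwz, hka, hr⟩

theorem abcTree_isAcyclic [Finite V] (hG : G.Connected) : (abcTree G).IsAcyclic := by
  rw [SimpleGraph.isAcyclic_iff_forall_adj_isBridge]
  rintro x y (h | h)
  · rw [Sym2.eq_swap]; exact isBridge_of_incident hG h
  · exact isBridge_of_incident hG h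

theorem reachable_of_mem_blocks [Finite V] {B B' : Node G} (hB : B.IsBlock) (hB' : B'.IsBlock)
    {v : V} (hv : v ∈ B.subgraph.verts) (hv' : v ∈ B'.subgraph.verts) :
    (abcTree G).Reachable B B' := by
  by_cases hne : B = B'
  · rw [hne]
  · have ha := isArticulation_of_mem_blocks hB hB' hne hv hv'
    have h1 : (abcTree G).Adj B (.art v ha) := .inr (Node.incident_art ha hB hv)
    have h2 : (abcTree G).Adj (.art v ha) B' := .inl (Node.incident_art ha hB' hv')
    exact h1.reachable.trans h2.reachable

theorem Node.exists_incident [Finite V] (hG : G.Connected) {x : Node G} (hx : ¬ x.IsBlock) :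
    ∃ B, x.Incident B := by
  cases x with
  | bridge => exact absurd trivial hx
  | comp => exact absurd trivial hx
  | pend p hp =>
    obtain ⟨u, hu⟩ := hp.exists
    obtain ⟨B, hB, hpB⟩ := exists_block hu
    obtain ⟨e, he, rfl⟩ := hp.exists_bridge hB hpB.fst_mem
    exact ⟨.bridge e he, hpB.fst_mem⟩
  | art a ha =>
    have : ∃ y, y ≠ a := by
      by_contra! h
      exact isArticulation_iff.1 ha fun x _ hx => absurd (h x) hx
    obtain ⟨y, hy⟩ := this
    rcases Relation.ReflTransGen.cases_head ((connected_iff_reflTransGen.1 hG).2 a y) with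
      h | ⟨u, hu, -⟩
    · exact absurd h.symm hy
    · obtain ⟨B, hB, haB⟩ := exists_block hu
      exact ⟨B, Node.incident_art ha hB haB.fst_mem⟩

theorem Node.verts_nonempty (x : Node G) : x.subgraph.verts.Nonempty := by
  cases x with
  | art a _ => exact ⟨a, rfl⟩
  | pend p _ => exact ⟨p, rfl⟩
  | bridge e _ => induction e with | h a b => exact ⟨a, Sym2.mem_mk_left a b⟩
  | comp C hC =>
    have h3 := (isBiconnComp_iff.1 hC).1.1
    have h0 : C.verts.ncard ≠ 0 := by omega
    exact Set.nonempty_of_ncard_ne_zero h0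

/-- A walk in `G` is followed by the blocks of its edges. Consecutive blocks share a vertex, hence
coincide or are joined through an articulation point. -/
theorem abcTree_connected [Finite V] (hG : G.Connected) {R : Node G} (hR : R.IsBlock) :
    (abcTree G).Connected := by
  obtain ⟨r, hr⟩ := R.verts_nonempty
  have h1 : ∀ v, ∀ B : Node G, B.IsBlock → v ∈ B.subgraph.verts →
      (abcTree G).Reachable R B := by
    intro v
    have hv := (connected_iff_reflTransGen.1 hG).2 r v
    induction hv with
    | refl => exact fun B hB hv => reachable_of_mem_blocks hR hB hr hv
    | @tail a b _ hab ih =>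
      intro B hB hbB
      obtain ⟨D, hD, hDab⟩ := exists_block hab
      exact (ih D hD hDab.fst_mem).trans (reachable_of_mem_blocks hD hB hDab.snd_mem hbB)
  have h2 : ∀ x, (abcTree G).Reachable R x := by
    intro x
    by_cases hx : x.IsBlock
    · obtain ⟨v, hv⟩ := x.verts_nonempty
      exact h1 v x hx hv
    · obtain ⟨B, hB⟩ := Node.exists_incident hG hx
      obtain ⟨v, -, hv⟩ := hB.exists_vertex
      exact (h1 v B hB.isBlock hv).trans (SimpleGraph.Adj.reachable (.inr hB))
  exact { preconnected := fun a b => (h2 a).symm.trans (h2 b), nonempty := ⟨R⟩ }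

theorem abcTree_isTree [Finite V] (hG : G.Connected) {R : Node G} (hR : R.IsBlock) :
    (abcTree G).IsTree :=
  ⟨abcTree_connected hG hR, abcTree_isAcyclic hG⟩

end Tree

/-! ### Graphs without biconnected components -/

section NoComponent

variable {V : Type u} {G : SimpleGraph V}

theorem isTree_of_no_isBiconnComp [Finite V] (hG : G.Connected)
    (h : ¬ ∃ C : G.Subgraph, IsBiconnComp G C) : G.IsTree := by
  refine ⟨hG, SimpleGraph.isAcyclic_iff_forall_adj_isBridge.2 fun a b hab => ?_⟩
  by_contra hb
  obtain ⟨C, hC, -⟩ := exists_isBiconnComp_of_not_isBridge hab hb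
  exact h ⟨C, hC⟩

/-- Every edge of a tree is a bridge, so the only connected spanning subgraph is the tree itself. -/
theorem IsMIS.isRMIS_of_isTree (hG : G.IsTree) {M : Set V} (hM : IsMIS G M) : IsRMIS G M := by
  refine ⟨hM, fun H hHG hH => ?_⟩
  have : H = G := by
    refine le_antisymm hHG fun a b hab => ?_
    by_contra hn
    have hb := SimpleGraph.isAcyclic_iff_forall_adj_isBridge.1 hG.isAcyclic hab
    rw [isBridge_iff_reflTransGen] at hb
    refine hb (reflTransGen_mono (fun x y hxy => ⟨hHG hxy, fun e => hn ?_⟩)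
      ((connected_iff_reflTransGen.1 hH).2 a b))
    have : s(a, b) ∈ H.edgeSet := e ▸ hxy
    exact this
  rwa [this]

theorem exists_isMIS [Finite V] : ∃ M, IsMIS G M := by
  obtain ⟨M, -, hM⟩ := Finite.exists_le_maximal (p := G.IsIndepSet) (a := ∅)
    (by simp [SimpleGraph.isIndepSet_iff])
  exact ⟨M, hM⟩

end NoComponent

/-! ### The rooted tree -/

section RootedTree

variable {V : Type u} {G : SimpleGraph V} {R : Node G}

theorem children_cases (hT : (abcTree G).IsTree) {x y : Node G} (h : (abcTree G).Adj x y) :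
    y ∈ children R x ∨ x ∈ children R y := by
  rcases hT.dist_eq_dist_add_one_of_adj R h with h' | h'
  · exact .inr ⟨h.symm, h'⟩
  · exact .inl ⟨h, h'⟩

/-- The parent is the first stop on a shortest walk to the root. -/
theorem exists_parent (hT : (abcTree G).IsTree) {x : Node G} (hx : x ≠ R) :
    ∃ z, x ∈ children R z := by
  obtain ⟨p, hp⟩ := (hT.connected x R).exists_walk_length_eq_dist
  cases p with
  | nil => exact absurd rfl hx
  | @cons _ z _ h p =>
    refine ⟨z, h.symm, ?_⟩
    have h1 := SimpleGraph.dist_le p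
    have h2 : (abcTree G).dist x R ≤ (abcTree G).dist x z + (abcTree G).dist z R :=
      hT.connected.dist_triangle
    have h3 : (abcTree G).dist x z = 1 := SimpleGraph.dist_eq_one_iff_adj.2 h
    rw [SimpleGraph.Walk.length_cons] at hp
    rw [SimpleGraph.dist_comm (u := R) (v := x), SimpleGraph.dist_comm (u := R) (v := z)]
    omega

theorem reflTransGen_of_dist_le (hT : (abcTree G).IsTree) (d : ℕ) : ∀ z : Node G,
    (abcTree G).dist R z ≤ d → Relation.ReflTransGen (fun a b => (abcTree G).Adj a b ∧
      (abcTree G).dist R a ≤ d ∧ (abcTree G).dist R b ≤ d) R z := by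
  intro z
  induction hn : (abcTree G).dist R z generalizing z with
  | zero =>
    intro _
    rw [(hT.connected.dist_eq_zero_iff.1 hn)]
  | succ n ih =>
    intro hd
    have hz : z ≠ R := by
      rintro rfl
      rw [SimpleGraph.dist_self] at hn
      omega
    obtain ⟨y, hy, hyd⟩ := exists_parent hT hz
    exact (ih y (by omega) (by omega)).tail ⟨hy, by omega, by omega⟩

/-- By `reflTransGen_of_dist_le` two parents of `y` are joined through the root by nodes nearer to
it than `y`. Together with the edge `x'y` this would bypass `xy`, although every edge of a tree is a
bridge. -/
theorem parent_unique (hT : (abcTree G).IsTree) {x x' y : Node G} (h : y ∈ children R x)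
    (h' : y ∈ children R x') : x = x' := by
  by_contra hne
  have hb := SimpleGraph.isAcyclic_iff_forall_adj_isBridge.1 hT.isAcyclic h.1
  rw [isBridge_iff_reflTransGen] at hb
  apply hb
  have h1 := h.2
  have h2 := h'.2
  have key : ∀ a b, ((abcTree G).Adj a b ∧ (abcTree G).dist R a ≤ (abcTree G).dist R x ∧
      (abcTree G).dist R b ≤ (abcTree G).dist R x) →
      ((abcTree G).Adj a b ∧ s(a, b) ≠ s(x, y)) := by
    rintro a b ⟨hab, ha, hb⟩
    refine ⟨hab, fun e => ?_⟩
    rcases Sym2.eq_iff.1 e with ⟨-, rfl⟩ | ⟨rfl, -⟩ <;> omega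
  have e1 := reflTransGen_mono key (reflTransGen_of_dist_le (R := R) hT _ x le_rfl)
  have e2 := reflTransGen_mono key
    (reflTransGen_of_dist_le (R := R) hT ((abcTree G).dist R x) x' (by omega))
  have e3 : Relation.ReflTransGen
      (fun a b => (abcTree G).Adj a b ∧ s(a, b) ≠ s(x, y)) x R := by
    rw [← Relation.reflTransGen_swap]
    refine reflTransGen_mono (fun a b hab => ⟨hab.1.symm, fun e => hab.2 ?_⟩) e1
    rw [← e, Sym2.eq_swap]
  refine (e3.trans e2).tail ⟨h'.1, fun e => ?_⟩
  rcases Sym2.eq_iff.1 e with ⟨e, -⟩ | ⟨e, -⟩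
  · exact hne e.symm
  · rw [e] at h2; omega

theorem ne_root_of_mem_children {x c : Node G} (h : c ∈ children R x) : c ≠ R := by
  rintro rfl
  have := h.2
  rw [SimpleGraph.dist_self] at this
  omega

theorem parent?_eq (hT : (abcTree G).IsTree) {x c : Node G} (h : c ∈ children R x) :
    parent? R c = some x := by
  have hex : ∃ z, c ∈ children R z := ⟨x, h⟩
  rw [parent?, dif_pos hex, parent_unique hT hex.choose_spec h]

theorem mem_subtree_self (x : Node G) : x ∈ subtree R x := Relation.ReflTransGen.refl

theorem mem_subtree_tail {x y z : Node G} (hy : y ∈ subtree R x) (hz : z ∈ children R y) :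
    z ∈ subtree R x := Relation.ReflTransGen.tail hy hz

theorem subtree_child_subset {x c : Node G} (hc : c ∈ children R x) :
    subtree R c ⊆ subtree R x := fun _ hy => Relation.ReflTransGen.head hc hy

theorem mem_subtree_iff {x y : Node G} :
    y ∈ subtree R x ↔ y = x ∨ ∃ c ∈ children R x, y ∈ subtree R c := by
  constructor
  · intro h
    rcases Relation.ReflTransGen.cases_head h with h | ⟨c, hc, h⟩
    exacts [.inl h.symm, .inr ⟨c, hc, h⟩]
  · rintro (rfl | ⟨c, hc, h⟩)
    exacts [mem_subtree_self _, subtree_child_subset hc h]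

theorem dist_le_of_mem_subtree {x y : Node G} (h : y ∈ subtree R x) :
    (abcTree G).dist R x ≤ (abcTree G).dist R y := by
  induction h with
  | refl => exact le_rfl
  | tail _ h ih => exact ih.trans (by rw [h.2]; omega)

theorem notMem_subtree_child {x c : Node G} (hc : c ∈ children R x) : x ∉ subtree R c := by
  intro h
  have := dist_le_of_mem_subtree h
  rw [hc.2] at this
  omega

theorem parent_mem_subtree (hT : (abcTree G).IsTree) {x y z : Node G} (hy : y ∈ subtree R x)
    (hne : y ≠ x) (hz : y ∈ children R z) : z ∈ subtree R x := by
  rcases Relation.ReflTransGen.cases_tail hy with h | ⟨z', hz', h⟩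
  · exact absurd h hne
  · rw [parent_unique hT hz h]; exact hz'

theorem children_eq_of_mem_subtree (hT : (abcTree G).IsTree) {x c c' y : Node G}
    (hc : c ∈ children R x) (hc' : c' ∈ children R x) (hy : y ∈ subtree R c)
    (hy' : y ∈ subtree R c') : c = c' := by
  induction hy with
  | refl =>
    by_contra hne
    exact notMem_subtree_child hc' (parent_mem_subtree hT hy' hne hc)
  | @tail z y hz hzy ih =>
    by_cases hne : y = c'
    · subst hne
      rw [parent_unique hT hzy hc'] at hz
      exact absurd hz (notMem_subtree_child hc)
    · exact ih (parent_mem_subtree hT hy' hne hzy)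

theorem mem_subtree_root (hT : (abcTree G).IsTree) (x : Node G) : x ∈ subtree R R := by
  induction hn : (abcTree G).dist R x generalizing x with
  | zero => rw [(hT.connected.dist_eq_zero_iff.1 hn)]; exact mem_subtree_self _
  | succ n ih =>
    have hx : x ≠ R := by
      rintro rfl
      rw [SimpleGraph.dist_self] at hn
      omega
    obtain ⟨y, hy⟩ := exists_parent hT hx
    exact mem_subtree_tail (ih y (by have := hy.2; omega)) hy

theorem isBlock_of_mem_children {x c : Node G} (hx : ¬ x.IsBlock) (hc : c ∈ children R x) :
    c.IsBlock := ((abcTree_adj_iff_of_not_isBlock hx).1 hc.1).isBlock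

theorem not_isBlock_of_mem_children {x c : Node G} (hx : x.IsBlock) (hc : c ∈ children R x) :
    ¬ c.IsBlock := ((abcTree_adj_iff_of_isBlock hx).1 hc.1).not_isBlock

/-! ### Attachment vertices -/

theorem attach?_of_vertex {x : Node G} {v : V} (h : x.vertex? = some v) :
    attach? R x = some v := by
  cases x <;> simp [Node.vertex?] at h ⊢ <;> simp [attach?, h]

theorem attach?_of_isBlock (hT : (abcTree G).IsTree) {x c : Node G} (hcb : c.IsBlock)
    (hc : c ∈ children R x) : attach? R c = x.vertex? := by
  cases c with
  | art => exact hcb.elim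
  | pend => exact hcb.elim
  | bridge => simp [attach?, parent?_eq hT hc]
  | comp => simp [attach?, parent?_eq hT hc]

theorem exists_attach? (hT : (abcTree G).IsTree) {x : Node G} (hx : x ≠ R) :
    ∃ v, attach? R x = some v ∧ v ∈ x.subgraph.verts := by
  by_cases hxb : x.IsBlock
  · obtain ⟨z, hz⟩ := exists_parent hT hx
    obtain ⟨v, hv, hvx⟩ := ((abcTree_adj_iff_of_isBlock hxb).1 hz.1.symm).exists_vertex
    exact ⟨v, (attach?_of_isBlock hT hxb hz).trans hv, hvx⟩
  · obtain ⟨v, hv⟩ := Node.exists_vertex_of_not_isBlock hxb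
    exact ⟨v, attach?_of_vertex hv, (Node.mem_verts_iff_of_vertex hv).2 rfl⟩

theorem attach?_mem (hT : (abcTree G).IsTree) {x : Node G} (hx : x ≠ R) {v : V}
    (hv : attach? R x = some v) : v ∈ x.subgraph.verts := by
  obtain ⟨w, hw, hwx⟩ := exists_attach? hT hx
  rw [hv] at hw
  exact Option.some.inj hw ▸ hwx

theorem attach?_child_mem (hT : (abcTree G).IsTree) {x c : Node G} (hc : c ∈ children R x)
    {v : V} (hv : attach? R c = some v) : v ∈ x.subgraph.verts := by
  by_cases hx : x.IsBlock
  · have hi := (abcTree_adj_iff_of_isBlock hx).1 hc.1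
    obtain ⟨w, hw, hwx⟩ := hi.exists_vertex
    rw [attach?_of_vertex hw] at hv
    exact Option.some.inj hv ▸ hwx
  · have hi := (abcTree_adj_iff_of_not_isBlock hx).1 hc.1
    rw [attach?_of_isBlock hT hi.isBlock hc] at hv
    exact (Node.mem_verts_iff_of_vertex hv).2 rfl

theorem mem_verts_subtreeGraph {x : Node G} {v : V} :
    v ∈ (subtreeGraph R x).verts ↔ ∃ y ∈ subtree R x, v ∈ y.subgraph.verts := by
  simp [subtreeGraph, SimpleGraph.Subgraph.verts_iSup]

theorem adj_subtreeGraph {x : Node G} {v w : V} :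
    (subtreeGraph R x).Adj v w ↔ ∃ y ∈ subtree R x, y.subgraph.Adj v w := by
  simp [subtreeGraph, SimpleGraph.Subgraph.iSup_adj]

theorem mem_verts_subtreeGraph_iff {x : Node G} {v : V} : v ∈ (subtreeGraph R x).verts ↔
    v ∈ x.subgraph.verts ∨ ∃ c ∈ children R x, v ∈ (subtreeGraph R c).verts := by
  simp only [mem_verts_subtreeGraph]
  constructor
  · rintro ⟨y, hy, hv⟩
    rcases mem_subtree_iff.1 hy with rfl | ⟨c, hc, hy⟩
    exacts [.inl hv, .inr ⟨c, hc, y, hy, hv⟩]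
  · rintro (hv | ⟨c, hc, y, hy, hv⟩)
    exacts [⟨x, mem_subtree_self _, hv⟩, ⟨y, subtree_child_subset hc hy, hv⟩]

theorem verts_subset_subtreeGraph {x y : Node G} (hy : y ∈ subtree R x) :
    y.subgraph.verts ⊆ (subtreeGraph R x).verts :=
  fun _ hv => mem_verts_subtreeGraph.2 ⟨y, hy, hv⟩

/-! ### Overlaps between the graphs of subtrees -/

section Finite

variable [Finite V]

/-- Every block through a vertex of `G[T_x]` other than the attachment vertex belongs to `T_x`. -/
theorem block_mem_subtree (hT : (abcTree G).IsTree) (hR : R.IsBlock) {x : Node G} {w : V}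
    (hw : w ∈ (subtreeGraph R x).verts) (hne : attach? R x ≠ some w) {B : Node G}
    (hB : B.IsBlock) (hwB : w ∈ B.subgraph.verts) : B ∈ subtree R x := by
  -- First some block `D` of `T_x` through `w`: if `w` comes from a vertex node `y`, then `y ≠ x`
  -- because `w ≠ v(x)`, and the parent block of `y` is still in `T_x`.
  obtain ⟨D, hDx, hD, hwD⟩ : ∃ D ∈ subtree R x, D.IsBlock ∧ w ∈ D.subgraph.verts := by
    obtain ⟨y, hy, hwy⟩ := mem_verts_subtreeGraph.1 hw
    by_cases hyb : y.IsBlock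
    · exact ⟨y, hy, hyb, hwy⟩
    obtain ⟨v, hv⟩ := Node.exists_vertex_of_not_isBlock hyb
    obtain rfl := (Node.mem_verts_iff_of_vertex hv).1 hwy
    have hyx : y ≠ x := fun e => hne (e ▸ attach?_of_vertex hv)
    obtain ⟨z, hz⟩ := exists_parent hT (x := y) (R := R) fun e => hyb (e ▸ hR)
    have hi := (abcTree_adj_iff_of_not_isBlock hyb).1 hz.1.symm
    exact ⟨z, parent_mem_subtree hT hy hyx hz, hi.isBlock, hi.mem_verts hv⟩
  by_cases hDB : D = B
  · exact hDB ▸ hDx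
  -- Now `w` is an articulation node adjacent to both `D` and `B`. The way from `D` over `w` to `B`
  -- could leave `T_x` only upwards from `x`, with `x = D` or `x` the node `w`; in either case `w`
  -- would be `v(x)`.
  have ha := isArticulation_of_mem_blocks hD hB hDB hwD hwB
  have h1 : (abcTree G).Adj D (.art w ha) := .inr (Node.incident_art ha hD hwD)
  have h2 : (abcTree G).Adj (.art w ha) B := .inl (Node.incident_art ha hB hwB)
  have h3 : Node.art w ha ∈ subtree R x := by
    rcases children_cases (R := R) hT h1 with h | h
    · exact mem_subtree_tail hDx h
    · refine parent_mem_subtree hT hDx ?_ h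
      rintro rfl
      exact hne (attach?_of_isBlock hT hD h)
  rcases children_cases (R := R) hT h2 with h | h
  · exact mem_subtree_tail h3 h
  · refine parent_mem_subtree hT h3 ?_ h
    rintro rfl
    exact hne rfl

/-- A block `x` containing another vertex of `G[T_c]` would have to belong to `T_c` by
`block_mem_subtree`, yet it is the parent of `c`. -/
theorem attach?_of_mem_verts (hT : (abcTree G).IsTree) (hR : R.IsBlock) {x c : Node G}
    (hc : c ∈ children R x) {w : V} (hwc : w ∈ (subtreeGraph R c).verts)
    (hwx : w ∈ x.subgraph.verts) : attach? R c = some w := by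
  by_cases hx : x.IsBlock
  · by_contra hne
    exact notMem_subtree_child hc (block_mem_subtree hT hR hwc hne hx hwx)
  · obtain ⟨v, hv⟩ := Node.exists_vertex_of_not_isBlock hx
    obtain rfl := (Node.mem_verts_iff_of_vertex hv).1 hwx
    rw [attach?_of_isBlock hT (isBlock_of_mem_children hx hc) hc, hv]

/-- If `w ≠ v(c)`, all blocks through `w` lie in `T_c`. But a node of `T_{c'}` containing `w`
supplies a block through `w` that is in `T_{c'}` or equals `x`, and neither is part of `T_c`. -/
theorem attach?_of_mem_inter (hT : (abcTree G).IsTree) (hR : R.IsBlock) {x c c' : Node G}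
    (hc : c ∈ children R x) (hc' : c' ∈ children R x) (hne : c ≠ c') {w : V}
    (hw : w ∈ (subtreeGraph R c).verts) (hw' : w ∈ (subtreeGraph R c').verts) :
    attach? R c = some w := by
  by_contra hn
  have key := fun B => block_mem_subtree hT hR hw hn (B := B)
  obtain ⟨y, hy, hwy⟩ := mem_verts_subtreeGraph.1 hw'
  by_cases hyb : y.IsBlock
  · exact hne (children_eq_of_mem_subtree hT hc hc' (key y hyb hwy) hy)
  obtain ⟨v, hv⟩ := Node.exists_vertex_of_not_isBlock hyb
  obtain rfl := (Node.mem_verts_iff_of_vertex hv).1 hwy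
  obtain ⟨z, hz⟩ := exists_parent hT (x := y) (R := R) fun e => hyb (e ▸ hR)
  have hi := (abcTree_adj_iff_of_not_isBlock hyb).1 hz.1.symm
  have hzc := key z hi.isBlock (hi.mem_verts hv)
  by_cases hyc : y = c'
  · subst hyc
    rw [parent_unique hT hz hc'] at hzc
    exact notMem_subtree_child hc hzc
  · exact hne (children_eq_of_mem_subtree hT hc hc' hzc (parent_mem_subtree hT hy hyc hz))

end Finite

/-! ### Connectedness of `G[T_x]` -/

theorem Node.reflTransGen_adj (x : Node G) {a b : V} (ha : a ∈ x.subgraph.verts)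
    (hb : b ∈ x.subgraph.verts) : Relation.ReflTransGen x.subgraph.Adj a b := by
  by_cases hab : a = b
  · rw [hab]
  cases x with
  | art => exact absurd (Eq.trans ha (Eq.symm hb)) hab
  | pend => exact absurd (Eq.trans ha (Eq.symm hb)) hab
  | bridge e he =>
    exact .single (Node.subgraph_bridge_adj.2 ((Sym2.mem_and_mem_iff hab).1 ⟨ha, hb⟩))
  | comp C hC =>
    have hC := (isBiconnComp_iff.1 hC).1
    obtain ⟨c, -, hca, hcb⟩ := exists_third hC.1 a b
    exact (hC.2 c a ha b hb hca.symm hcb.symm).reflTransGen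

theorem subtreeGraph_reflTransGen {x y : Node G} (hy : y ∈ subtree R x) {a b : V}
    (ha : a ∈ x.subgraph.verts) (hb : b ∈ y.subgraph.verts) :
    Relation.ReflTransGen (subtreeGraph R x).Adj a b := by
  have hle : ∀ z ∈ subtree R x, ∀ a b, z.subgraph.Adj a b → (subtreeGraph R x).Adj a b :=
    fun z hz a b h => adj_subtreeGraph.2 ⟨z, hz, h⟩
  induction hy generalizing b with
  | refl => exact reflTransGen_mono (hle x (mem_subtree_self _)) (x.reflTransGen_adj ha hb)
  | @tail y z hy hyz ih =>
    obtain ⟨w, hwy, hwz⟩ : ∃ w, w ∈ y.subgraph.verts ∧ w ∈ z.subgraph.verts := by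
      rcases hyz.1 with h | h
      · obtain ⟨w, hw, hwz⟩ := h.exists_vertex
        exact ⟨w, (Node.mem_verts_iff_of_vertex hw).2 rfl, hwz⟩
      · obtain ⟨w, hw, hwz⟩ := h.exists_vertex
        exact ⟨w, hwz, (Node.mem_verts_iff_of_vertex hw).2 rfl⟩
    exact (ih hwy).trans
      (reflTransGen_mono (hle z (mem_subtree_tail hy hyz)) (z.reflTransGen_adj hwz hb))

theorem subtreeGraph_connected (x : Node G) : (subtreeGraph R x).coe.Connected := by
  obtain ⟨a, ha⟩ := x.verts_nonempty
  have ha' := verts_subset_subtreeGraph (mem_subtree_self (R := R) x) ha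
  have key : ∀ b : (subtreeGraph R x).verts,
      (subtreeGraph R x).coe.Reachable ⟨a, ha'⟩ b := by
    rintro ⟨b, hb⟩
    obtain ⟨y, hy, hby⟩ := mem_verts_subtreeGraph.1 hb
    rw [SimpleGraph.reachable_iff_reflTransGen]
    exact (reflTransGen_subtype (r := (subtreeGraph R x).Adj) fun x y h => h.snd_mem).2
      (subtreeGraph_reflTransGen hy ha hby)
  exact { preconnected := fun b c => (key b).symm.trans (key c), nonempty := ⟨⟨a, ha'⟩⟩ }

end RootedTree

/-! ### Local conditions on the nodes of the tree -/

section Local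

variable {V : Type u} {G : SimpleGraph V} {R : Node G}

/-- `M` contains no edge of a node in `N`. -/
def IndepIn (N : Set (Node G)) (M : Set V) : Prop :=
  ∀ B ∈ N, ∀ a b, B.subgraph.Adj a b → a ∈ M → b ∉ M

/-- All neighbours of `w` in some block that belongs to `N` are in `M`. -/
def SecureIn (N : Set (Node G)) (M : Set V) (w : V) : Prop :=
  ∃ B ∈ N, (∃ u, B.subgraph.Adj w u) ∧ ∀ u, B.subgraph.Adj w u → u ∈ M

theorem IndepIn.mono {N N' : Set (Node G)} {M : Set V} (h : IndepIn N' M) (hN : N ⊆ N') :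
    IndepIn N M := fun B hB => h B (hN hB)

theorem SecureIn.mono {N N' : Set (Node G)} {M : Set V} {w : V} (h : SecureIn N M w)
    (hN : N ⊆ N') : SecureIn N' M w := by
  obtain ⟨B, hB, h⟩ := h
  exact ⟨B, hN hB, h⟩

/-! ### Independence and security read off from the blocks -/

section Criterion

variable {W : Type*} {H : SimpleGraph W} {φ : W → V} {N : Set (Node G)}

theorem isIndepSet_iff_indepIn
    (hadj : ∀ a b, H.Adj a b ↔ ∃ B ∈ N, B.subgraph.Adj (φ a) (φ b)) {S : Set W} :
    H.IsIndepSet S ↔ IndepIn N (φ '' S) := by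
  rw [isIndepSet_iff_forall]
  constructor
  · rintro h B hB _ _ hab ⟨a, ha, rfl⟩ ⟨b, hb, rfl⟩
    exact h a b ((hadj a b).2 ⟨B, hB, hab⟩) ha hb
  · intro h a b hab ha hb
    obtain ⟨B, hB, hBab⟩ := (hadj a b).1 hab
    exact h B hB _ _ hBab ⟨a, ha, rfl⟩ ⟨b, hb, rfl⟩

/-- A block stays connected when `y` is removed, so the neighbours of `y` in one block lie in one
component; conversely neighbours joined off `y` share a block. The injection `φ` lets the same
argument serve `G` and every `G[T_x]`, and `hclosed` keeps walks within a block inside `H`. -/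
theorem secure_iff_secureIn [Finite V] (hφ : φ.Injective)
    (hadj : ∀ a b, H.Adj a b ↔ ∃ B ∈ N, B.subgraph.Adj (φ a) (φ b))
    (hclosed : ∀ B ∈ N, ∀ a u, B.subgraph.Adj (φ a) u → ∃ b, φ b = u) {S : Set W} {y : W} :
    Secure H S y ↔ SecureIn N (φ '' S) (φ y) := by
  constructor
  · rintro ⟨u, hyu, h⟩
    obtain ⟨B, hB, hByu⟩ := (hadj y u).1 hyu
    refine ⟨B, hB, ⟨_, hByu⟩, fun w' hw' => ?_⟩
    have key : ∀ z, ReachAvoid B.subgraph.Adj (φ y) (φ u) z →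
        ∃ w, φ w = z ∧ ReachAvoid H.Adj y u w := by
      intro z hz
      induction hz with
      | refl => exact ⟨u, rfl, .refl _⟩
      | @tail z z' _ hzz' ih =>
        obtain ⟨w, rfl, hw⟩ := ih
        obtain ⟨w', rfl⟩ := hclosed B hB _ _ hzz'.1
        exact ⟨w', rfl, hw.trans (.single ((hadj _ _).2 ⟨B, hB, hzz'.1⟩)
          (fun e => hzz'.2.1 (e ▸ rfl)) (fun e => hzz'.2.2 (e ▸ rfl)))⟩
    obtain ⟨w, rfl, hw⟩ := key w' ((Node.IsBlock.of_adj hByu).reachAvoid hByu.snd_mem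
      hw'.snd_mem hByu.adj_sub.ne' hw'.adj_sub.ne')
    exact ⟨w, h w ((hadj _ _).2 ⟨B, hB, hw'⟩) hw, rfl⟩
  · rintro ⟨B, hB, ⟨u', hu'⟩, h⟩
    obtain ⟨u, rfl⟩ := hclosed B hB _ _ hu'
    refine ⟨u, (hadj _ _).2 ⟨B, hB, hu'⟩, fun w hw hr => ?_⟩
    have hr' : ReachAvoid G.Adj (φ y) (φ u) (φ w) := by
      refine hr.map φ fun a b hab ha hb => ⟨?_, fun e => ha (hφ e), fun e => hb (hφ e)⟩
      obtain ⟨D, -, hD⟩ := (hadj a b).1 hab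
      exact hD.adj_sub
    obtain ⟨D, -, hDw⟩ := (hadj y w).1 hw
    obtain ⟨D, -, h1, h2⟩ := exists_block_of_reachAvoid hu'.adj_sub hDw.adj_sub hr'
    rw [block_unique h1 hu'] at h2
    obtain ⟨w', hw', e⟩ := h _ h2
    exact hφ e ▸ hw'

end Criterion

/-- `M` is a robust MIS of `G[T_x]`, except that `v(x)` may be undominated. -/
def Good (R x : Node G) (M : Set V) : Prop :=
  IndepIn (subtree R x) M ∧ ∀ w ∈ (subtreeGraph R x).verts, w ∉ M → attach? R x ≠ some w →
    SecureIn (subtree R x) M w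

/-- `M` is a set of vertices that realizes the label `l` at the node `x`. -/
def Realizes (R x : Node G) (l : Label) (M : Set V) : Prop :=
  Good R x M ∧ ∀ v, attach? R x = some v →
    (v ∈ M ↔ l = Label.PI) ∧ (l = Label.PO → SecureIn (subtree R x) M v)

theorem indepIn_congr {x : Node G} {M M' : Set V}
    (h : ∀ w ∈ (subtreeGraph R x).verts, w ∈ M ↔ w ∈ M') :
    IndepIn (subtree R x) M ↔ IndepIn (subtree R x) M' := by
  refine forall₂_congr fun B hB => forall₃_congr fun a b hab => ?_
  rw [h a (verts_subset_subtreeGraph hB hab.fst_mem),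
    h b (verts_subset_subtreeGraph hB hab.snd_mem)]

theorem secureIn_congr {x : Node G} {M M' : Set V}
    (h : ∀ w ∈ (subtreeGraph R x).verts, w ∈ M ↔ w ∈ M') {w : V} :
    SecureIn (subtree R x) M w ↔ SecureIn (subtree R x) M' w := by
  refine exists_congr fun B => and_congr_right fun hB => and_congr_right fun _ =>
    forall₂_congr fun u hu => ?_
  rw [h u (verts_subset_subtreeGraph hB hu.snd_mem)]

theorem good_congr {x : Node G} {M M' : Set V}
    (h : ∀ w ∈ (subtreeGraph R x).verts, w ∈ M ↔ w ∈ M') :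
    Good R x M ↔ Good R x M' := by
  refine and_congr (indepIn_congr h) (forall₂_congr fun w hw => ?_)
  rw [h w hw, secureIn_congr h]

theorem attach?_mem_subtreeGraph (hT : (abcTree G).IsTree) {x : Node G} (hx : x ≠ R) {v : V}
    (hv : attach? R x = some v) : v ∈ (subtreeGraph R x).verts :=
  verts_subset_subtreeGraph (mem_subtree_self x) (attach?_mem hT hx hv)

theorem realizes_congr (hT : (abcTree G).IsTree) {x : Node G} (hx : x ≠ R) {l : Label}
    {M M' : Set V} (h : ∀ w ∈ (subtreeGraph R x).verts, w ∈ M ↔ w ∈ M') :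
    Realizes R x l M ↔ Realizes R x l M' := by
  refine and_congr (good_congr h) (forall₂_congr fun v hv => ?_)
  rw [h v (attach?_mem_subtreeGraph hT hx hv), secureIn_congr h]

/-- Sets of vertices of `G[T_x]` are traded for subsets of `V`, which can be compared at different
nodes; this is harmless when only the trace on `s` matters. -/
theorem exists_image_iff {s : Set V} {P : Set V → Prop}
    (hP : ∀ M M' : Set V, (∀ w ∈ s, w ∈ M ↔ w ∈ M') → P M → P M') :
    (∃ S : Set s, P (Subtype.val '' S)) ↔ ∃ M, P M := by
  refine ⟨fun ⟨S, hS⟩ => ⟨_, hS⟩, fun ⟨M, hM⟩ => ⟨Subtype.val ⁻¹' M, hP M _ (fun w hw => ?_) hM⟩⟩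
  simp [hw]

theorem attach?_root (hR : R.IsBlock) : attach? R R = none := by
  have h : parent? R R = none := dif_neg fun ⟨_, hz⟩ => ne_root_of_mem_children hz rfl
  cases R with
  | art => exact hR.elim
  | pend => exact hR.elim
  | bridge => simp [attach?, h]
  | comp => simp [attach?, h]

theorem secureIn_subtree_iff {x : Node G} {M : Set V} {w : V} :
    SecureIn (subtree R x) M w ↔
      SecureIn {x} M w ∨ ∃ c ∈ children R x, SecureIn (subtree R c) M w := by
  constructor
  · rintro ⟨B, hB, h⟩
    rcases mem_subtree_iff.1 hB with rfl | ⟨c, hc, hBc⟩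
    exacts [.inl ⟨B, rfl, h⟩, .inr ⟨c, hc, B, hBc, h⟩]
  · rintro (⟨_, rfl, h⟩ | ⟨c, hc, B, hB, h⟩)
    exacts [⟨_, mem_subtree_self _, h⟩, ⟨B, subtree_child_subset hc hB, h⟩]

theorem SecureIn.mem_verts {x : Node G} {M : Set V} {w : V} (h : SecureIn (subtree R x) M w) :
    w ∈ (subtreeGraph R x).verts := by
  obtain ⟨B, hB, ⟨u, hu⟩, -⟩ := h
  exact verts_subset_subtreeGraph hB hu.fst_mem

section Finite

variable [Finite V]

theorem isRMIS_subtreeGraph_iff {x : Node G} {S : Set (subtreeGraph R x).verts} :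
    IsRMIS (subtreeGraph R x).coe S ↔ IndepIn (subtree R x) (Subtype.val '' S) ∧
      ∀ w ∈ (subtreeGraph R x).verts, w ∉ Subtype.val '' S →
        SecureIn (subtree R x) (Subtype.val '' S) w := by
  have hadj : ∀ a b, (subtreeGraph R x).coe.Adj a b ↔
      ∃ B ∈ subtree R x, B.subgraph.Adj a.1 b.1 := fun a b => adj_subtreeGraph
  rw [isRMIS_iff (subtreeGraph_connected x),
    isIndepSet_iff_indepIn hadj]
  simp only [secure_iff_secureIn Subtype.val_injective hadj
    fun B hB a u h => ⟨⟨u, verts_subset_subtreeGraph hB h.snd_mem⟩, rfl⟩]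
  refine and_congr_right fun _ => ⟨fun h w hw hwS => h ⟨w, hw⟩ fun hS => hwS ⟨_, hS, rfl⟩,
    fun h w hwS => h w.1 w.2 ?_⟩
  rintro ⟨w', hw', e⟩
  exact hwS (Subtype.ext e ▸ hw')

theorem exists_isRMIS_aerial_subtreeGraph_iff {x : Node G} {v : V}
    (hv : v ∈ (subtreeGraph R x).verts) :
    (∃ S, IsRMIS (aerial (subtreeGraph R x).coe ⟨v, hv⟩) S ∧ some ⟨v, hv⟩ ∉ S) ↔
      ∃ S : Set (subtreeGraph R x).verts, IndepIn (subtree R x) (Subtype.val '' S) ∧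
        v ∉ Subtype.val '' S ∧ ∀ w ∈ (subtreeGraph R x).verts, w ∉ Subtype.val '' S → v ≠ w →
        SecureIn (subtree R x) (Subtype.val '' S) w := by
  have hadj : ∀ a b, (subtreeGraph R x).coe.Adj a b ↔
      ∃ B ∈ subtree R x, B.subgraph.Adj a.1 b.1 := fun a b => adj_subtreeGraph
  rw [exists_isRMIS_aerial (subtreeGraph_connected x)]
  refine exists_congr fun S => ?_
  rw [isIndepSet_iff_indepIn hadj]
  simp only [secure_iff_secureIn Subtype.val_injective hadj
    fun B hB a u h => ⟨⟨u, verts_subset_subtreeGraph hB h.snd_mem⟩, rfl⟩]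
  have hmem : ∀ w : (subtreeGraph R x).verts, w.1 ∈ Subtype.val '' S ↔ w ∈ S :=
    fun w => Subtype.val_injective.mem_set_image
  refine and_congr_right fun _ => and_congr (not_congr (hmem ⟨v, hv⟩).symm)
    ⟨fun h w hw hwS hne => h ⟨w, hw⟩ (fun hS => hwS ⟨_, hS, rfl⟩)
      (fun e => hne (congrArg Subtype.val e).symm),
    fun h w hwS hne => h w.1 w.2 (fun hw => hwS ((hmem w).1 hw))
      (fun e => hne (Subtype.ext e.symm))⟩

/-- PI and PO both describe RMISs of `G[T_x]`: a selected `v(x)` needs no security, and PO demands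
it explicitly. The extra vertex behind PE exempts `v(x)`, which is exactly what `Good` allows. -/
theorem isCorrect_iff (hT : (abcTree G).IsTree) {x : Node G} (hx : x ≠ R) {L : Finset Label} :
    IsCorrect R x L ↔ (Label.PI ∈ L ↔ ∃ M, Realizes R x .PI M) ∧
      (Label.PO ∈ L ↔ ∃ M, Realizes R x .PO M) ∧
      (Label.PE ∈ L ↔ Label.PO ∉ L ∧ ∃ M, Realizes R x .PE M) := by
  obtain ⟨v, hv, -⟩ := exists_attach? hT hx
  have hvx := attach?_mem_subtreeGraph hT hx hv
  have hcongr := fun l M M' h => (realizes_congr (M := M) (M' := M') (l := l) hT hx h).1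
  have hmem : ∀ S : Set (subtreeGraph R x).verts,
      (⟨v, hvx⟩ : (subtreeGraph R x).verts) ∈ S ↔ v ∈ Subtype.val '' S :=
    fun S => (Subtype.val_injective.mem_set_image (a := ⟨v, hvx⟩)).symm
  have hPI : (∃ S, IsRMIS (subtreeGraph R x).coe S ∧ ⟨v, hvx⟩ ∈ S) ↔
      ∃ M, Realizes R x .PI M := by
    rw [← exists_image_iff (hcongr .PI)]
    refine exists_congr fun S => ?_
    rw [isRMIS_subtreeGraph_iff, hmem, Realizes, Good]
    simp only [hv, Option.some.injEq, forall_eq', iff_true, reduceCtorEq, false_imp_iff,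
      and_true, and_congr_left_iff, and_congr_right_iff, ne_eq]
    exact fun h _ => ⟨fun h' w hw hwS _ => h' w hw hwS,
      fun h' w hw hwS => h' w hw hwS fun e => hwS (e ▸ h)⟩
  have hPO : (∃ S, IsRMIS (subtreeGraph R x).coe S ∧ ⟨v, hvx⟩ ∉ S) ↔
      ∃ M, Realizes R x .PO M := by
    rw [← exists_image_iff (hcongr .PO)]
    refine exists_congr fun S => ?_
    rw [isRMIS_subtreeGraph_iff, hmem, Realizes, Good]
    simp only [hv, Option.some.injEq, forall_eq', reduceCtorEq, iff_false, ne_eq, true_imp_iff]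
    constructor
    · rintro ⟨⟨h1, h2⟩, h3⟩
      exact ⟨⟨h1, fun w hw hwS _ => h2 w hw hwS⟩, h3, h2 v hvx h3⟩
    · rintro ⟨⟨h1, h2⟩, h3, h4⟩
      refine ⟨⟨h1, fun w hw hwS => ?_⟩, h3⟩
      by_cases e : v = w
      · exact e ▸ h4
      · exact h2 w hw hwS e
  have hPE : (∃ S, IsRMIS (aerial (subtreeGraph R x).coe ⟨v, hvx⟩) S ∧ some ⟨v, hvx⟩ ∉ S) ↔
      ∃ M, Realizes R x .PE M := by
    rw [← exists_image_iff (hcongr .PE), exists_isRMIS_aerial_subtreeGraph_iff]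
    refine exists_congr fun S => ?_
    simp only [Realizes, Good, hv, Option.some.injEq, forall_eq', reduceCtorEq, iff_false, ne_eq,
      false_imp_iff, and_true]
    tauto
  rw [← hPI, ← hPO, ← hPE]
  constructor
  · rintro ⟨w, hw, hwx, h⟩
    obtain rfl := Option.some.inj (hv.symm.trans hw)
    exact h
  · exact fun h => ⟨v, hv, hvx, h⟩

/-- The root has no attachment vertex, hence no exemption, and every edge of `G` lies in some block
of the whole tree. -/
theorem isRMIS_iff_good (hG : G.Connected) (hT : (abcTree G).IsTree) (hR : R.IsBlock)
    {M : Set V} : IsRMIS G M ↔ Good R R M := by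
  have hadj : ∀ a b, G.Adj a b ↔ ∃ B ∈ subtree R R, B.subgraph.Adj (id a) (id b) := by
    refine fun a b => ⟨fun h => ?_, fun ⟨B, _, h⟩ => h.adj_sub⟩
    obtain ⟨B, -, hB⟩ := exists_block h
    exact ⟨B, mem_subtree_root hT B, hB⟩
  have hverts : ∀ w, w ∈ (subtreeGraph R R).verts := by
    intro w
    obtain ⟨y, hy⟩ : ∃ y, y ≠ w := by
      obtain ⟨a, ha⟩ := R.verts_nonempty
      obtain ⟨b, hb⟩ := hR.exists_adj ha
      by_cases haw : a = w
      · exact ⟨b, fun e => hb.adj_sub.ne (haw.trans e.symm)⟩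
      · exact ⟨a, haw⟩
    rcases Relation.ReflTransGen.cases_head ((connected_iff_reflTransGen.1 hG).2 w y) with
      h | ⟨u, hu, -⟩
    · exact absurd h.symm hy
    · obtain ⟨B, hB, hBu⟩ := (hadj w u).1 hu
      exact verts_subset_subtreeGraph hB hBu.fst_mem
  rw [isRMIS_iff hG, isIndepSet_iff_indepIn hadj]
  simp only [secure_iff_secureIn Function.injective_id hadj fun B hB a u h => ⟨u, rfl⟩]
  simp [Good, hverts, attach?_root hR]

/-- The recursion behind all labeling rules. A vertex of `G[T_c]` other than `v(c)` has all its
blocks in `T_c`, so its security is decided there; a vertex of `x` is secured by `x` itself or by a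
child attached at it. -/
theorem good_iff (hT : (abcTree G).IsTree) (hR : R.IsBlock) {x : Node G} {M : Set V} :
    Good R x M ↔ IndepIn {x} M ∧ (∀ c ∈ children R x, Good R c M) ∧
      ∀ w ∈ x.subgraph.verts, w ∉ M → attach? R x ≠ some w → SecureIn {x} M w ∨
        ∃ c ∈ children R x, attach? R c = some w ∧ SecureIn (subtree R c) M w := by
  constructor
  · rintro ⟨hi, hs⟩
    refine ⟨hi.mono (Set.singleton_subset_iff.2 (mem_subtree_self x)), fun c hc =>
      ⟨hi.mono (subtree_child_subset hc), fun w hw hwM hne => ?_⟩, fun w hw hwM hne => ?_⟩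
    · have hne' : attach? R x ≠ some w := by
        intro e
        by_cases hx : x = R
        · subst hx
          rw [attach?_root hR] at e
          cases e
        · exact hne (attach?_of_mem_verts hT hR hc hw (attach?_mem hT hx e))
      obtain ⟨B, hB, ⟨u, hu⟩, h⟩ :=
        hs w (mem_verts_subtreeGraph_iff.2 (.inr ⟨c, hc, hw⟩)) hwM hne'
      exact ⟨B, block_mem_subtree hT hR hw hne (.of_adj hu) hu.fst_mem, ⟨u, hu⟩, h⟩
    · refine (secureIn_subtree_iff.1
        (hs w (mem_verts_subtreeGraph_iff.2 (.inl hw)) hwM hne)).imp_right ?_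
      rintro ⟨c, hc, h⟩
      exact ⟨c, hc, attach?_of_mem_verts hT hR hc h.mem_verts hw, h⟩
  · rintro ⟨hi, hc, hs⟩
    have h1 : ∀ w ∈ x.subgraph.verts, w ∉ M → attach? R x ≠ some w →
        SecureIn (subtree R x) M w := by
      intro w hw hwM hne
      refine secureIn_subtree_iff.2 ((hs w hw hwM hne).imp_right ?_)
      rintro ⟨c, hc, -, h⟩
      exact ⟨c, hc, h⟩
    refine ⟨fun B hB => ?_, fun w hw hwM hne => ?_⟩
    · rcases mem_subtree_iff.1 hB with rfl | ⟨c, hcx, hBc⟩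
      exacts [hi _ rfl, (hc c hcx).1 B hBc]
    · rcases mem_verts_subtreeGraph_iff.1 hw with hw | ⟨c, hcx, hwc⟩
      · exact h1 w hw hwM hne
      · by_cases hcw : attach? R c = some w
        · exact h1 w (attach?_child_mem hT hcx hcw) hwM hne
        · exact ((hc c hcx).2 w hwc hwM hcw).mono (subtree_child_subset hcx)

theorem Good.of_mem_subtree (hT : (abcTree G).IsTree) (hR : R.IsBlock) {x y : Node G}
    {M : Set V} (h : Good R x M) (hy : y ∈ subtree R x) : Good R y M := by
  induction hy with
  | refl => exact h
  | tail _ hyz ih => exact ((good_iff hT hR).1 ih).2.1 _ hyz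

/-- Gluing sets given on `x` and on the subtrees of its children. -/
theorem glue_mem_iff (hT : (abcTree G).IsTree) (hR : R.IsBlock) {x : Node G} {X : Set V}
    {m : Node G → Set V} (hX : X ⊆ x.subgraph.verts)
    (hm : ∀ c ∈ children R x, m c ⊆ (subtreeGraph R c).verts)
    (hXm : ∀ c ∈ children R x, ∀ v, attach? R c = some v → (v ∈ m c ↔ v ∈ X)) :
    (∀ w ∈ x.subgraph.verts, w ∈ X ∪ ⋃ c : children R x, m c ↔ w ∈ X) ∧
    ∀ c ∈ children R x, ∀ w ∈ (subtreeGraph R c).verts,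
      w ∈ X ∪ ⋃ c : children R x, m c ↔ w ∈ m c := by
  have h1 : ∀ c ∈ children R x, ∀ w ∈ x.subgraph.verts, w ∈ m c → w ∈ X := fun c hc w hw hwc =>
    (hXm c hc w (attach?_of_mem_verts hT hR hc (hm c hc hwc) hw)).1 hwc
  refine ⟨fun w hw => ⟨?_, .inl⟩, fun c hc w hw => ⟨?_, fun h => .inr ?_⟩⟩
  · rintro (h | h)
    · exact h
    · obtain ⟨c, hwc⟩ := Set.mem_iUnion.1 h
      exact h1 c.1 c.2 w hw hwc
  · have h2 : w ∈ X → w ∈ m c := fun h =>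
      (hXm c hc w (attach?_of_mem_verts hT hR hc hw (hX h))).2 h
    rintro (h | h)
    · exact h2 h
    · obtain ⟨c', hwc'⟩ := Set.mem_iUnion.1 h
      by_cases hne : c'.1 = c
      · exact hne ▸ hwc'
      · have := attach?_of_mem_inter hT hR c'.2 hc hne (hm c'.1 c'.2 hwc') hw
        exact h2 (h1 c'.1 c'.2 w (attach?_child_mem hT c'.2 this) hwc')
  · exact Set.mem_iUnion.2 ⟨⟨c, hc⟩, h⟩

end Finite

end Local

/-! ### Correctness of the 2-SAT reduction -/

section Fits

variable {W : Type u} {H : SimpleGraph W} {L : W → Finset Label}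

/-- The requirement of a flag on a set of vertices of the component. -/
def Flag.AgreesOn (X : Set W) : Flag W → Prop
  | .isIn v => v ∈ X
  | .isOut v => v ∉ X
  | .free => True

/-- The sets of vertices of a component that are compatible with the labels. -/
def Fits (H : SimpleGraph W) (L : W → Finset Label) (X : Set W) : Prop :=
  (∀ w, L w ≠ ∅ → (w ∈ X → Label.PI ∈ L w) ∧ (w ∉ X → Label.PO ∈ L w ∨ Label.PE ∈ L w)) ∧
  (∀ u w, H.Adj u w → u ∈ X → w ∉ X) ∧
  ∀ w ∉ X, Label.PO ∈ L w ∨ ∀ u, H.Adj w u → u ∈ X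

/-- If neither end of an edge is selected, each end must carry PO, since otherwise it would need all
its neighbours selected. With independence this splits every edge of `cutPO H L`, while an edge with
PO at both ends only forbids selecting both. As PO and PE never occur together, a label set forces
its vertex exactly when it is a singleton. -/
theorem fits_iff (hL : ∀ w, ¬ (Label.PO ∈ L w ∧ Label.PE ∈ L w)) {X : Set W} :
    Fits H L X ↔ (∀ w, L w = {Label.PI} → w ∈ X) ∧
      (∀ w, L w = {Label.PO} ∨ L w = {Label.PE} → w ∉ X) ∧
      (∀ u w, H.Adj u w → Label.PO ∈ L u → Label.PO ∈ L w → u ∉ X ∨ w ∉ X) ∧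
      ∀ u w, (cutPO H L).Adj u w → (u ∈ X ↔ w ∉ X) := by
  constructor
  · rintro ⟨h1, h2, h3⟩
    refine ⟨fun w hw => ?_, fun w hw hwX => ?_, fun u w huw _ _ => ?_, fun u w huw => ?_⟩
    · by_contra hwX
      have := (h1 w (by simp [hw])).2 hwX
      simp [hw] at this
    · rcases hw with hw | hw
      all_goals
        have := (h1 w (by simp [hw])).1 hwX
        simp [hw] at this
    · by_contra! hn
      exact h2 u w huw hn.1 hn.2
    · refine ⟨h2 u w huw.1, fun hw => ?_⟩
      by_contra hu
      rcases h3 w hw with hwP | hw'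
      · rcases h3 u hu with huP | hu'
        · exact huw.2 ⟨huP, hwP⟩
        · exact hw (hu' w huw.1)
      · exact hu (hw' u huw.1.symm)
  · rintro ⟨h1, h2, h3, h4⟩
    refine ⟨fun w hw => ⟨fun hwX => ?_, fun hwX => ?_⟩, fun u w huw hu hw => ?_, fun w hw => ?_⟩
    · by_contra hPI
      obtain ⟨l, hl⟩ := Finset.nonempty_iff_ne_empty.2 hw
      refine h2 w ?_ hwX
      cases l with
      | PI => exact absurd hl hPI
      | PO =>
        left
        ext l
        cases l with
        | PI => simpa using hPI
        | PO => simpa using hl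
        | PE => simpa using fun h => hL w ⟨hl, h⟩
      | PE =>
        right
        ext l
        cases l with
        | PI => simpa using hPI
        | PO => simpa using fun h => hL w ⟨h, hl⟩
        | PE => simpa using hl
    · by_contra! hn
      obtain ⟨l, hl⟩ := Finset.nonempty_iff_ne_empty.2 hw
      refine hwX (h1 w ?_)
      cases l with
      | PI =>
        ext l
        cases l with
        | PI => simpa using hl
        | PO => simpa using hn.1
        | PE => simpa using hn.2
      | PO => exact absurd hl hn.1
      | PE => exact absurd hl hn.2
    · by_cases hP : Label.PO ∈ L u ∧ Label.PO ∈ L w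
      · rcases h3 u w huw hP.1 hP.2 with h | h
        exacts [h hu, h hw]
      · exact (h4 u w ⟨huw, hP⟩).1 hu hw
    · by_cases hP : Label.PO ∈ L w
      · exact .inl hP
      · exact .inr fun u hu => (h4 u w ⟨hu.symm, fun h => hP h.2⟩).2 hw

theorem lit_neg_holds {X : SimpleGraph W} {c : X.Coloring Bool} {s : X.ConnectedComponent → Bool}
    {w : W} : (lit c w).neg.Holds s ↔ ¬ (lit c w).Holds s := by
  simp [Literal.Holds, Literal.neg, Bool.eq_not]

theorem formula_holds_iff {c : (cutPO H L).Coloring Bool}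
    {flag : Flag W} {s : (cutPO H L).ConnectedComponent → Bool} :
    (∀ k ∈ formula H L c flag, k.Holds s) ↔
      ((∀ w, L w = {Label.PI} → (lit c w).Holds s) ∧
      (∀ w, L w = {Label.PO} ∨ L w = {Label.PE} → ¬ (lit c w).Holds s) ∧
      (∀ u w, H.Adj u w → Label.PO ∈ L u → Label.PO ∈ L w →
        ¬ (lit c u).Holds s ∨ ¬ (lit c w).Holds s)) ∧
      flag.AgreesOn {w | (lit c w).Holds s} := by
  constructor
  · intro h
    refine ⟨⟨fun w hw => ?_, fun w hw => ?_, fun u w huw hu hw => ?_⟩, ?_⟩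
    · exact h (.unit (lit c w)) (.inl (.inl (.inl ⟨w, hw, rfl⟩)))
    · exact lit_neg_holds.1 (h (.unit (lit c w).neg) (.inl (.inl (.inr ⟨w, hw, rfl⟩))))
    · exact (h (.or (lit c u).neg (lit c w).neg)
        (.inl (.inr ⟨u, w, huw, hu, hw, rfl⟩))).imp lit_neg_holds.1 lit_neg_holds.1
    · cases flag with
      | isIn v => exact h (.unit (lit c v)) (.inr rfl)
      | isOut v => exact lit_neg_holds.1 (h (.unit (lit c v).neg) (.inr rfl))
      | free => trivial
  · rintro ⟨⟨h1, h2, h3⟩, h4⟩ k (((⟨w, hw, rfl⟩ | ⟨w, hw, rfl⟩) | ⟨u, w, huw, hu, hw, rfl⟩) | hk)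
    · exact h1 w hw
    · exact lit_neg_holds.2 (h2 w hw)
    · exact (h3 u w huw hu hw).imp lit_neg_holds.2 lit_neg_holds.2
    · cases flag with
      | isIn v => obtain rfl := hk; exact h4
      | isOut v => obtain rfl := hk; exact lit_neg_holds.2 h4
      | free => exact hk.elim

theorem lit_holds_of_adj {X : SimpleGraph W} (c : X.Coloring Bool)
    (s : X.ConnectedComponent → Bool) {u w : W} (h : X.Adj u w) :
    (lit c u).Holds s ↔ ¬ (lit c w).Holds s := by
  have h1 : X.connectedComponentMk u = X.connectedComponentMk w :=
    SimpleGraph.ConnectedComponent.sound h.reachable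
  have h2 := c.valid h
  simp only [Literal.Holds, lit, h1]
  revert h2
  generalize c u = a
  generalize c w = b
  generalize s _ = d
  revert a b d
  decide

/-- Every set that splits the edges of a 2-coloured graph is given by an assignment. -/
theorem exists_assignment {Y : SimpleGraph W} (c : Y.Coloring Bool) {X : Set W}
    (hX : ∀ u w, Y.Adj u w → (u ∈ X ↔ w ∉ X)) :
    ∃ s : Y.ConnectedComponent → Bool, {w | (lit c w).Holds s} = X := by
  classical
  -- Along an edge both the colour and the membership in `X` flip, so their agreement is constant on
  -- a connected component; it is the value of the variable.
  have key : ∀ u w, Y.Reachable u w → (c u == decide (u ∈ X)) = (c w == decide (w ∈ X)) := by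
    intro u w h
    rw [SimpleGraph.reachable_iff_reflTransGen] at h
    induction h with
    | refl => rfl
    | @tail a b _ hab ih =>
      rw [ih]
      have h1 := c.valid hab
      have h2 := hX a b hab
      by_cases hb : b ∈ X <;> simp only [hb, not_true, not_false_eq_true, iff_true, iff_false]
        at h2 <;> simp only [h2, hb, decide_true, decide_false] <;> revert h1 <;>
        generalize c a = p <;> generalize c b = q <;> revert p q <;> decide
  refine ⟨fun K => K.lift (fun w => c w == decide (w ∈ X)) (fun u w p _ => key u w ⟨p⟩), ?_⟩
  ext w
  simp only [Literal.Holds, lit, Set.mem_ofPred_eq, SimpleGraph.ConnectedComponent.lift_mk]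
  by_cases hw : w ∈ X <;> simp [hw]

variable [Finite W] {B : BipartiteTest.{u}} {S : TwoSatSolver.{u}} {flag : Flag W}

theorem fits_of_solveComponent (hL : ∀ w, ¬ (Label.PO ∈ L w ∧ Label.PE ∈ L w)) {X : Set W}
    (h : solveComponent B S H L flag = some X) : Fits H L X ∧ flag.AgreesOn X := by
  rw [solveComponent, Option.bind_eq_some_iff] at h
  obtain ⟨c, -, h⟩ := h
  rw [Option.map_eq_some_iff] at h
  obtain ⟨s, hs, rfl⟩ := h
  obtain ⟨⟨h1, h2, h3⟩, h4⟩ := formula_holds_iff.1 (S.sound _ s hs)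
  exact ⟨(fits_iff hL).2 ⟨h1, h2, h3, fun u w huw => lit_holds_of_adj c s huw⟩, h4⟩

/-- A fitting set splits all edges of `cutPO H L`. It is thus a proper 2-colouring, which excludes
failure of the bipartiteness test, and relative to any colouring returned it comes from an
assignment. -/
theorem isSatisfiable_iff (hL : ∀ w, ¬ (Label.PO ∈ L w ∧ Label.PE ∈ L w)) :
    IsSatisfiable B S H L flag ↔ ∃ X, Fits H L X ∧ flag.AgreesOn X := by
  constructor
  · intro h
    obtain ⟨X, hX⟩ := Option.isSome_iff_exists.1 h
    exact ⟨X, fits_of_solveComponent hL hX⟩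
  · rintro ⟨X, hX, hflag⟩
    obtain ⟨h1, h2, h3, h4⟩ := (fits_iff hL).1 hX
    rw [IsSatisfiable, solveComponent]
    cases hc : B.run (cutPO H L) with
    | none =>
      classical
      refine absurd ⟨SimpleGraph.Coloring.mk (fun w => if w ∈ X then (0 : Fin 2) else 1) ?_⟩
        (B.complete _ hc)
      intro u w huw
      have := h4 u w huw
      by_cases hw : w ∈ X <;> simp_all
    | some c =>
      obtain ⟨s, rfl⟩ := exists_assignment c h4
      cases hs : S.solve (formula H L c flag) with
      | none => exact absurd ⟨s, formula_holds_iff.2 ⟨⟨h1, h2, h3⟩, hflag⟩⟩ (S.complete _ hs)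
      | some t => simp [hs]

end Fits

/-! ### The augmented component -/

section Augmented

variable {W : Type u} {H : SimpleGraph W} {L : W → Finset Label}

theorem augmented_inl_inl {u w : W} :
    (augmented H L).Adj (.inl u) (.inl w) ↔ H.Adj u w := by
  simp only [augmented, SimpleGraph.fromRel_adj, ne_eq, Sum.inl.injEq]
  exact ⟨fun h => h.2.elim id fun h => h.symm, fun h => ⟨h.ne, .inl h⟩⟩

theorem augmented_inl_inr {u : W} {k : {w : W // L w ≠ ∅}} {b : Bool} :
    (augmented H L).Adj (.inl u) (.inr (k, b)) ↔ b = false ∧ u = k := by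
  cases b <;> simp [augmented]

theorem augmented_inr_inl {u : W} {k : {w : W // L w ≠ ∅}} {b : Bool} :
    (augmented H L).Adj (.inr (k, b)) (.inl u) ↔ b = false ∧ u = k := by
  rw [SimpleGraph.adj_comm, augmented_inl_inr]

theorem augmented_inr_inr {k k' : {w : W // L w ≠ ∅}} {b b' : Bool} :
    (augmented H L).Adj (.inr (k, b)) (.inr (k', b')) ↔ k = k' ∧ b ≠ b' := by
  cases b <;> cases b' <;> simp [augmented, eq_comm]

theorem augmented_connected (hH : H.Connected) : (augmented H L).Connected := by
  obtain ⟨v⟩ := hH.nonempty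
  have h1 : ∀ w, (augmented H L).Reachable (.inl v) (.inl w) := by
    intro w
    rw [SimpleGraph.reachable_iff_reflTransGen]
    exact reflTransGen_map Sum.inl (fun x y h => augmented_inl_inl.2 h)
      ((connected_iff_reflTransGen.1 hH).2 v w)
  have h2 : ∀ k, (augmented H L).Reachable (.inl v) (.inr (k, false)) := fun k =>
    (h1 k.1).trans (SimpleGraph.Adj.reachable (augmented_inl_inr.2 ⟨rfl, rfl⟩))
  have key : ∀ x, (augmented H L).Reachable (.inl v) x := by
    rintro (w | ⟨k, _ | _⟩)
    · exact h1 w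
    · exact h2 k
    · exact (h2 k).trans (SimpleGraph.Adj.reachable (augmented_inr_inr.2 ⟨rfl, by simp⟩))
  exact { preconnected := fun a b => (key a).symm.trans (key b), nonempty := ⟨.inl v⟩ }

/-- Once `w` is removed, the path attached at `w` is cut off from everything else. -/
theorem eq_inr_of_reachAvoid {w : W} {k : {w : W // L w ≠ ∅}} (hk : k.1 = w) {b : Bool}
    {z : W ⊕ ({w : W // L w ≠ ∅} × Bool)}
    (h : ReachAvoid (augmented H L).Adj (.inl w) (.inr (k, b)) z) : ∃ b', z = .inr (k, b') := by
  induction h with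
  | refl => exact ⟨b, rfl⟩
  | @tail z z' _ hz ih =>
    obtain ⟨b', rfl⟩ := ih
    rcases z' with u | ⟨k', b''⟩
    · exact absurd (by rw [(augmented_inr_inl.1 hz.1).2, hk]) hz.2.2
    · exact ⟨b'', by rw [(augmented_inr_inr.1 hz.1).1]⟩

variable {M : Set (W ⊕ ({w : W // L w ≠ ∅} × Bool))}

/-- Since `H - w` is connected, all neighbours of `w` in `H` fall into one component. The only other
possible component is the path at `w`, where `v'(w)` is the sole neighbour. -/
theorem secure_augmented_inl (hH : IsBiconnected H) {w : W} :
    Secure (augmented H L) M (.inl w) ↔ (∀ u, H.Adj w u → .inl u ∈ M) ∨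
      ∃ k : {w : W // L w ≠ ∅}, k.1 = w ∧ .inr (k, false) ∈ M := by
  have hav : ∀ a b, a ≠ w → b ≠ w → ReachAvoid H.Adj w a b :=
    induce_compl_preconnected_iff.1 (hH.2.2 w).preconnected
  constructor
  · rintro ⟨x, hx, h⟩
    rcases x with u | ⟨k, b⟩
    · refine .inl fun u' hu' => h _ (augmented_inl_inl.2 hu') ?_
      refine (hav u u' (augmented_inl_inl.1 hx).ne' hu'.ne').map Sum.inl fun a b hab ha hb =>
        ⟨augmented_inl_inl.2 hab, ?_, ?_⟩
      · simpa using ha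
      · simpa using hb
    · obtain ⟨rfl, hk⟩ := augmented_inl_inr.1 hx
      exact .inr ⟨k, hk.symm, h _ hx (.refl _)⟩
  · rintro (h | ⟨k, rfl, hk⟩)
    · obtain ⟨u, hu⟩ : ∃ u, H.Adj w u := by
        obtain ⟨y, hy⟩ := (hH.2.2 w).nonempty
        rcases Relation.ReflTransGen.cases_head ((connected_iff_reflTransGen.1 hH.2.1).2 w y) with
          h | ⟨u, hu, -⟩
        · exact absurd h.symm hy
        · exact ⟨u, hu⟩
      refine ⟨.inl u, augmented_inl_inl.2 hu, fun x hx hux => ?_⟩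
      rcases x with u' | ⟨k, b⟩
      · exact h u' (augmented_inl_inl.1 hx)
      · obtain ⟨-, hk⟩ := augmented_inl_inr.1 hx
        obtain ⟨b', hb'⟩ := eq_inr_of_reachAvoid hk.symm (hux.symm fun _ _ h => h.symm)
        cases hb'
    · refine ⟨.inr (k, false), augmented_inl_inr.2 ⟨rfl, rfl⟩, fun x hx hux => ?_⟩
      obtain ⟨b, rfl⟩ := eq_inr_of_reachAvoid rfl hux
      obtain ⟨rfl, -⟩ := augmented_inl_inr.1 hx
      exact hk

/-- Without `v'(w)` the end `v''(w)` is isolated, so either of the two neighbours of `v'(w)`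
suffices alone. -/
theorem secure_augmented_false {k : {w : W // L w ≠ ∅}} (h : .inl k.1 ∈ M ∨ .inr (k, true) ∈ M) :
    Secure (augmented H L) M (.inr (k, false)) := by
  have hend : ∀ x, (augmented H L).Adj x (.inr (k, true)) → x = .inr (k, false) := by
    rintro (u | ⟨k', b⟩) hx
    · simp [augmented_inl_inr] at hx
    · obtain ⟨rfl, hb⟩ := augmented_inr_inr.1 hx
      simpa using hb
  rcases h with h | h
  · refine ⟨.inl k, augmented_inr_inl.2 ⟨rfl, rfl⟩, fun x hx hr => ?_⟩
    rcases x with u | ⟨k', b⟩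
    · rw [(augmented_inr_inl.1 hx).2]; exact h
    · obtain ⟨rfl, hb⟩ := augmented_inr_inr.1 hx
      obtain rfl : b = true := by simpa using hb.symm
      rcases Relation.ReflTransGen.cases_tail hr with e | ⟨z, -, hz⟩
      · cases e
      · exact absurd (hend z hz.1) hz.2.1
  · refine ⟨.inr (k, true), augmented_inr_inr.2 ⟨rfl, by simp⟩, fun x hx hr => ?_⟩
    rcases Relation.ReflTransGen.cases_head hr with e | ⟨z, hz, -⟩
    · exact e ▸ h
    · exact absurd (hend z hz.1.symm) hz.2.2

theorem secure_augmented_true {k : {w : W // L w ≠ ∅}} (h : .inr (k, false) ∈ M) :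
    Secure (augmented H L) M (.inr (k, true)) := by
  refine ⟨.inr (k, false), augmented_inr_inr.2 ⟨rfl, by simp⟩, fun x hx _ => ?_⟩
  rcases x with u | ⟨k', b⟩
  · simp [augmented_inr_inl] at hx
  · obtain ⟨rfl, hb⟩ := augmented_inr_inr.1 hx
    obtain rfl : b = false := by simpa using hb.symm
    exact h

/-- The attached path plays the part of a child subtree: selecting `v'(w)` secures `w` from below.
Independence then excludes `v''(w)`, so suitability permits this for an unselected `w` only under
PO. -/
theorem exists_isSuitable_iff (hH : IsBiconnected H) {flag : Flag W} :
    (∃ M, IsSuitable H L M ∧ flag.Agrees M) ↔ ∃ X, Fits H L X ∧ flag.AgreesOn X := by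
  have hagree : ∀ M : Set (W ⊕ ({w : W // L w ≠ ∅} × Bool)),
      flag.Agrees M ↔ flag.AgreesOn (Sum.inl ⁻¹' M) := by
    intro M
    cases flag <;> rfl
  simp only [IsSuitable, isRMIS_iff (augmented_connected hH.2.1), hagree]
  constructor
  · rintro ⟨M, ⟨⟨hi, hs⟩, h⟩, hflag⟩
    rw [isIndepSet_iff_forall] at hi
    refine ⟨_, ⟨fun w hw => ⟨(h ⟨w, hw⟩).1, (h ⟨w, hw⟩).2.1⟩,
      fun u w huw => hi _ _ (augmented_inl_inl.2 huw), fun w hw => ?_⟩, hflag⟩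
    rcases (secure_augmented_inl hH).1 (hs _ hw) with h' | ⟨k, rfl, hk⟩
    · exact .inr h'
    · exact .inl ((h k).2.2 hw hk (hi _ _ (augmented_inr_inr.2 ⟨rfl, by simp⟩) hk))
  · rintro ⟨X, ⟨h1, h2, h3⟩, hflag⟩
    -- On each path exactly one new vertex is chosen: `v'(w)` when `w` is unselected and carries PO,
    -- and `v''(w)` otherwise.
    let M : Set (W ⊕ ({w : W // L w ≠ ∅} × Bool)) := {x | match x with
      | .inl w => w ∈ X
      | .inr (k, false) => k.1 ∉ X ∧ Label.PO ∈ L k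
      | .inr (k, true) => k.1 ∈ X ∨ Label.PO ∉ L k}
    have e1 : ∀ w, .inl w ∈ M ↔ w ∈ X := fun _ => Iff.rfl
    have e2 : ∀ k : {w : W // L w ≠ ∅}, .inr (k, false) ∈ M ↔ k.1 ∉ X ∧ Label.PO ∈ L k := fun _ => Iff.rfl
    have e3 : ∀ k : {w : W // L w ≠ ∅}, .inr (k, true) ∈ M ↔ k.1 ∈ X ∨ Label.PO ∉ L k := fun _ => Iff.rfl
    refine ⟨M, ⟨⟨isIndepSet_iff_forall.2 ?_, ?_⟩, fun k => ⟨?_, ?_, ?_⟩⟩, hflag⟩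
    · rintro (u | ⟨k, b⟩) (w | ⟨k', b'⟩) hadj hx hy
      · exact h2 u w (augmented_inl_inl.1 hadj) hx hy
      · obtain ⟨rfl, rfl⟩ := augmented_inl_inr.1 hadj
        exact hy.1 hx
      · obtain ⟨rfl, rfl⟩ := augmented_inr_inl.1 hadj
        exact hx.1 hy
      · obtain ⟨rfl, hb⟩ := augmented_inr_inr.1 hadj
        cases b <;> cases b'
        · exact hb rfl
        · rw [e2] at hx
          rw [e3] at hy
          tauto
        · rw [e3] at hx
          rw [e2] at hy
          tauto
        · exact hb rfl
    · rintro (w | ⟨k, _ | _⟩) hx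
      · refine (secure_augmented_inl hH).2 ?_
        rcases h3 w hx with h | h
        · exact .inr ⟨⟨w, Finset.ne_empty_of_mem h⟩, rfl, hx, h⟩
        · exact .inl h
      · refine secure_augmented_false ?_
        rw [e2] at hx
        rw [e1, e3]
        tauto
      · refine secure_augmented_true ?_
        rw [e3] at hx
        rw [e2]
        tauto
    · exact (h1 k k.2).1
    · exact (h1 k k.2).2
    · exact fun _ h _ => h.2

end Augmented

/-! ### Correctness of the labeling rules -/

section Rules

open scoped Classical

variable {V : Type u} {G : SimpleGraph V} {R : Node G}

theorem secureIn_singleton {x : Node G} {M : Set V} {w : V} :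
    SecureIn {x} M w ↔ (∃ u, x.subgraph.Adj w u) ∧ ∀ u, x.subgraph.Adj w u → u ∈ M := by
  simp [SecureIn]

theorem indepIn_singleton {x : Node G} {M : Set V} :
    IndepIn {x} M ↔ ∀ a b, x.subgraph.Adj a b → a ∈ M → b ∉ M := by
  simp [IndepIn]

theorem Node.eq_of_vertex (hG : G.Connected) {x y : Node G} {v : V} (hx : x.vertex? = some v)
    (hy : y.vertex? = some v) : x = y := by
  cases x <;> cases y <;> simp only [Node.vertex?, Option.some.injEq, reduceCtorEq] at hx hy
  · subst hx; subst hy; rfl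
  · rename_i a ha p hp
    subst hx; subst hy
    exact absurd ha (hp.not_isArticulation hG)
  · rename_i p hp a ha
    subst hx; subst hy
    exact absurd ha (hp.not_isArticulation hG)
  · subst hx; subst hy; rfl

theorem ne_root_of_not_isBlock (hR : R.IsBlock) {x : Node G} (hx : ¬ x.IsBlock) : x ≠ R :=
  fun e => hx (e ▸ hR)

/-- A child of the block `x` at `v(x)` would be the same node as the parent of `x`, but the parent
is nearer to the root. -/
theorem attach?_child_ne (hG : G.Connected) (hT : (abcTree G).IsTree) {x c : Node G}
    (hx : x.IsBlock) (hc : c ∈ children R x) {v : V} (hv : attach? R x = some v) :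
    attach? R c ≠ some v := by
  intro hcv
  by_cases hxR : x = R
  · subst hxR
    rw [attach?_root hx] at hv
    cases hv
  obtain ⟨w, hw⟩ := Node.exists_vertex_of_not_isBlock (not_isBlock_of_mem_children hx hc)
  rw [attach?_of_vertex hw] at hcv
  obtain ⟨z, hz⟩ := exists_parent hT hxR
  rw [attach?_of_isBlock hT hx hz] at hv
  obtain rfl := Node.eq_of_vertex hG hv (hw.trans hcv)
  have h1 := hz.2
  have h2 := hc.2
  omega

theorem realizes_iff {x : Node G} {v : V} (hv : attach? R x = some v) {l : Label} {M : Set V} :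
    Realizes R x l M ↔ Good R x M ∧ (v ∈ M ↔ l = .PI) ∧
      (l = .PO → SecureIn (subtree R x) M v) := by
  simp [Realizes, hv]

/-- The label by which a node is excluded. -/
def excludingLabel (f : Node G → Finset Label) (c : Node G) : Label :=
  if Label.PO ∈ f c then Label.PO else Label.PE

theorem excludingLabel_ne {f : Node G → Finset Label} {c : Node G} :
    excludingLabel f c ≠ .PI := by
  unfold excludingLabel
  split_ifs <;> simp

theorem excludingLabel_mem {f : Node G → Finset Label} {c : Node G}
    (h : Label.PO ∈ f c ∨ Label.PE ∈ f c) : excludingLabel f c ∈ f c := by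
  unfold excludingLabel
  split_ifs with h'
  · exact h'
  · exact h.resolve_left h'

/-! ### Labels forced at a child by a good set -/

section Child

variable [Finite V] (hT : (abcTree G).IsTree) {x c : Node G} (hc : c ∈ children R x)
  {L : Finset Label} (hL : IsCorrect R c L) {M : Set V} (hM : Good R c M) {w : V}
  (hw : attach? R c = some w)

include hT hc hL

theorem IsCorrect.exists_realizes {l : Label} (hl : l ∈ L) : ∃ M, Realizes R c l M := by
  obtain ⟨h1, h2, h3⟩ := (isCorrect_iff hT (ne_root_of_mem_children hc)).1 hL
  cases l with
  | PI => exact h1.1 hl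
  | PO => exact h2.1 hl
  | PE => exact (h3.1 hl).2

theorem IsCorrect.not_both : ¬ (Label.PO ∈ L ∧ Label.PE ∈ L) := by
  obtain ⟨-, -, h3⟩ := (isCorrect_iff hT (ne_root_of_mem_children hc)).1 hL
  exact fun h => (h3.1 h.2).1 h.1

include hM hw

theorem IsCorrect.pi_mem (hwM : w ∈ M) : Label.PI ∈ L :=
  ((isCorrect_iff hT (ne_root_of_mem_children hc)).1 hL).1.2
    ⟨M, (realizes_iff hw).2 ⟨hM, by simpa using hwM, by simp⟩⟩

theorem IsCorrect.po_mem (hwM : w ∉ M) (hs : SecureIn (subtree R c) M w) : Label.PO ∈ L :=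
  ((isCorrect_iff hT (ne_root_of_mem_children hc)).1 hL).2.1.2
    ⟨M, (realizes_iff hw).2 ⟨hM, by simpa using hwM, fun _ => hs⟩⟩

theorem IsCorrect.po_or_pe_mem (hwM : w ∉ M) : Label.PO ∈ L ∨ Label.PE ∈ L := by
  by_cases hPO : Label.PO ∈ L
  · exact .inl hPO
  · exact .inr (((isCorrect_iff hT (ne_root_of_mem_children hc)).1 hL).2.2.2
      ⟨hPO, M, (realizes_iff hw).2 ⟨hM, by simpa using hwM, by simp⟩⟩)

end Child

/-- The common scheme for all rules: soundness by gluing, completeness by restriction, and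
exclusiveness of PO and PE. Completeness for PE is asked only when PO is absent. -/
theorem isCorrect_of [Finite V] (hT : (abcTree G).IsTree) {x : Node G} (hx : x ≠ R)
    {L : Finset Label} (h1 : ∀ l ∈ L, ∃ M, Realizes R x l M)
    (h2 : ∀ l M, Realizes R x l M → (l = .PE → Label.PO ∉ L) → l ∈ L)
    (h3 : Label.PE ∈ L → Label.PO ∉ L) : IsCorrect R x L := by
  refine (isCorrect_iff hT hx).2 ⟨⟨h1 _, ?_⟩, ⟨h1 _, ?_⟩, fun h => ⟨h3 h, h1 _ h⟩, ?_⟩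
  · rintro ⟨M, hM⟩
    exact h2 _ M hM (by simp)
  · rintro ⟨M, hM⟩
    exact h2 _ M hM (by simp)
  · rintro ⟨hn, M, hM⟩
    exact h2 _ M hM fun _ => hn

/-! Gluing realizations of labels at the children -/

section Glue

variable [Finite V] (hT : (abcTree G).IsTree) (hR : R.IsBlock) {x : Node G} {X : Set V}
  (hX : X ⊆ x.subgraph.verts) {lab : Node G → Label}
  (hXl : ∀ c ∈ children R x, ∀ v, attach? R c = some v → (v ∈ X ↔ lab c = .PI))

include hT hR hX hXl

/-- A realization depends only on the trace on `G[T_c]`, which gluing preserves. The last inclusion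
makes the result usable for gluing at the next level up. -/
theorem glue_realizes {m : Node G → Set V}
    (hm : ∀ c ∈ children R x, m c ⊆ (subtreeGraph R c).verts)
    (h : ∀ c ∈ children R x, Realizes R c (lab c) (m c)) :
    (∀ w ∈ x.subgraph.verts, w ∈ X ∪ ⋃ c : children R x, m c ↔ w ∈ X) ∧
    (∀ c ∈ children R x, Realizes R c (lab c) (X ∪ ⋃ c : children R x, m c)) ∧
    X ∪ ⋃ c : children R x, m c ⊆ (subtreeGraph R x).verts := by
  obtain ⟨h1, h2⟩ := glue_mem_iff hT hR hX hm fun c hc v hv =>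
    (((h c hc).2 v hv).1).trans (hXl c hc v hv).symm
  refine ⟨h1, fun c hc => (realizes_congr hT (ne_root_of_mem_children hc) (h2 c hc)).2 (h c hc),
    Set.union_subset (fun w hw => mem_verts_subtreeGraph_iff.2 (.inl (hX hw)))
      (Set.iUnion_subset fun c w hw =>
        mem_verts_subtreeGraph_iff.2 (.inr ⟨c.1, c.2, hm c.1 c.2 hw⟩))⟩

theorem exists_glue (h : ∀ c ∈ children R x, ∃ m, Realizes R c (lab c) m) :
    ∃ M, (∀ w ∈ x.subgraph.verts, w ∈ M ↔ w ∈ X) ∧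
      ∀ c ∈ children R x, Realizes R c (lab c) M := by
  choose! m hm using h
  obtain ⟨h1, h2, -⟩ := glue_realizes hT hR hX hXl
    -- Arbitrary realizations may contain vertices elsewhere in `G`, so they are cut down to their
    -- own subtrees first.
    (m := fun c => m c ∩ (subtreeGraph R c).verts) (fun c _ => Set.inter_subset_right)
    fun c hc => (realizes_congr hT (ne_root_of_mem_children hc) fun w hw => by simp [hw]).2
      (hm c hc)
  exact ⟨_, h1, h2⟩

end Glue

/-! Articulation points -/

section Art

variable {a : V} {ha : IsArticulation G a}

theorem attach?_child_art (hT : (abcTree G).IsTree) {c : Node G}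
    (hc : c ∈ children R (.art a ha)) : attach? R c = some a :=
  attach?_of_isBlock hT (isBlock_of_mem_children id hc) hc

variable [Finite V] (hT : (abcTree G).IsTree) (hR : R.IsBlock) {l : Label} {M : Set V}

include hT hR

/-- The node `a` has no edges of its own, so only a child block can secure it. -/
theorem realizes_art_iff : Realizes R (.art a ha) l M ↔
    (∀ c ∈ children R (.art a ha), Good R c M) ∧ (a ∈ M ↔ l = .PI) ∧
      (l = .PO → ∃ c ∈ children R (.art a ha), SecureIn (subtree R c) M a) := by
  have hno : ∀ u w, ¬ (Node.art a ha).subgraph.Adj u w := fun u w h => Node.IsBlock.of_adj h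
  have h1 : attach? R (.art a ha) = some a := rfl
  rw [realizes_iff h1, good_iff hT hR, secureIn_subtree_iff]
  simp only [indepIn_singleton, secureIn_singleton, hno, h1, false_imp_iff, implies_true,
    exists_false, false_and, false_or, true_and]
  refine and_congr_left fun _ => and_iff_left ?_
  rintro w hw - hne
  exact absurd (congrArg some (Eq.symm hw)) hne

/-- For PO some child carries PO, and `excludingLabel` prefers PO over PE, so that child secures
`a`; the other children only have to exclude it. -/
theorem realizes_art_of_children {f : Node G → Finset Label} {B : BipartiteTest.{u}}
    {S : TwoSatSolver.{u}} (hl : l ∈ labelNode B S R (.art a ha) f) (haM : a ∈ M ↔ l = .PI)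
    (h : ∀ c ∈ children R (.art a ha),
      Realizes R c (if l = .PI then .PI else excludingLabel f c) M) :
    Realizes R (.art a ha) l M := by
  refine (realizes_art_iff hT hR).2 ⟨fun c hc => (h c hc).1, haM, ?_⟩
  rintro rfl
  simp only [labelNode, Finset.mem_union] at hl
  have hex : ∃ c ∈ children R (.art a ha), Label.PO ∈ f c := by
    by_contra hn
    rw [if_neg hn] at hl
    rcases hl with hl | hl <;> split_ifs at hl <;> simp at hl
  obtain ⟨c, hc, hPO⟩ := hex
  refine ⟨c, hc, ((h c hc).2 a (attach?_child_art hT hc)).2 ?_⟩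
  simp [excludingLabel, hPO]

end Art

theorem mem_labelNode_art {B : BipartiteTest.{u}} {S : TwoSatSolver.{u}} [Finite V]
    {a : V} {ha : IsArticulation G a} {f : Node G → Finset Label} {l : Label} :
    l ∈ labelNode B S R (.art a ha) f ↔ match l with
      | .PI => ∀ c ∈ children R (.art a ha), Label.PI ∈ f c
      | .PO => (∀ c ∈ children R (.art a ha), Label.PO ∈ f c ∨ Label.PE ∈ f c) ∧
          ∃ c ∈ children R (.art a ha), Label.PO ∈ f c
      | .PE => (∀ c ∈ children R (.art a ha), Label.PO ∈ f c ∨ Label.PE ∈ f c) ∧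
          ¬ ∃ c ∈ children R (.art a ha), Label.PO ∈ f c := by
  simp only [labelNode]
  split_ifs with h1 h2 h3 h2 h3 <;> cases l <;> simp_all

theorem labelNode_art_child_mem [Finite V] {B : BipartiteTest.{u}} {S : TwoSatSolver.{u}}
    {a : V} {ha : IsArticulation G a} {f : Node G → Finset Label} {l : Label}
    (hl : l ∈ labelNode B S R (.art a ha) f) {c : Node G} (hc : c ∈ children R (.art a ha)) :
    (if l = .PI then .PI else excludingLabel f c) ∈ f c := by
  rw [mem_labelNode_art] at hl
  cases l with
  | PI => simpa using hl c hc
  | PO => simpa using excludingLabel_mem (hl.1 c hc)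
  | PE => simpa using excludingLabel_mem (hl.1 c hc)

theorem isCorrect_labelNode_art [Finite V] (hT : (abcTree G).IsTree) (hR : R.IsBlock)
    (B : BipartiteTest.{u}) (S : TwoSatSolver.{u}) {a : V} (ha : IsArticulation G a)
    {f : Node G → Finset Label} (hf : ∀ c ∈ children R (.art a ha), IsCorrect R c (f c)) :
    IsCorrect R (.art a ha) (labelNode B S R (.art a ha) f) := by
  refine isCorrect_of hT (ne_root_of_not_isBlock hR id) (fun l hl => ?_)
    (fun l M hM hPE => ?_) ?_
  · have hXl : ∀ c ∈ children R (.art a ha), ∀ v, attach? R c = some v →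
        (v ∈ {w | l = .PI ∧ a = w} ↔ (if l = .PI then .PI else excludingLabel f c) = .PI) := by
      intro c hc v hv
      rw [attach?_child_art hT hc] at hv
      obtain rfl := Option.some.inj hv
      by_cases hl' : l = .PI <;> simp [hl', excludingLabel_ne]
    obtain ⟨M, hM, hMc⟩ := exists_glue hT hR (x := .art a ha) (fun w hw => hw.2.symm) hXl
      fun c hc => (hf c hc).exists_realizes hT hc (labelNode_art_child_mem hl hc)
    refine ⟨M, realizes_art_of_children hT hR hl ((hM a rfl).trans ?_) hMc⟩
    simp
  · obtain ⟨hgood, haM, hs⟩ := (realizes_art_iff hT hR).1 hM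
    have hatt := fun c hc => attach?_child_art (R := R) (ha := ha) hT (c := c) hc
    rw [mem_labelNode_art] at hPE ⊢
    cases l with
    | PI => exact fun c hc => (hf c hc).pi_mem hT hc (hgood c hc) (hatt c hc) (haM.2 rfl)
    | PO =>
      have haM' : a ∉ M := fun h => by simpa using haM.1 h
      obtain ⟨c, hc, hcs⟩ := hs rfl
      exact ⟨fun c hc => (hf c hc).po_or_pe_mem hT hc (hgood c hc) (hatt c hc) haM',
        c, hc, (hf c hc).po_mem hT hc (hgood c hc) (hatt c hc) haM' hcs⟩
    | PE =>
      have haM' : a ∉ M := fun h => by simpa using haM.1 h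
      have hall := fun c hc => (hf c hc).po_or_pe_mem hT hc (hgood c hc) (hatt c hc) haM'
      exact ⟨hall, fun h => hPE rfl ⟨hall, h⟩⟩
  · rw [mem_labelNode_art, mem_labelNode_art]
    exact fun h h' => h.2 h'.2

/-! Pendant vertices -/

/-- The single edge at `p` lies in one block, and this block is already the parent. -/
theorem children_pend [Finite V] (hT : (abcTree G).IsTree) (hR : R.IsBlock) {p : V}
    {hp : IsPendant G p} : children R (.pend p hp) = ∅ := by
  rw [Set.eq_empty_iff_forall_notMem]
  intro c hc
  obtain ⟨z, hz⟩ := exists_parent hT (ne_root_of_not_isBlock hR (x := .pend p hp) id)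
  have h1 := (abcTree_adj_iff_of_not_isBlock id).1 hc.1
  have h2 := (abcTree_adj_iff_of_not_isBlock id).1 hz.1.symm
  obtain ⟨b, hb⟩ := h1.isBlock.exists_adj (h1.mem_verts rfl)
  obtain ⟨b', hb'⟩ := h2.isBlock.exists_adj (h2.mem_verts rfl)
  obtain rfl := hp.unique hb.adj_sub hb'.adj_sub
  obtain rfl := block_unique hb hb'
  have h3 := hc.2
  have h4 := hz.2
  omega

theorem realizes_pend_iff [Finite V] (hT : (abcTree G).IsTree) (hR : R.IsBlock) {p : V}
    {hp : IsPendant G p} {l : Label} {M : Set V} :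
    Realizes R (.pend p hp) l M ↔ (p ∈ M ↔ l = .PI) ∧ l ≠ .PO := by
  have hno : ∀ u w, ¬ (Node.pend p hp).subgraph.Adj u w := fun u w h => Node.IsBlock.of_adj h
  have h1 : attach? R (.pend p hp) = some p := rfl
  rw [realizes_iff h1, good_iff hT hR, secureIn_subtree_iff]
  simp only [indepIn_singleton, secureIn_singleton, hno, h1, children_pend hT hR, false_imp_iff,
    implies_true, exists_false, false_and, false_or, true_and, Set.mem_empty_iff_false]
  refine and_iff_right ?_
  rintro w hw - hne
  exact hne (congrArg some (Eq.symm hw))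

theorem mem_labelNode_pend [Finite V] {B : BipartiteTest.{u}} {S : TwoSatSolver.{u}} {p : V}
    {hp : IsPendant G p} {f : Node G → Finset Label} {l : Label} :
    l ∈ labelNode B S R (.pend p hp) f ↔ l ≠ .PO := by
  cases l <;> simp [labelNode]

theorem isCorrect_labelNode_pend [Finite V] (hT : (abcTree G).IsTree) (hR : R.IsBlock)
    (B : BipartiteTest.{u}) (S : TwoSatSolver.{u}) {p : V} (hp : IsPendant G p)
    (f : Node G → Finset Label) :
    IsCorrect R (.pend p hp) (labelNode B S R (.pend p hp) f) := by
  refine isCorrect_of hT (ne_root_of_not_isBlock hR id) (fun l hl => ?_)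
    (fun l M hM _ => ?_) (fun _ h => (mem_labelNode_pend.1 h) rfl)
  · exact ⟨{w | w = p ∧ l = .PI}, (realizes_pend_iff hT hR).2
      ⟨by simp, mem_labelNode_pend.1 hl⟩⟩
  · exact mem_labelNode_pend.2 ((realizes_pend_iff hT hR).1 hM).2

/-! Bridges -/

section Bridge

variable [Finite V] (hG : G.Connected) (hT : (abcTree G).IsTree) (hR : R.IsBlock)

/-- The far end `w` is pendant or has a further edge. That edge lies in another block, which makes
`w` an articulation point. The near end `v` belongs to the parent, leaving `w` as the only child. -/
theorem exists_bridge_child (hG : G.Connected) (hT : (abcTree G).IsTree) {e : Sym2 V}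
    {he : IsBridgeEdge G e} {v : V} (hx : Node.bridge e he ≠ R)
    (hv : attach? R (.bridge e he) = some v) : ∃ w y, e = s(v, w) ∧ v ≠ w ∧
      children R (.bridge e he) = {y} ∧ attach? R y = some w := by
  have hve : v ∈ e := attach?_mem hT hx hv
  obtain ⟨w, rfl⟩ : ∃ w, e = s(v, w) := hve
  have hadj : G.Adj v w := he.1
  have hxb : (Node.bridge s(v, w) he).IsBlock := trivial
  have key : ∃ y : Node G, y.vertex? = some w ∧ y.Incident (.bridge s(v, w) he) := by
    by_cases hp : IsPendant G w
    · exact ⟨.pend w hp, rfl, Sym2.mem_mk_right v w⟩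
    · obtain ⟨u, hu, huv⟩ : ∃ u, G.Adj w u ∧ u ≠ v := by
        by_contra! hn
        exact hp ⟨v, hadj.symm, hn⟩
      obtain ⟨B, hB, hBu⟩ := exists_block hu
      have ha : IsArticulation G w := by
        refine isArticulation_of_mem_blocks (B := .bridge s(v, w) he) trivial hB ?_
          (Sym2.mem_mk_right v w) hBu.fst_mem
        rintro rfl
        rcases Sym2.eq_iff.1 (Node.subgraph_bridge_adj.1 hBu) with ⟨h, -⟩ | ⟨h, -⟩
        · exact hadj.ne h
        · exact huv h.symm
      exact ⟨.art w ha, rfl, Sym2.mem_mk_right v w⟩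
  obtain ⟨y, hyw, hi⟩ := key
  have hy : y ∈ children R (.bridge s(v, w) he) := by
    rcases children_cases (R := R) hT (x := .bridge s(v, w) he) (y := y) (.inr hi) with h | h
    · exact h
    · rw [attach?_of_isBlock hT hxb h, hyw] at hv
      exact absurd (Option.some.inj hv).symm hadj.ne
  refine ⟨w, y, rfl, hadj.ne, Set.eq_singleton_iff_unique_mem.2 ⟨hy, fun c hc => ?_⟩,
    attach?_of_vertex hyw⟩
  have hic := (abcTree_adj_iff_of_isBlock (x := .bridge s(v, w) he) trivial).1 hc.1
  obtain ⟨u, hu, hue⟩ := hic.exists_vertex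
  rcases Sym2.mem_iff.1 (show u ∈ s(v, w) from hue) with rfl | rfl
  · exact absurd (attach?_of_vertex hu) (attach?_child_ne hG hT hxb hc hv)
  · exact Node.eq_of_vertex hG hu hyw

variable {v w : V} {he : IsBridgeEdge G s(v, w)} {y : Node G} {l : Label} {M : Set V}
  (hv : attach? R (.bridge s(v, w) he) = some v) (hvw : v ≠ w)
  (hy : children R (.bridge s(v, w) he) = {y}) (hw : attach? R y = some w)

include hT hR hv hvw hy hw

/-- No block below the bridge contains `v`, so inside the subtree `v` can be secured only by
selecting `w`. An unselected `w` is secured by `v` or from below. -/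
theorem realizes_bridge_iff : Realizes R (.bridge s(v, w) he) l M ↔
    ((v ∈ M → w ∉ M) ∧ Good R y M ∧ (w ∉ M → v ∈ M ∨ SecureIn (subtree R y) M w)) ∧
      (v ∈ M ↔ l = .PI) ∧ (l = .PO → w ∈ M) := by
  have hyc : y ∈ children R (.bridge s(v, w) he) := hy ▸ rfl
  have h1 : ¬ SecureIn (subtree R y) M v := fun h => by
    have := attach?_of_mem_verts hT hR hyc h.mem_verts (Sym2.mem_mk_left v w)
    rw [hw] at this
    exact hvw (Option.some.inj this).symm
  have hadjv : ∀ u, (Node.bridge s(v, w) he).subgraph.Adj v u ↔ u = w := fun u => by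
    rw [Node.subgraph_bridge_adj, Sym2.eq_iff]
    constructor
    · rintro (⟨-, h⟩ | ⟨-, h⟩)
      exacts [h.symm, absurd h.symm hvw]
    · rintro rfl
      exact .inl ⟨rfl, rfl⟩
  have hadjw : ∀ u, (Node.bridge s(v, w) he).subgraph.Adj w u ↔ u = v := fun u => by
    rw [Node.subgraph_bridge_adj, Sym2.eq_iff]
    constructor
    · rintro (⟨h, -⟩ | ⟨h, -⟩)
      exacts [absurd h hvw, h.symm]
    · rintro rfl
      exact .inr ⟨rfl, rfl⟩
  have h2 : SecureIn {Node.bridge s(v, w) he} M v ↔ w ∈ M := by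
    simp [secureIn_singleton, hadjv]
  have h3 : SecureIn {Node.bridge s(v, w) he} M w ↔ v ∈ M := by
    simp [secureIn_singleton, hadjw]
  have h4 : IndepIn {Node.bridge s(v, w) he} M ↔ (v ∈ M → w ∉ M) := by
    rw [indepIn_singleton]
    constructor
    · exact fun h => h v w ((hadjv w).2 rfl)
    · intro h a b hab ha hb
      rcases Sym2.eq_iff.1 (Node.subgraph_bridge_adj.1 hab) with ⟨rfl, rfl⟩ | ⟨rfl, rfl⟩
      exacts [h ha hb, h hb ha]
  have h5 : (∀ u ∈ (Node.bridge s(v, w) he).subgraph.verts, u ∉ M → some v ≠ some u →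
      SecureIn {Node.bridge s(v, w) he} M u ∨
        attach? R y = some u ∧ SecureIn (subtree R y) M u) ↔
      (w ∉ M → v ∈ M ∨ SecureIn (subtree R y) M w) := by
    constructor
    · intro h hwM
      have := h w (Sym2.mem_mk_right v w) hwM (fun e => hvw (Option.some.inj e))
      rw [h3] at this
      exact this.imp_right And.right
    · intro h u hu huM hne
      rcases Sym2.mem_iff.1 (show u ∈ s(v, w) from hu) with rfl | rfl
      · exact absurd rfl hne
      · exact (h huM).imp h3.2 fun h => ⟨hw, h⟩
  rw [realizes_iff hv, good_iff hT hR, secureIn_subtree_iff, h2, h4, hy, hv]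
  simp only [Set.mem_singleton_iff, exists_eq_left, forall_eq, h1, or_false, h5]

/-- Under PI the selected `v` secures the far end, so PE suffices at the child. Under PE neither end
is selected, and the far end has to be secured from below, which is PO at the child. -/
theorem realizes_bridge_of_child {f : Node G → Finset Label}
    (hvM : v ∈ M ↔ l = .PI) (h : Realizes R y (if l = .PO then .PI
      else if l = .PI then excludingLabel f y else .PO) M) :
    Realizes R (.bridge s(v, w) he) l M := by
  rw [realizes_bridge_iff hT hR hv hvw hy hw]
  obtain ⟨h1, h2, h3⟩ := (realizes_iff hw).1 h
  cases l <;> simp [excludingLabel_ne] at hvM h2 h3 <;> simp [hvM, h1, h2, h3]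

end Bridge

theorem mem_labelNode_bridge [Finite V] {B : BipartiteTest.{u}} {S : TwoSatSolver.{u}}
    {e : Sym2 V} {he : IsBridgeEdge G e} {y : Node G} (hy : children R (.bridge e he) = {y})
    {f : Node G → Finset Label} {l : Label} :
    l ∈ labelNode B S R (.bridge e he) f ↔ match l with
      | .PI => Label.PO ∈ f y ∨ Label.PE ∈ f y
      | .PO => Label.PI ∈ f y
      | .PE => Label.PO ∈ f y ∧ Label.PI ∉ f y := by
  simp only [labelNode, hy, Set.mem_singleton_iff, exists_eq_left]
  by_cases h1 : Label.PI ∈ f y <;> by_cases h2 : Label.PO ∈ f y <;>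
    by_cases h3 : Label.PE ∈ f y <;> cases l <;> simp [h1, h2, h3]

theorem labelNode_bridge_child_mem [Finite V] {B : BipartiteTest.{u}} {S : TwoSatSolver.{u}}
    {e : Sym2 V} {he : IsBridgeEdge G e} {y : Node G} (hy : children R (.bridge e he) = {y})
    {f : Node G → Finset Label} {l : Label} (hl : l ∈ labelNode B S R (.bridge e he) f) :
    (if l = .PO then .PI else if l = .PI then excludingLabel f y else .PO) ∈ f y := by
  rw [mem_labelNode_bridge hy] at hl
  cases l with
  | PI => simpa using excludingLabel_mem hl
  | PO => simpa using hl
  | PE => simpa using hl.1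

theorem isCorrect_labelNode_bridge [Finite V] (hG : G.Connected) (hT : (abcTree G).IsTree)
    (hR : R.IsBlock) (B : BipartiteTest.{u}) (S : TwoSatSolver.{u}) {e : Sym2 V}
    (he : IsBridgeEdge G e) (hx : Node.bridge e he ≠ R) {f : Node G → Finset Label}
    (hf : ∀ c ∈ children R (.bridge e he), IsCorrect R c (f c)) :
    IsCorrect R (.bridge e he) (labelNode B S R (.bridge e he) f) := by
  obtain ⟨v, hv, -⟩ := exists_attach? hT hx
  obtain ⟨w, y, rfl, hvw, hy, hw⟩ := exists_bridge_child hG hT hx hv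
  have hyc : y ∈ children R (.bridge s(v, w) he) := hy ▸ rfl
  refine isCorrect_of hT hx (fun l hl => ?_) (fun l M hM hPE => ?_) ?_
  · have hX : {u | (l = .PI ∧ u = v) ∨ (l = .PO ∧ u = w)} ⊆
        (Node.bridge s(v, w) he).subgraph.verts := by
      rintro u (⟨-, rfl⟩ | ⟨-, rfl⟩)
      exacts [Sym2.mem_mk_left _ _, Sym2.mem_mk_right _ _]
    have hXl : ∀ c ∈ children R (.bridge s(v, w) he), ∀ u, attach? R c = some u →
        (u ∈ {u | (l = .PI ∧ u = v) ∨ (l = .PO ∧ u = w)} ↔ (if l = .PO then .PI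
          else if l = .PI then excludingLabel f c else .PO) = .PI) := by
      intro c hc u hu
      obtain rfl : c = y := by simpa [hy] using hc
      obtain rfl := Option.some.inj (hw.symm.trans hu)
      cases l <;> simp [excludingLabel_ne, hvw.symm]
    obtain ⟨M, hM, hMc⟩ := exists_glue hT hR hX hXl fun c hc => by
      obtain rfl : c = y := by simpa [hy] using hc
      exact (hf c hc).exists_realizes hT hc (labelNode_bridge_child_mem hy hl)
    refine ⟨M, realizes_bridge_of_child hT hR hv hvw hy hw (f := f)
      ((hM v (Sym2.mem_mk_left v w)).trans ?_) (hMc y hyc)⟩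
    simp [hvw]
  · obtain ⟨⟨h1, h2, h3⟩, h4, h5⟩ := (realizes_bridge_iff hT hR hv hvw hy hw).1 hM
    rw [mem_labelNode_bridge hy] at hPE ⊢
    cases l with
    | PI => exact (hf y hyc).po_or_pe_mem hT hyc h2 hw (h1 (h4.2 rfl))
    | PO => exact (hf y hyc).pi_mem hT hyc h2 hw (h5 rfl)
    | PE =>
      have hn := hPE rfl
      have hwM : w ∉ M := fun h => hn ((hf y hyc).pi_mem hT hyc h2 hw h)
      refine ⟨(hf y hyc).po_mem hT hyc h2 hw hwM ((h3 hwM).resolve_left ?_), hn⟩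
      simpa using h4
  · rw [mem_labelNode_bridge hy, mem_labelNode_bridge hy]
    exact fun h h' => h.2 h'

end Rules

/-! ### The labeling rule for biconnected components -/

section CompRule

open scoped Classical

variable {V : Type u} {G : SimpleGraph V} {R : Node G} {C : G.Subgraph} {hC : IsBiconnComp G C}
  {f : Node G → Finset Label}

/-- The labels that the vertices of a component have in the formula for the label `l`. -/
def labelsFor {W : Type u} [DecidableEq W] (L : W → Finset Label) (v : W) : Label → W → Finset Label
  | .PE => Function.update L v {Label.PO}
  | _ => L

/-- The flag in the formula for the label `l`. -/
def flagFor {W : Type u} (v : W) : Label → Flag W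
  | .PI => .isIn v
  | _ => .isOut v

theorem flagFor_agreesOn {W : Type u} {v : W} {l : Label} {X : Set W} :
    (flagFor v l).AgreesOn X ↔ (v ∈ X ↔ l = .PI) := by
  cases l <;> simp [flagFor, Flag.AgreesOn]

theorem labelsFor_of_ne {W : Type u} [DecidableEq W] {L : W → Finset Label} {v w : W} {l : Label} (h : w ≠ v) :
    labelsFor L v l w = L w := by
  cases l <;> simp [labelsFor, h]

theorem labelsFor_not_both {W : Type u} [DecidableEq W] {L : W → Finset Label} {v : W} {l : Label}
    (hL : ∀ w, ¬ (Label.PO ∈ L w ∧ Label.PE ∈ L w)) (w : W) :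
    ¬ (Label.PO ∈ labelsFor L v l w ∧ Label.PE ∈ labelsFor L v l w) := by
  by_cases h : w = v
  · subst h
    cases l with
    | PE => simp [labelsFor]
    | _ => exact hL w
  · rw [labelsFor_of_ne h]
    exact hL w

theorem exists_art_of_mem_children_comp {c : Node G} (hc : c ∈ children R (.comp C hC)) :
    ∃ a ha, c = .art a ha ∧ a ∈ C.verts := by
  have h := (abcTree_adj_iff_of_isBlock (x := .comp C hC) trivial).1 hc.1
  cases c with
  | art a ha => exact ⟨a, ha, rfl, h⟩
  | _ => exact h.elim

theorem vertexLabels_of_child {c : Node G} (hc : c ∈ children R (.comp C hC)) {w : C.verts}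
    (hw : attach? R c = some w.1) : vertexLabels R (.comp C hC) f C w = f c := by
  obtain ⟨a, ha, rfl, -⟩ := exists_art_of_mem_children_comp hc
  obtain ⟨w, hwC⟩ := w
  obtain rfl : a = w := Option.some.inj hw
  rw [vertexLabels, dif_pos ha, if_pos hc]

theorem exists_child_of_vertexLabels_ne {w : C.verts}
    (h : vertexLabels R (.comp C hC) f C w ≠ ∅) : ∃ c ∈ children R (.comp C hC),
      attach? R c = some w.1 ∧ vertexLabels R (.comp C hC) f C w = f c := by
  rw [vertexLabels] at h ⊢
  split_ifs at h ⊢ with h1 h2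
  · exact ⟨_, h2, rfl, rfl⟩
  · exact absurd rfl h
  · exact absurd rfl h

theorem vertexLabels_congr {g : Node G → Finset Label} {x : Node G}
    (h : ∀ c ∈ children R x, f c = g c) : vertexLabels R x f C = vertexLabels R x g C := by
  funext w
  unfold vertexLabels
  split_ifs with h1 h2
  · exact h _ h2
  · rfl
  · rfl

section Correct

variable [Finite V] (hG : G.Connected) (hT : (abcTree G).IsTree) (hR : R.IsBlock) {M : Set V}

theorem vertexLabels_not_both (hT : (abcTree G).IsTree)
    (hf : ∀ c ∈ children R (.comp C hC), IsCorrect R c (f c)) (w : C.verts) :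
    ¬ (Label.PO ∈ vertexLabels R (.comp C hC) f C w ∧
      Label.PE ∈ vertexLabels R (.comp C hC) f C w) := by
  intro h
  obtain ⟨c, hc, -, e⟩ := exists_child_of_vertexLabels_ne (Finset.ne_empty_of_mem h.1)
  rw [e] at h
  exact (hf c hc).not_both hT hc h

include hT hR

theorem good_comp_iff : Good R (.comp C hC) M ↔ (∀ a b, C.Adj a b → a ∈ M → b ∉ M) ∧
    (∀ c ∈ children R (.comp C hC), Good R c M) ∧
    ∀ w ∈ C.verts, w ∉ M → attach? R (.comp C hC) ≠ some w → (∀ u, C.Adj w u → u ∈ M) ∨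
      ∃ c ∈ children R (.comp C hC), attach? R c = some w ∧ SecureIn (subtree R c) M w := by
  rw [good_iff hT hR, indepIn_singleton]
  refine and_congr_right fun _ => and_congr_right fun _ => forall₂_congr fun w hw => ?_
  have h1 : SecureIn {Node.comp C hC} M w ↔ ∀ u, C.Adj w u → u ∈ M := by
    rw [secureIn_singleton]
    exact and_iff_right (Node.IsBlock.exists_adj (B := .comp C hC) trivial hw)
  rw [h1]

include hG

/-- No child is attached at `v(x)`, so only the component itself can secure it. -/
theorem secureIn_comp_iff {v : V} (hx : Node.comp C hC ≠ R)
    (hv : attach? R (.comp C hC) = some v) :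
    SecureIn (subtree R (.comp C hC)) M v ↔ ∀ u, C.Adj v u → u ∈ M := by
  have hxb : (Node.comp C hC).IsBlock := trivial
  have hvC := attach?_mem hT hx hv
  rw [secureIn_subtree_iff, secureIn_singleton, or_iff_left,
    and_iff_right (hxb.exists_adj hvC)]
  · rfl
  · rintro ⟨c, hc, h⟩
    exact attach?_child_ne hG hT hxb hc hv (attach?_of_mem_verts hT hR hc h.mem_verts hvC)

omit hG in
-- Correct labels of the children record what `M` does on their subtrees. The labels are left open
-- at `v(x)`, because the formula for PE puts an artificial label there; `hv` collects what is
-- needed at that vertex.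
theorem fits_of_good (hf : ∀ c ∈ children R (.comp C hC), IsCorrect R c (f c))
    (hM : Good R (.comp C hC) M) {L : C.verts → Finset Label}
    (hL : ∀ w : C.verts, attach? R (.comp C hC) ≠ some w.1 →
      L w = vertexLabels R (.comp C hC) f C w)
    (hv : ∀ w : C.verts, attach? R (.comp C hC) = some w.1 →
      (L w ≠ ∅ → (w.1 ∈ M → Label.PI ∈ L w) ∧ (w.1 ∉ M → Label.PO ∈ L w ∨ Label.PE ∈ L w)) ∧
      (w.1 ∉ M → Label.PO ∈ L w ∨ ∀ u, C.Adj w.1 u → u ∈ M)) :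
    Fits C.coe L (Subtype.val ⁻¹' M) := by
  obtain ⟨h1, h2, h3⟩ := (good_comp_iff hT hR).1 hM
  refine ⟨fun w hw => ?_, fun u w huw => h1 u w huw, fun w hw => ?_⟩
  · by_cases hwv : attach? R (.comp C hC) = some w.1
    · exact (hv w hwv).1 hw
    · rw [hL w hwv] at hw ⊢
      obtain ⟨c, hc, hcw, e⟩ := exists_child_of_vertexLabels_ne hw
      rw [e]
      exact ⟨(hf c hc).pi_mem hT hc (h2 c hc) hcw, (hf c hc).po_or_pe_mem hT hc (h2 c hc) hcw⟩
  · by_cases hwv : attach? R (.comp C hC) = some w.1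
    · exact ((hv w hwv).2 hw).imp_right fun h u hu => h u hu
    · rcases h3 w w.2 hw hwv with h | ⟨c, hc, hcw, hs⟩
      · exact .inr fun u hu => h u hu
      · left
        rw [hL w hwv, vertexLabels_of_child hc hcw]
        exact (hf c hc).po_mem hT hc (h2 c hc) hcw hw hs

variable {L : C.verts → Finset Label} {X : Set C.verts}
  (hL : ∀ w : C.verts, attach? R (.comp C hC) ≠ some w.1 →
    L w = vertexLabels R (.comp C hC) f C w) (hX : Fits C.coe L X)

include hL hX

omit [Finite V] hR in
-- Non-emptiness of the label sets matters: an empty set would be read as an unconstrained vertex,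
-- and no label of the child would match the choice made there.
theorem child_label_mem_of_fits (hne : ∀ c ∈ children R (.comp C hC), f c ≠ ∅) {c : Node G}
    (hc : c ∈ children R (.comp C hC)) :
    (if ∃ w ∈ Subtype.val '' X, c.vertex? = some w then .PI else excludingLabel f c) ∈ f c := by
  obtain ⟨a, ha, rfl, haC⟩ := exists_art_of_mem_children_comp hc
  have hL' : L ⟨a, haC⟩ = f (.art a ha) := by
    rw [hL ⟨a, haC⟩ fun h => attach?_child_ne hG hT (x := .comp C hC) trivial hc h rfl,
      vertexLabels_of_child hc rfl]
  obtain ⟨h1, h2⟩ := hX.1 ⟨a, haC⟩ (hL' ▸ hne _ hc)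
  rw [hL'] at h1 h2
  split_ifs with h
  · obtain ⟨_, ⟨w, hw, rfl⟩, e⟩ := h
    obtain rfl : a = w.1 := Option.some.inj e
    exact h1 hw
  · exact excludingLabel_mem (h2 fun hw => h ⟨a, ⟨_, hw, rfl⟩, rfl⟩)

omit hG in
-- Where `Fits` lets a vertex stay out because of PO, the child attached there realizes PO rather
-- than PE and secures the vertex from below.
theorem good_of_fits (hM : ∀ w ∈ C.verts, w ∈ M ↔ w ∈ Subtype.val '' X)
    (h : ∀ c ∈ children R (.comp C hC), Realizes R c
      (if ∃ w ∈ Subtype.val '' X, c.vertex? = some w then .PI else excludingLabel f c) M) :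
    Good R (.comp C hC) M := by
  have hM' : ∀ w : C.verts, w.1 ∈ M ↔ w ∈ X := fun w =>
    (hM w w.2).trans (Subtype.val_injective.mem_set_image)
  refine (good_comp_iff hT hR).2 ⟨fun a b hab ha hb => ?_, fun c hc => (h c hc).1,
    fun w hwC hwM hne => ?_⟩
  · exact hX.2.1 ⟨a, hab.fst_mem⟩ ⟨b, hab.snd_mem⟩ hab ((hM' _).1 ha) ((hM' _).1 hb)
  · rcases hX.2.2 ⟨w, hwC⟩ (fun h => hwM ((hM' ⟨w, hwC⟩).2 h)) with hPO | hall
    · right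
      rw [hL ⟨w, hwC⟩ hne] at hPO
      obtain ⟨c, hc, hcw, e⟩ := exists_child_of_vertexLabels_ne (Finset.ne_empty_of_mem hPO)
      rw [e] at hPO
      refine ⟨c, hc, hcw, ((h c hc).2 w hcw).2 ?_⟩
      rw [if_neg, excludingLabel, if_pos hPO]
      rintro ⟨u, hu, hcu⟩
      rw [attach?_of_vertex hcu] at hcw
      obtain rfl := Option.some.inj hcw
      exact hwM ((hM u hwC).2 hu)
    · exact .inl fun u hu => (hM' ⟨u, hu.snd_mem⟩).2 (hall ⟨u, hu.snd_mem⟩ hu)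

end Correct

theorem mem_image_iff_child_label {X : Set C.verts} {c : Node G} (hc : c ∈ children R (.comp C hC))
    {v : V} (hv : attach? R c = some v) : v ∈ Subtype.val '' X ↔
      (if ∃ w ∈ Subtype.val '' X, c.vertex? = some w then .PI else excludingLabel f c) = .PI := by
  obtain ⟨a, ha, rfl, haC⟩ := exists_art_of_mem_children_comp hc
  obtain rfl : a = v := Option.some.inj hv
  constructor
  · exact fun h => if_pos ⟨a, h, rfl⟩
  · intro h
    split_ifs at h with h'
    · obtain ⟨w, hw, e⟩ := h'
      obtain rfl : a = w := Option.some.inj e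
      exact hw
    · exact absurd h excludingLabel_ne

variable [Finite V] {B : BipartiteTest.{u}} {S : TwoSatSolver.{u}}

theorem mem_labelNode_comp {v : V} (hv : attach? R (.comp C hC) = some v) (hvC : v ∈ C.verts)
    {l : Label} :
    l ∈ labelNode B S R (.comp C hC) f ↔
      IsSatisfiable B S C.coe (labelsFor (vertexLabels R (.comp C hC) f C) ⟨v, hvC⟩ l)
        (flagFor ⟨v, hvC⟩ l) ∧
      (l = .PE → Label.PO ∉ labelNode B S R (.comp C hC) f) := by
  simp only [labelNode, hv, dif_pos hvC]
  cases l <;> simp only [labelsFor, flagFor] <;> split_ifs <;> simp_all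

variable (hG : G.Connected) (hT : (abcTree G).IsTree) (hR : R.IsBlock) (hx : Node.comp C hC ≠ R)

include hG hT hR hx

theorem realizes_comp_of_fits {M : Set V} {v : V} (hv : attach? R (.comp C hC) = some v)
    (hvC : v ∈ C.verts) {l : Label} {X : Set C.verts}
    (hX : Fits C.coe (labelsFor (vertexLabels R (.comp C hC) f C) ⟨v, hvC⟩ l) X)
    (hXl : (flagFor ⟨v, hvC⟩ l).AgreesOn X) (hM : ∀ w ∈ C.verts, w ∈ M ↔ w ∈ Subtype.val '' X)
    (h : ∀ c ∈ children R (.comp C hC), Realizes R c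
      (if ∃ w ∈ Subtype.val '' X, c.vertex? = some w then .PI else excludingLabel f c) M) :
    Realizes R (.comp C hC) l M := by
  have hvM : v ∈ M ↔ (⟨v, hvC⟩ : C.verts) ∈ X :=
    (hM v hvC).trans (Subtype.val_injective.mem_set_image (a := (⟨v, hvC⟩ : C.verts)))
  refine (realizes_iff hv).2 ⟨good_of_fits hT hR (fun w hw => labelsFor_of_ne ?_) hX hM h,
    hvM.trans (flagFor_agreesOn.1 hXl), ?_⟩
  · rintro rfl
    exact hw hv
  · rintro rfl
    rw [secureIn_comp_iff hG hT hR hx hv]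
    have hvX : (⟨v, hvC⟩ : C.verts) ∉ X := fun h => by simpa using (flagFor_agreesOn.1 hXl).1 h
    -- In the formula for PO the vertex `v(x)` is unlabelled, so it is secured by its neighbours in
    -- the component. The artificial label for PE removes precisely this demand.
    rcases hX.2.2 _ hvX with hPO | hall
    · obtain ⟨c, hc, hcv, -⟩ := exists_child_of_vertexLabels_ne (Finset.ne_empty_of_mem hPO)
      exact absurd hcv (attach?_child_ne hG hT (x := .comp C hC) trivial hc hv)
    · exact fun u hu => (hM u hu.snd_mem).2 ⟨_, hall ⟨u, hu.snd_mem⟩ hu, rfl⟩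

theorem isCorrect_labelNode_comp (B : BipartiteTest.{u}) (S : TwoSatSolver.{u})
    (hf : ∀ c ∈ children R (.comp C hC), IsCorrect R c (f c))
    (hne : ∀ c ∈ children R (.comp C hC), f c ≠ ∅) :
    IsCorrect R (.comp C hC) (labelNode B S R (.comp C hC) f) := by
  obtain ⟨v, hv, hvC⟩ := exists_attach? hT hx
  have hboth := fun l => labelsFor_not_both (v := ⟨v, hvC⟩) (l := l)
    (vertexLabels_not_both hT hf)
  have hLv : ∀ l, ∀ w : C.verts, attach? R (.comp C hC) ≠ some w.1 →
      labelsFor (vertexLabels R (.comp C hC) f C) ⟨v, hvC⟩ l w =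
        vertexLabels R (.comp C hC) f C w := by
    intro l w hw
    refine labelsFor_of_ne ?_
    rintro rfl
    exact hw hv
  refine isCorrect_of hT hx (fun l hl => ?_) (fun l M hM hPE => ?_) fun h =>
    ((mem_labelNode_comp hv hvC).1 h).2 rfl
  · obtain ⟨X, hX, hXl⟩ := (isSatisfiable_iff (hboth l)).1 ((mem_labelNode_comp hv hvC).1 hl).1
    obtain ⟨M, hM, hMc⟩ := exists_glue hT hR (x := .comp C hC) (X := Subtype.val '' X)
      (lab := fun c => if ∃ w ∈ Subtype.val '' X, c.vertex? = some w then .PI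
        else excludingLabel f c)
      (by rintro _ ⟨w, -, rfl⟩; exact w.2)
      (fun c hc v hv => mem_image_iff_child_label hc hv)
      fun c hc => (hf c hc).exists_realizes hT hc
        (child_label_mem_of_fits hG hT (hLv l) hX hne hc)
    exact ⟨M, realizes_comp_of_fits hG hT hR hx hv hvC hX hXl hM hMc⟩
  · rw [mem_labelNode_comp hv hvC]
    refine ⟨(isSatisfiable_iff (hboth l)).2 ⟨Subtype.val ⁻¹' M, ?_, ?_⟩, hPE⟩
    · refine fits_of_good hT hR hf hM.1 (hLv l) fun w hw => ?_
      rw [hv] at hw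
      obtain ⟨w, hwC⟩ := w
      obtain rfl : v = w := Option.some.inj hw
      obtain ⟨-, h1, h2⟩ := (realizes_iff hv).1 hM
      have hempty : vertexLabels R (.comp C hC) f C ⟨v, hwC⟩ = ∅ := by
        by_contra hn
        obtain ⟨c, hc, hcv, -⟩ := exists_child_of_vertexLabels_ne hn
        exact attach?_child_ne hG hT (x := .comp C hC) trivial hc hv hcv
      cases l with
      | PI => simp [labelsFor, hempty, h1]
      | PO =>
        simp only [labelsFor, hempty]
        exact ⟨fun h => absurd rfl h, fun _ =>
          .inr ((secureIn_comp_iff hG hT hR hx hv).1 (h2 rfl))⟩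
      | PE => simp [labelsFor, h1]
    · exact flagFor_agreesOn.2 ((realizes_iff hv).1 hM).2.1

end CompRule

/-! ### Correctness of the algorithm -/

section Algorithm

open scoped Classical

variable {V : Type u} [Finite V] {G : SimpleGraph V} {R : Node G} {B : BipartiteTest.{u}}
  {S : TwoSatSolver.{u}}

theorem isCorrect_labelNode (hG : G.Connected) (hT : (abcTree G).IsTree) (hR : R.IsBlock)
    {x : Node G} (hx : x ≠ R) {f : Node G → Finset Label}
    (hf : ∀ c ∈ children R x, IsCorrect R c (f c))
    (hne : (∃ D hD, x = .comp D hD) → ∀ c ∈ children R x, f c ≠ ∅) :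
    IsCorrect R x (labelNode B S R x f) := by
  cases x with
  | art a ha => exact isCorrect_labelNode_art hT hR B S ha hf
  | bridge e he => exact isCorrect_labelNode_bridge hG hT hR B S he hx hf
  | pend p hp => exact isCorrect_labelNode_pend hT hR B S hp f
  | comp C hC => exact isCorrect_labelNode_comp hG hT hR hx B S hf (hne ⟨C, hC, rfl⟩)

theorem labelNode_congr {x : Node G} {f g : Node G → Finset Label}
    (h : ∀ c ∈ children R x, f c = g c) : labelNode B S R x f = labelNode B S R x g := by
  have hex : ∀ P : Finset Label → Prop,
      (∃ c ∈ children R x, P (f c)) = ∃ c ∈ children R x, P (g c) := fun P =>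
    propext (exists_congr fun c => and_congr_right fun hc => by rw [h c hc])
  have hall : ∀ P : Finset Label → Prop,
      (∀ c ∈ children R x, P (f c)) = ∀ c ∈ children R x, P (g c) := fun P =>
    propext (forall₂_congr fun c hc => by rw [h c hc])
  cases x with
  | art a ha =>
    simp only [labelNode, hex (Label.PO ∈ ·), hall (Label.PI ∈ ·),
      hall fun s => Label.PO ∈ s ∨ Label.PE ∈ s]
  | bridge e he =>
    simp only [labelNode, hex (Label.PO ∈ ·), hex (Label.PI ∈ ·), hex (Label.PE ∈ ·)]
  | pend p hp => rfl
  | comp C hC => simp only [labelNode, vertexLabels_congr h]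

theorem labelSubTree_eq (x : Node G) : labelSubTree B S R x =
    if ∀ c ∈ children R x, labelSubTree B S R c ≠ none then
      if labelNode B S R x (finalLabel B S R) = ∅ then none
      else some (labelNode B S R x (finalLabel B S R))
    else none := by
  have e : (labelNode B S R x fun y =>
      if _hy : y ∈ children R x then (labelSubTree B S R y).getD ∅ else ∅) =
        labelNode B S R x (finalLabel B S R) :=
    labelNode_congr fun c hc => by simp only [hc, dif_pos]; rfl
  rw [labelSubTree]
  simp only [Subtype.forall, e]

theorem labelSubTree_eq_some_iff {x : Node G} {L : Finset Label} :
    labelSubTree B S R x = some L ↔ (∀ c ∈ children R x, labelSubTree B S R c ≠ none) ∧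
      L = labelNode B S R x (finalLabel B S R) ∧ L ≠ ∅ := by
  rw [labelSubTree_eq]
  split_ifs with h1 h2
  · simp only [false_iff]
    rintro ⟨-, rfl, h⟩
    exact h h2
  · rw [Option.some.injEq]
    exact ⟨fun h => ⟨h1, h.symm, h ▸ h2⟩, fun h => h.2.1.symm⟩
  · simp [h1]

theorem labelSubTree_finalLabel {x : Node G} (h : labelSubTree B S R x ≠ none) :
    labelSubTree B S R x = some (finalLabel B S R x) := by
  obtain ⟨L, hL⟩ := Option.ne_none_iff_exists'.1 h
  rw [finalLabel, hL, Option.getD_some]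

theorem finalLabel_ne_empty {x : Node G} (h : labelSubTree B S R x ≠ none) :
    finalLabel B S R x ≠ ∅ :=
  (labelSubTree_eq_some_iff.1 (labelSubTree_finalLabel h)).2.2

/-- Children are farther from the root, and distances are bounded by the number of nodes. -/
theorem children_induction {P : Node G → Prop} (h : ∀ x, (∀ c ∈ children R x, P c) → P x)
    (x : Node G) : P x := by
  induction hn : Nat.card (Node G) - (abcTree G).dist R x using Nat.strong_induction_on
    generalizing x with
  | _ n ih => exact h x fun c hc => ih _ (hn ▸ children_measure hc) c rfl

variable (hG : G.Connected) (hT : (abcTree G).IsTree) (hR : R.IsBlock)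

include hG hT hR

theorem labelSubTree_correct (x : Node G) (hx : x ≠ R) :
    (∀ L, labelSubTree B S R x = some L → IsCorrect R x L) ∧
    (labelSubTree B S R x = none → ¬ ∃ M, IsRMIS G M) := by
  induction x using children_induction (R := R) with
  | h x ih =>
    have hchild := fun c hc => ih c hc (ne_root_of_mem_children hc)
    by_cases hall : ∀ c ∈ children R x, labelSubTree B S R c ≠ none
    · have hcorr : IsCorrect R x (labelNode B S R x (finalLabel B S R)) :=
        isCorrect_labelNode hG hT hR hx
          (fun c hc => (hchild c hc).1 _ (labelSubTree_finalLabel (hall c hc)))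
          (fun _ c hc => finalLabel_ne_empty (hall c hc))
      refine ⟨fun L hL => (labelSubTree_eq_some_iff.1 hL).2.1 ▸ hcorr, fun hnone => ?_⟩
      have hempty : labelNode B S R x (finalLabel B S R) = ∅ := by
        by_contra hne
        rw [labelSubTree_eq_some_iff.2 ⟨hall, rfl, hne⟩] at hnone
        cases hnone
      rintro ⟨M, hM⟩
      -- A robust set of `G` is good for every subtree. It selects `v(x)` or not, and either case
      -- puts a label into the correct set `L(x)`, which was empty.
      have hgood := ((isRMIS_iff_good hG hT hR).1 hM).of_mem_subtree hT hR (mem_subtree_root hT x)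
      obtain ⟨v, hv, -⟩ := exists_attach? hT hx
      obtain ⟨z, hz⟩ := exists_parent hT hx
      rw [hempty] at hcorr
      by_cases hvM : v ∈ M
      · simpa using hcorr.pi_mem hT hz hgood hv hvM
      · simpa using hcorr.po_or_pe_mem hT hz hgood hv hvM
    · refine ⟨fun L hL => absurd (labelSubTree_eq_some_iff.1 hL).1 hall, fun _ => ?_⟩
      push Not at hall
      obtain ⟨c, hc, hcn⟩ := hall
      exact (hchild c hc).2 hcn

theorem isCorrect_finalLabel {x : Node G} (hx : x ≠ R) (h : labelSubTree B S R x ≠ none) :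
    IsCorrect R x (finalLabel B S R x) :=
  (labelSubTree_correct hG hT hR x hx).1 _ (labelSubTree_finalLabel h)

/-- Every label requested of a child belongs to its label set, so the induction hypothesis applies
and the pieces glue. The inclusion in `G[T_x]` is carried along because gluing needs it. -/
theorem redescend_realizes (x : Node G) (hx : x ≠ R) (h : labelSubTree B S R x ≠ none)
    {l : Label} (hl : l ∈ finalLabel B S R x) : Realizes R x l (redescend B S R x (some l)) ∧
      redescend B S R x (some l) ⊆ (subtreeGraph R x).verts := by
  induction x using children_induction (R := R) generalizing l with
  | h x ih =>
    obtain ⟨hall, hlab, -⟩ := labelSubTree_eq_some_iff.1 (labelSubTree_finalLabel h)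
    have hch : ∀ c ∈ children R x, ∀ l ∈ finalLabel B S R c,
        Realizes R c l (redescend B S R c (some l)) ∧
          redescend B S R c (some l) ⊆ (subtreeGraph R c).verts :=
      fun c hc l hl => ih c hc (ne_root_of_mem_children hc) (hall c hc) hl
    rw [hlab] at hl
    rw [redescend]
    cases x with
    | pend p hp =>
      have hno : IsEmpty (children R (.pend p hp)) := by rw [children_pend hT hR]; infer_instance
      rw [Set.iUnion_of_empty, Set.union_empty]
      refine ⟨(realizes_pend_iff hT hR).2 ⟨?_, mem_labelNode_pend.1 hl⟩, ?_⟩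
      · simp [selected, attach?]
      · rintro w ⟨-, hw⟩
        exact attach?_mem_subtreeGraph hT hx hw
    | art a ha =>
      have hcl : ∀ c, childLabel B S R (.art a ha) (some l) c =
          if l = .PI then .PI else excludingLabel (finalLabel B S R) c := by
        intro c
        simp [childLabel, outLabel, excludingLabel]
      have hsel : selected B S R (.art a ha) (some l) = {w | l = .PI ∧ a = w} := by
        simp [selected, attach?]
      rw [hsel]
      simp only [hcl]
      obtain ⟨h1, h2, h3⟩ := glue_realizes hT hR (x := .art a ha) (X := {w | l = .PI ∧ a = w})
        (lab := fun c => if l = .PI then .PI else excludingLabel (finalLabel B S R) c)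
        (fun w hw => hw.2.symm) (by
          intro c hc v hv
          rw [attach?_child_art hT hc] at hv
          obtain rfl := Option.some.inj hv
          by_cases hl' : l = .PI <;> simp [hl', excludingLabel_ne])
        (fun c hc => (hch c hc _ (labelNode_art_child_mem hl hc)).2)
        (fun c hc => (hch c hc _ (labelNode_art_child_mem hl hc)).1)
      refine ⟨realizes_art_of_children hT hR hl ((h1 a rfl).trans ?_) h2, h3⟩
      simp
    | bridge e he =>
      obtain ⟨v, hv, -⟩ := exists_attach? hT hx
      obtain ⟨w, y, rfl, hvw, hy, hw⟩ := exists_bridge_child hG hT hx hv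
      have hyc : y ∈ children R (.bridge s(v, w) he) := hy ▸ rfl
      let lab : Node G → Label := fun c => if l = .PO then .PI
        else if l = .PI then excludingLabel (finalLabel B S R) c else .PO
      have hcl : ∀ c, childLabel B S R (.bridge s(v, w) he) (some l) c = lab c := by
        intro c
        simp [childLabel, outLabel, excludingLabel, lab]
      obtain ⟨hy1, hy2⟩ := hch y hyc (lab y) (labelNode_bridge_child_mem hy hl)
      have hwy : w ∈ redescend B S R y (some (lab y)) ↔ l = .PO := by
        rw [(hy1.2 w hw).1]
        cases l <;> simp [lab, excludingLabel_ne]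
      -- The bridge itself selects at most `v`; under PO the far end `w` is already selected below.
      -- Listing `w` as well leaves the union unchanged but describes both ends correctly, as gluing
      -- requires.
      have hunion : selected B S R (.bridge s(v, w) he) (some l) ∪
          ⋃ c : children R (.bridge s(v, w) he), redescend B S R c.1
            (some (childLabel B S R (.bridge s(v, w) he) (some l) c.1)) =
          {u | (l = .PI ∧ u = v) ∨ (l = .PO ∧ u = w)} ∪
            ⋃ c : children R (.bridge s(v, w) he), redescend B S R c.1 (some (lab c.1)) := by
        simp only [hcl]
        ext u
        simp only [selected, hv, Set.mem_union, Set.mem_ofPred_eq, Set.mem_iUnion,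
          Option.some.injEq]
        constructor
        · rintro (⟨h1, h2⟩ | h)
          exacts [.inl (.inl ⟨h1, h2.symm⟩), .inr h]
        · rintro ((⟨h1, h2⟩ | ⟨h1, rfl⟩) | h)
          exacts [.inl ⟨h1, h2.symm⟩, .inr ⟨⟨y, hyc⟩, hwy.2 h1⟩, .inr h]
      rw [hunion]
      obtain ⟨h1, h2, h3⟩ := glue_realizes hT hR (x := .bridge s(v, w) he)
        (X := {u | (l = .PI ∧ u = v) ∨ (l = .PO ∧ u = w)}) (lab := lab)
        (by
          rintro u (⟨-, rfl⟩ | ⟨-, rfl⟩)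
          exacts [Sym2.mem_mk_left _ _, Sym2.mem_mk_right _ _])
        (by
          intro c hc u hu
          obtain rfl : c = y := by simpa [hy] using hc
          obtain rfl := Option.some.inj (hw.symm.trans hu)
          cases l <;> simp [lab, excludingLabel_ne, hvw.symm])
        (m := fun c => redescend B S R c (some (lab c)))
        (fun c hc => by obtain rfl : c = y := by simpa [hy] using hc
                        exact hy2)
        (fun c hc => by obtain rfl : c = y := by simpa [hy] using hc
                        exact hy1)
      refine ⟨realizes_bridge_of_child hT hR hv hvw hy hw (f := finalLabel B S R)
        ((h1 v (Sym2.mem_mk_left v w)).trans ?_) (h2 y hyc), h3⟩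
      simp [hvw]
    | comp C hC =>
      obtain ⟨v, hv, hvC⟩ := exists_attach? hT hx
      have hcorr : ∀ c ∈ children R (.comp C hC), IsCorrect R c (finalLabel B S R c) := fun c hc =>
        isCorrect_finalLabel hG hT hR (ne_root_of_mem_children hc) (hall c hc)
      obtain ⟨X, hX⟩ := Option.isSome_iff_exists.1 ((mem_labelNode_comp hv hvC).1 hl).1
      have hset : componentSet B S R (.comp C hC) C (some l) = Subtype.val '' X := by
        have hvC' : v ∈ C.verts := hvC
        simp only [componentSet, hv, dif_pos hvC']
        cases l <;> simp only [labelsFor, flagFor] at hX <;> rw [hX] <;> rfl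
      obtain ⟨hfit, hXl⟩ := fits_of_solveComponent
        (labelsFor_not_both (vertexLabels_not_both hT hcorr)) hX
      have hL : ∀ w : C.verts, attach? R (.comp C hC) ≠ some w.1 →
          labelsFor (vertexLabels R (.comp C hC) (finalLabel B S R) C) ⟨v, hvC⟩ l w =
            vertexLabels R (.comp C hC) (finalLabel B S R) C w := by
        intro w hw
        refine labelsFor_of_ne ?_
        rintro rfl
        exact hw hv
      have hmem := fun c hc => child_label_mem_of_fits hG hT hL hfit
        (fun c hc => finalLabel_ne_empty (hall c hc)) (c := c) hc
      simp only [selected, childLabel, hset]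
      obtain ⟨h1, h2, h3⟩ := glue_realizes hT hR (x := .comp C hC) (X := Subtype.val '' X)
        (lab := fun c => if ∃ w ∈ Subtype.val '' X, c.vertex? = some w then .PI
          else excludingLabel (finalLabel B S R) c)
        (by rintro _ ⟨w, -, rfl⟩; exact w.2)
        (fun c hc v hv => mem_image_iff_child_label hc hv)
        (fun c hc => (hch c hc _ (hmem c hc)).2)
        (fun c hc => (hch c hc _ (hmem c hc)).1)
      exact ⟨realizes_comp_of_fits hG hT hR hx hv hvC hfit hXl h1 h2, h3⟩

end Algorithm

/-! ### Acceptance and output at the root -/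

section Root

open scoped Classical

variable {V : Type u} [Finite V] {G : SimpleGraph V} {B : BipartiteTest.{u}}
  {S : TwoSatSolver.{u}} (hG : G.Connected) (hT : (abcTree G).IsTree)
  {C : G.Subgraph} {hC : IsBiconnComp G C}

include hG hT

theorem accepts_of_isRMIS {M : Set V} (hM : IsRMIS G M) : Accepts B S C hC := by
  have hR : (Node.comp C hC).IsBlock := trivial
  have hall : ∀ x ∈ children (.comp C hC) (.comp C hC),
      labelSubTree B S (.comp C hC) x ≠ none := fun x hx hnone =>
    (labelSubTree_correct hG hT hR x (ne_root_of_mem_children hx)).2 hnone ⟨M, hM⟩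
  have hcorr := fun c hc => isCorrect_finalLabel (B := B) (S := S) hG hT hR
    (ne_root_of_mem_children hc) (hall c hc)
  have hroot : attach? (.comp C hC) (.comp C hC) = none := attach?_root hR
  refine ⟨hall, (isSatisfiable_iff (vertexLabels_not_both hT hcorr)).2
    ⟨Subtype.val ⁻¹' M, ?_, trivial⟩⟩
  refine fits_of_good hT hR hcorr ((isRMIS_iff_good hG hT hR).1 hM) (fun w _ => rfl)
    fun w hw => ?_
  rw [hroot] at hw
  cases hw

/-- The root solution and the sets realized at its children glue to a good set for the whole tree,
and at the root good means robust. -/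
theorem isRMIS_redescend (h : Accepts B S C hC) :
    IsRMIS G (redescend B S (.comp C hC) (.comp C hC) none) := by
  have hR : (Node.comp C hC).IsBlock := trivial
  obtain ⟨hall, hsat⟩ := h
  have hcorr := fun c hc => isCorrect_finalLabel (B := B) (S := S) hG hT hR
    (ne_root_of_mem_children hc) (hall c hc)
  obtain ⟨X, hX⟩ := Option.isSome_iff_exists.1 hsat
  have hset : componentSet B S (.comp C hC) (.comp C hC) C none = Subtype.val '' X := by
    simp only [componentSet, hX]
    rfl
  obtain ⟨hfit, -⟩ := fits_of_solveComponent (vertexLabels_not_both hT hcorr) hX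
  have hmem := fun c hc => child_label_mem_of_fits hG hT (fun w _ => rfl) hfit
    (fun c hc => finalLabel_ne_empty (hall c hc)) (c := c) hc
  have hch := fun c hc => redescend_realizes hG hT hR c (ne_root_of_mem_children hc) (hall c hc)
    (hmem c hc)
  rw [isRMIS_iff_good hG hT hR, redescend]
  simp only [selected, childLabel, hset]
  obtain ⟨h1, h2, -⟩ := glue_realizes hT hR (x := .comp C hC) (X := Subtype.val '' X)
    (by rintro _ ⟨w, -, rfl⟩; exact w.2)
    (fun c hc v hv => mem_image_iff_child_label hc hv)
    (fun c hc => (hch c hc).2) (fun c hc => (hch c hc).1)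
  exact good_of_fits hT hR (fun w _ => rfl) hfit h1 h2

theorem accepts_iff : Accepts B S C hC ↔ ∃ M, IsRMIS G M :=
  ⟨fun h => ⟨_, isRMIS_redescend hG hT h⟩, fun ⟨_, hM⟩ => accepts_of_isRMIS hG hT hM⟩

end Root

end RobustMIS

open RobustMIS in
theorem mainTheorem4 {V : Type*} [Finite V] (G : SimpleGraph V) (hG : G.Connected)
    (B : BipartiteTest) (S : TwoSatSolver) :
    -- graphs without biconnected components
    ((¬ ∃ C : G.Subgraph, IsBiconnComp G C) →
      G.IsTree ∧ (∃ M, IsRMIS G M) ∧ ∀ M, IsMIS G M → IsRMIS G M) ∧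
    -- the algorithm, for an arbitrary choice of the root component
    ∀ (C : G.Subgraph) (hC : IsBiconnComp G C),
      (abcTree G).IsTree ∧
      -- correctness of `isSatisfiable`
      (∀ D : G.Subgraph, IsBiconnComp G D → ∀ L : D.verts → Finset Label,
        (∀ w, ¬ (Label.PO ∈ L w ∧ Label.PE ∈ L w)) → ∀ flag : Flag D.verts,
          (IsSatisfiable B S D.coe L flag ↔ ∃ M, IsSuitable D.coe L M ∧ flag.Agrees M)) ∧
      -- correctness of the labeling rules
      (∀ x : Node G, x ≠ .comp C hC → ∀ f : Node G → Finset Label,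
        (∀ c ∈ children (.comp C hC) x, IsCorrect (.comp C hC) c (f c)) →
        ((∃ D hD, x = .comp D hD) → ∀ c ∈ children (.comp C hC) x, f c ≠ ∅) →
          IsCorrect (.comp C hC) x (labelNode B S (.comp C hC) x f)) ∧
      -- correctness of the bottom-up labeling
      (∀ x : Node G, x ≠ .comp C hC →
        (∀ L, labelSubTree B S (.comp C hC) x = some L → IsCorrect (.comp C hC) x L) ∧
        (labelSubTree B S (.comp C hC) x = none → ¬ ∃ M, IsRMIS G M)) ∧
      -- correctness of the decision algorithm
      (Accepts B S C hC ↔ ∃ M, IsRMIS G M) ∧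
      -- correctness of the constructive algorithm
      (∀ M, construct B S C hC = some M → IsRMIS G M) ∧
      (construct B S C hC = none → ¬ ∃ M, IsRMIS G M) := by
  refine ⟨fun h => ⟨isTree_of_no_isBiconnComp hG h, ?_, fun M hM =>
    hM.isRMIS_of_isTree (isTree_of_no_isBiconnComp hG h)⟩, fun C hC => ?_⟩
  · obtain ⟨M, hM⟩ := exists_isMIS (G := G)
    exact ⟨M, hM.isRMIS_of_isTree (isTree_of_no_isBiconnComp hG h)⟩
  have hR : (Node.comp C hC).IsBlock := trivial
  have hT := abcTree_isTree hG hR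
  refine ⟨hT, fun D hD L hL flag => ?_, fun x hx f hf hne => ?_, fun x hx => ?_,
    accepts_iff hG hT, fun M hM => ?_, fun hnone => ?_⟩
  · rw [isSatisfiable_iff hL, exists_isSuitable_iff hD.1]
  · exact isCorrect_labelNode hG hT hR hx hf hne
  · exact labelSubTree_correct hG hT hR x hx
  · rw [construct] at hM
    split_ifs at hM with h
    exact Option.some.inj hM ▸ isRMIS_redescend hG hT h
  · rw [construct] at hnone
    split_ifs at hnone with h
    exact fun hM => h ((accepts_iff hG hT).2 hM)
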